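/- For $k\ge 1$ and $\varepsilon\in(0,1]$, call a univariate mixture of $k$ Gaussians $F=\sum_{i=1}^k w_i\,\mathcal N(\mu_i,\sigma_i^2)$ (with $w_i\ge 0$, $\sum_i w_i=1$, $\sigma_i^2>0$) *$\varepsilon$-admissible* if $F$ has mean $0$ and variance in $[1/2,2]$, $w_i\ge\varepsilon$ for all $i$, and $|\mu_i-\mu_j|+|\sigma_i^2-\sigma_j^2|\ge\varepsilon$ for all $i\ne j$. For a mesh width $\gamma>0$, a *candidate* is a mixture of $k$ Gaussians $\tilde F=\sum_{i=1}^k\tilde w_i\,\mathcal N(\tilde\mu_i,\tilde\sigma_i^2)$ all of whose parameters $\tilde w_i,\tilde\mu_i,\tilde\sigma_i^2$ are integer multiples of $\gamma$, with $\tilde w_i\ge\varepsilon/2$, $\sum_i\tilde w_i=1$, $|\tilde\mu_i|\le 2/\varepsilon$, $0<\tilde\sigma_i^2\le 2/\varepsilon$, and $|\tilde\mu_i-\tilde\mu_j|+|\tilde\sigma_i^2-\tilde\sigma_j^2|\ge\varepsilon/2$ for $i\neq j$. Given $m$ samples $x_1,\dots,x_m\in\mathbb R$ and a tolerance $\alpha>0$,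 a candidate $\tilde F$ is a *match* if $\bigl|\mathbb E_{y\sim\tilde F}[y^j]-\frac1m\sum_{l=1}^m x_l^j\bigr|\le\alpha$ for all $j=1,\dots,4k-2$. **Corollary (Basic Univariate Algorithm).** There are a single algorithm, which takes as input $k\ge1$, $\varepsilon\in(0,1]$, $\delta\in(0,1]$ and access to a sample oracle (a program for a real random access machine with exact unit-cost real arithmetic and comparisons, and unit-cost sample requests), a sample size $m=m(k,\varepsilon,\delta)$, a tolerance $0<\alpha=\alpha(k,\varepsilon)\le\varepsilon$, a mesh width $\gamma=\gamma(k,\varepsilon)>0$, and numbers $C_k\in\mathbb R$, $a_k\in\mathbb N$ depending only on $k$, such that for all $k\ge1$ and $\varepsilon,\delta\in(0,1]$: 1. $1/\alpha$ and $1/\gamma$ are at most $C_k(1/\varepsilon)^{a_k}$, and $m\le C_k\bigl(\tfrac{1}{\varepsilon\delta}\bigr)^{a_k}$. 2. On every sequence of samples the algorithm draws exactly $m$ samples and halts after at most $C_k\bigl(\tfrac1{\varepsilon\delta}\bigr)^{a_k}$ steps; whenever a match exists, its output is a match. 3. If the samples are independent draws from an $\varepsilon$-admissible mixture $F=\sum_{i=1}^k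 w_i\,\mathcal N(\mu_i,\sigma_i^2)$, then with probability at least $1-\delta$ the output $(\hat w_i,\hat\mu_i,\hat\sigma_i^2)_{i=1}^k$ is a match and there is a permutation $\pi$ of $\{1,\dots,k\}$ with $$|w_i-\hat w_{\pi(i)}|\le\varepsilon,\qquad |\mu_i-\hat\mu_{\pi(i)}|\le\varepsilon,\qquad |\sigma_i^2-\hat\sigma_{\pi(i)}^2|\le\varepsilon\qquad\text{for all }i=1,\dots,k.$$ -/

import Mathlib

open MeasureTheory ProbabilityTheory

namespace UnivariateGMM

/-! ### Univariate mixtures of Gaussians -/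

/-- The parameters of `k` weighted univariate Gaussians: weights, means and variances
(`v i` is the variance `σ_i ^ 2`, not the standard deviation). -/
structure Params (k : ℕ) where
  w : Fin k → ℝ
  μ : Fin k → ℝ
  v : Fin k → ℝ

namespace Params

variable {k : ℕ}

/-- The parameters describe a mixture of (nondegenerate) Gaussians. -/
def IsGMM (F : Params k) : Prop :=
  (∀ i, 0 ≤ F.w i) ∧ ∑ i, F.w i = 1 ∧ ∀ i, 0 < F.v i

/-- The distribution `∑ i, w i * N(μ i, v i)` on the real line. -/
noncomputable def law (F : Params k) : Measure ℝ :=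
  ∑ i, ENNReal.ofReal (F.w i) • gaussianReal (F.μ i) (F.v i).toNNReal

/-- The `j`-th raw moment of the mixture. -/
noncomputable def rawMoment (F : Params k) (j : ℕ) : ℝ :=
  ∫ x, x ^ j ∂F.law

/-- The parameter distance `|μ i - μ j| + |v i - v j|` of two components. -/
def compDist (F : Params k) (i j : Fin k) : ℝ :=
  |F.μ i - F.μ j| + |F.v i - F.v j|

/-- All weights are at least `ε`, and any two components have parameter distance at least `ε`. -/
def IsSeparated (F : Params k) (ε : ℝ) : Prop :=
  (∀ i, ε ≤ F.w i) ∧ ∀ i j, i ≠ j → ε ≤ F.compDist i j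

/-- Up to a permutation of the components, all parameters of `G` agree with those of `F`
to within `ε`. -/
def Close (ε : ℝ) (F G : Params k) : Prop :=
  ∃ π : Equiv.Perm (Fin k), ∀ i,
    |F.w i - G.w (π i)| ≤ ε ∧ |F.μ i - G.μ (π i)| ≤ ε ∧ |F.v i - G.v (π i)| ≤ ε

/-- The candidates of the brute-force search: mixtures all of whose parameters are integer
multiples of the mesh width `γ`, with weights and parameter distances at least `ε / 2`, and with
means and variances bounded by `2 / ε` in absolute value. -/
def IsCandidate (ε γ : ℝ) (F : Params k) : Prop :=
  F.IsGMM ∧ F.IsSeparated (ε / 2) ∧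
    (∀ i, |F.μ i| ≤ 2 / ε ∧ |F.v i| ≤ 2 / ε) ∧
    ∀ i, (∃ z : ℤ, F.w i = z * γ) ∧ (∃ z : ℤ, F.μ i = z * γ) ∧ ∃ z : ℤ, F.v i = z * γ

end Params

/-- The `j`-th sample moment of the first `m` terms of the sequence `x` of samples. -/
noncomputable def sampleMoment (x : ℕ → ℝ) (m j : ℕ) : ℝ :=
  (∑ l ∈ Finset.range m, x l ^ j) / m

/-- `F` is a candidate of the brute-force search each of whose first `4 k - 2` moments agrees to
within `α` with the corresponding moment of the first `m` samples. -/
def IsMatch {k : ℕ} (ε α γ : ℝ) (x : ℕ → ℝ) (m : ℕ) (F : Params k) : Prop :=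
  F.IsCandidate ε γ ∧ ∀ j ∈ Finset.Icc 1 (4 * k - 2), |F.rawMoment j - sampleMoment x m j| ≤ α

/-! ### A real random access machine with a sample oracle

Programs work on natural number variables (used for counting and for addressing), on real
variables, and on real arrays.  The arithmetic operations on the reals are exact and have unit
cost; there is no rounding operation. -/

/-- The memory of the machine, and the number `pos` of samples drawn so far. -/
structure State where
  nat : ℕ → ℕ
  real : ℕ → ℝ
  arr : ℕ → ℕ → ℝ
  pos : ℕ

/-- The arithmetic operations on real variables. -/
inductive Op where
  | add
  | sub
  | mul
  | div

/-- The value of an arithmetic operation (division by zero gives zero). -/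
noncomputable def Op.eval : Op → ℝ → ℝ → ℝ
  | .add, a, b => a + b
  | .sub, a, b => a - b
  | .mul, a, b => a * b
  | .div, a, b => a / b

/-- The elementary instructions; the arguments `r`, `p`, `q`, `i` are names of variables and `a`
is the name of an array. -/
inductive Instr where
  | natConst (r : ℕ) (c : ℕ)
  | natAdd (r p q : ℕ)
  | natSub (r p q : ℕ)
  | realConst (r : ℕ) (c : ℤ)
  | realOp (op : Op) (r p q : ℕ)
  | load (r a i : ℕ)
  | store (a i r : ℕ)
  | sample (r : ℕ)

/-- The effect of an elementary instruction, where the sample oracle answers the successive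
requests with `x 0`, `x 1`, `x 2`, … -/
noncomputable def Instr.apply (x : ℕ → ℝ) (s : State) : Instr → State
  | .natConst r c => { s with nat := Function.update s.nat r c }
  | .natAdd r p q => { s with nat := Function.update s.nat r (s.nat p + s.nat q) }
  | .natSub r p q => { s with nat := Function.update s.nat r (s.nat p - s.nat q) }
  | .realConst r c => { s with real := Function.update s.real r (c : ℝ) }
  | .realOp op r p q => { s with real := Function.update s.real r (op.eval (s.real p) (s.real q)) }
  | .load r a i => { s with real := Function.update s.real r (s.arr a (s.nat i)) }
  | .store a i r =>
      { s with
        arr := Function.update s.arr a (Function.update (s.arr a) (s.nat i) (s.real r)) }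
  | .sample r => { s with real := Function.update s.real r (x s.pos), pos := s.pos + 1 }

/-- The tests: comparison of two natural number variables or of two real variables. -/
inductive Test where
  | natLe (p q : ℕ)
  | realLe (p q : ℕ)

/-- The outcome of a test. -/
def Test.holds (s : State) : Test → Prop
  | .natLe p q => s.nat p ≤ s.nat q
  | .realLe p q => s.real p ≤ s.real q

/-- Programs: elementary instructions, sequencing, branching and while-loops. -/
inductive Prog where
  | instr (i : Instr)
  | seq (c d : Prog)
  | cond (t : Test) (c d : Prog)
  | loop (t : Test) (c : Prog)

/-- `Exec x c s n s'`: with sample oracle `x`, the program `c` started in the state `s` halts in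
the state `s'` after exactly `n` steps.  Each elementary instruction and each evaluation of a test
is one step. -/
inductive Exec (x : ℕ → ℝ) : Prog → State → ℕ → State → Prop where
  | instr (i : Instr) (s : State) : Exec x (.instr i) s 1 (i.apply x s)
  | seq {c d : Prog} {s s' s'' : State} {m n : ℕ} :
      Exec x c s m s' → Exec x d s' n s'' → Exec x (.seq c d) s (m + n) s''
  | cond_true {t : Test} {c d : Prog} {s s' : State} {n : ℕ} :
      t.holds s → Exec x c s n s' → Exec x (.cond t c d) s (n + 1) s'
  | cond_false {t : Test} {c d : Prog} {s s' : State} {n : ℕ} :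
      ¬ t.holds s → Exec x d s n s' → Exec x (.cond t c d) s (n + 1) s'
  | loop_false {t : Test} {c : Prog} {s : State} :
      ¬ t.holds s → Exec x (.loop t c) s 1 s
  | loop_true {t : Test} {c : Prog} {s s' s'' : State} {m n : ℕ} :
      t.holds s → Exec x c s m s' → Exec x (.loop t c) s' n s'' →
      Exec x (.loop t c) s (m + n + 1) s''

/-- The machine is deterministic: the number of steps and the final state are determined by the
program, the initial state and the samples. -/
theorem Exec.deterministic {x : ℕ → ℝ} {c : Prog} {s s₁ s₂ : State} {n₁ n₂ : ℕ}
    (h₁ : Exec x c s n₁ s₁) (h₂ : Exec x c s n₂ s₂) : n₁ = n₂ ∧ s₁ = s₂ := by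
  induction h₁ generalizing n₂ s₂ with
  | instr i s => cases h₂; exact ⟨rfl, rfl⟩
  | seq _ _ ih ih' =>
    cases h₂ with
    | seq a b =>
      obtain ⟨rfl, rfl⟩ := ih a
      obtain ⟨rfl, rfl⟩ := ih' b
      exact ⟨rfl, rfl⟩
  | cond_true h _ ih =>
    cases h₂ with
    | cond_true _ a => obtain ⟨rfl, rfl⟩ := ih a; exact ⟨rfl, rfl⟩
    | cond_false h' _ => exact absurd h h'
  | cond_false h _ ih =>
    cases h₂ with
    | cond_true h' _ => exact absurd h' h
    | cond_false _ a => obtain ⟨rfl, rfl⟩ := ih a; exact ⟨rfl, rfl⟩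
  | loop_false h =>
    cases h₂ with
    | loop_false _ => exact ⟨rfl, rfl⟩
    | loop_true h' _ _ => exact absurd h' h
  | loop_true h _ _ ih ih' =>
    cases h₂ with
    | loop_false h' => exact absurd h h'
    | loop_true _ a b =>
      obtain ⟨rfl, rfl⟩ := ih a
      obtain ⟨rfl, rfl⟩ := ih' b
      exact ⟨rfl, rfl⟩

/-- The initial state on input `k`, `ε`, `δ`: the natural number variable `0` holds `k`, the real
variables `0` and `1` hold `ε` and `δ`, and everything else is zero. -/
noncomputable def inputState (k : ℕ) (ε δ : ℝ) : State where
  nat := Function.update 0 0 k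
  real := Function.update (Function.update 0 0 ε) 1 δ
  arr := 0
  pos := 0

/-- The output of a halted machine: the weights, means and variances are read off from the first
`k` cells of the arrays `0`, `1` and `2`. -/
def State.output (s : State) (k : ℕ) : Params k where
  w i := s.arr 0 i
  μ i := s.arr 1 i
  v i := s.arr 2 i

end UnivariateGMM

namespace UnivariateGMM

/-! ### Moments of Gaussians -/

/-! The algorithm searches a grid by brute force, so the content is identifiability: two separated
mixtures of k Gaussians whose moments up to order 4k-2 nearly agree have nearly the same parameters,
with polynomial dependence for fixed k.

The source of identifiability is that a signed combination of n+1 Gaussians has at most 2n sign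
changes (`exists_rootsPoly_combInt`). Lower all variances by the smallest one, so that one component
becomes a point mass. A double root at its mean hides it, the other n components are handled by
induction, and the convolution that restores the variances creates no sign changes. Indeed,
convolution with a Gaussian is a Laplace transform up to a positive factor and a rescaling, and
Rolle's theorem removes the roots one at a time (`not_alternates_laplace`). Sign changes of f are
recorded by a real-rooted polynomial r such that r f has constant sign; this still makes sense when
f has point masses.

The quantitative form is `abs_coeff_le_of_min_var`. Shift all variances so that the smallest is
tiny. If the moments up to order 2n are small, then the integral of |r f| = ± r f is small; as |r|
is bounded below on a bounded region away from short intervals around the roots, f has little mass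
there. A narrow bump at the mean of the narrowest component therefore integrates to almost nothing
against f, whereas separation makes this integral essentially a multiple of the coefficient of that
component. So that coefficient is small. Removing the component and repeating, with a coarser
tolerance each time, bounds all coefficients (`abs_coeff_le`).

For two mixtures F and G (`Params.close_of_moments`), apply this to F - G, which has at most 2k
components; this is where 4k-2 moments are needed. Components of F and G may be close without being
equal, so a pigeonhole argument over scales finds a T such that no distance between a component of F
and one of G lies between T^Q and T. Pairs closer than T^Q are merged, which hardly changes the
moments, and the rest is T-separated. All merged coefficients are then small, but an unmatched
component of F would keep its full weight; so the merging is a bijection with nearly equal weights.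

By Chebyshev's inequality the sample moments are within α/2 of the true ones with probability at
least 1-δ. Then rounding F to the grid gives a match (`Params.exists_isMatch`), and every match is
close to F (`Params.close_of_isMatch`). The remainder is a program enumerating the grid, whose
running time is polynomial for fixed k. -/

/-- The `j`-th moment of `N(μ, v)` as a polynomial in `μ` and `v`. -/
noncomputable def gaussMoment : ℕ → ℝ → ℝ → ℝ
  | 0, _, _ => 1
  | 1, μ, _ => μ
  | j + 2, μ, v => μ * gaussMoment (j + 1) μ v + (j + 1) * v * gaussMoment j μ v

/-- The moment generating function M satisfies M' = (μ + v t) M, and repeated differentiation of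
this equation gives the recursion. The parameter t is kept general so that the identity can be
differentiated; the moments themselves are the case t = 0. -/
theorem integral_pow_mul_exp_gaussianReal (μ : ℝ) (v : NNReal) (j : ℕ) (t : ℝ) :
    ∫ x, x ^ (j + 2) * Real.exp (t * x) ∂gaussianReal μ v =
      (μ + v * t) * ∫ x, x ^ (j + 1) * Real.exp (t * x) ∂gaussianReal μ v +
        (j + 1) * v * ∫ x, x ^ j * Real.exp (t * x) ∂gaussianReal μ v := by
  have hd (n : ℕ) (t : ℝ) := hasDerivAt_integral_pow_mul_exp_real (X := fun x : ℝ => x)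
    (μ := gaussianReal μ v) (t := t) (by simp) n
  have h0 : ∀ t : ℝ, ∫ x, x ^ 0 * Real.exp (t * x) ∂gaussianReal μ v =
      Real.exp (μ * t + v * t ^ 2 / 2) := by
    intro t
    have := congrFun (mgf_fun_id_gaussianReal (μ := μ) (v := v)) t
    simpa [mgf] using this
  have h1 : ∀ t : ℝ, ∫ x, x ^ 1 * Real.exp (t * x) ∂gaussianReal μ v =
      (μ + v * t) * ∫ x, x ^ 0 * Real.exp (t * x) ∂gaussianReal μ v := by
    intro t
    have h := hd 0 t
    rw [funext h0] at h
    have h' : HasDerivAt (fun t : ℝ => Real.exp (μ * t + v * t ^ 2 / 2))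
        (Real.exp (μ * t + v * t ^ 2 / 2) * (μ * 1 + v * (2 * t) / 2)) t := by
      have := (((hasDerivAt_id t).const_mul μ).add
        ((((hasDerivAt_id t).pow 2).const_mul (v : ℝ)).div_const 2)).exp
      refine (this.congr_deriv ?_).congr_of_eventuallyEq (Filter.Eventually.of_forall ?_)
      · simp
      · intro x
        simp
    have h2 := h.unique h'
    simp only [zero_add] at h2
    rw [h0, h2]
    ring
  induction j generalizing t with
  | zero =>
    have h := hd 1 t
    rw [funext h1] at h
    have h' := ((hasDerivAt_id t).const_mul (v : ℝ)).const_add μ |>.mul (hd 0 t)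
    simp only [Nat.reduceAdd, zero_add, id] at h h' ⊢
    rw [h.unique h']
    push_cast
    ring
  | succ j ih =>
    have h := hd (j + 2) t
    rw [funext ih] at h
    have h' := (((hasDerivAt_id t).const_mul (v : ℝ)).const_add μ |>.mul (hd (j + 1) t)).add
      ((hd j t).const_mul ((j + 1 : ℝ) * v))
    rw [show j + 1 + 2 = j + 2 + 1 from rfl, h.unique h']
    push_cast
    simp only [id]
    ring

theorem integral_pow_gaussianReal (μ : ℝ) (v : NNReal) (j : ℕ) :
    ∫ x, x ^ j ∂gaussianReal μ v = gaussMoment j μ v := by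
  induction j using Nat.twoStepInduction with
  | zero => simp [gaussMoment]
  | one => simp [gaussMoment]
  | more j h h' =>
    have := integral_pow_mul_exp_gaussianReal μ v j 0
    simp only [zero_mul, Real.exp_zero, mul_one, mul_zero, add_zero, h, h'] at this
    rw [this, gaussMoment]

theorem integrable_pow_gaussianReal (μ : ℝ) (v : NNReal) (j : ℕ) :
    Integrable (fun x => x ^ j) (gaussianReal μ v) :=
  integrable_pow_of_mem_interior_integrableExpSet (X := fun x : ℝ => x) (by simp) j

theorem integrable_eval_gaussianReal (μ : ℝ) (v : NNReal) (p : Polynomial ℝ) :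
    Integrable (fun x => p.eval x) (gaussianReal μ v) := by
  simp only [Polynomial.eval_eq_sum_range]
  exact integrable_finsetSum _ fun i _ => (integrable_pow_gaussianReal μ v i).const_mul _

/-- The heat equation: the derivative of a Gaussian expectation in the variance is half the
expectation of the second derivative. -/
theorem hasDerivAt_gaussMoment (μ : ℝ) (j : ℕ) (v : ℝ) :
    HasDerivAt (fun v => gaussMoment (j + 2) μ v)
      ((j + 1) * (j + 2) / 2 * gaussMoment j μ v) v := by
  have base0 : HasDerivAt (fun v => gaussMoment 2 μ v) 1 v := by
    have := ((hasDerivAt_id v).const_add (μ * μ))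
    simpa [gaussMoment] using this
  have base1 : HasDerivAt (fun v => gaussMoment 3 μ v) (3 * μ) v := by
    have := (((hasDerivAt_id v).const_add (μ * μ)).const_mul μ).add
      (((hasDerivAt_id v).const_mul 2).mul_const μ)
    refine (this.congr_deriv (by ring)).congr_of_eventuallyEq (Filter.Eventually.of_forall ?_)
    intro x
    simp [gaussMoment]
    norm_num
  induction j using Nat.twoStepInduction with
  | zero => simpa [gaussMoment] using base0
  | one =>
    refine base1.congr_deriv ?_
    simp [gaussMoment]; norm_num
  | more j h h' =>
    have e : (fun v => gaussMoment (j + 2 + 2) μ v) = fun v =>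
      μ * gaussMoment (j + 1 + 2) μ v + (((j + 2 : ℕ) : ℝ) + 1) * v * gaussMoment (j + 2) μ v := by
      funext v; rw [gaussMoment]
    rw [e]
    refine ((h'.const_mul μ).add (((hasDerivAt_id v).const_mul (((j + 2 : ℕ) : ℝ) + 1)).mul
      h)).congr_deriv ?_
    simp only [id, mul_one]
    rw [gaussMoment]
    push_cast
    ring

/-- The conditions on K make each of the two terms of the recursion at most K ^ (j + 2) / 4. -/
theorem abs_gaussMoment_le {R K : ℝ} {J : ℕ} (hR : 0 ≤ R) (hRK : 4 * R ≤ K)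
    (hJK : 4 * (J * R) ≤ K ^ 2) (hK : 4 ≤ K) {μ v : ℝ} (hμ : |μ| ≤ R) (hv : |v| ≤ R)
    {j : ℕ} (hj : j ≤ J) : |gaussMoment j μ v| ≤ K ^ j := by
  induction j using Nat.twoStepInduction with
  | zero => simp [gaussMoment]
  | one => simp [gaussMoment]; linarith
  | more j h h' =>
    have h := h (by omega)
    have h' := h' (by omega)
    have hj' : ((j : ℝ) + 1) ≤ J := by exact_mod_cast (by omega : j + 1 ≤ J)
    have hp : 0 ≤ K ^ j := by positivity
    rw [gaussMoment]
    have h1 : |μ * gaussMoment (j + 1) μ v| ≤ R * K ^ (j + 1) := by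
      rw [abs_mul]; gcongr
    have h2 : |(j + 1) * v * gaussMoment j μ v| ≤ (J * R) * K ^ j := by
      rw [abs_mul, abs_mul, abs_of_nonneg (by positivity : (0 : ℝ) ≤ j + 1)]; gcongr
    calc _ ≤ _ := abs_add_le _ _
      _ ≤ R * K ^ (j + 1) + (J * R) * K ^ j := add_le_add h1 h2
      _ ≤ (K / 4) * K ^ (j + 1) + (K ^ 2 / 4) * K ^ j := by gcongr <;> linarith
      _ ≤ K ^ (j + 2) := by
        have : 0 ≤ K ^ (j + 2) := by positivity
        rw [show (K / 4) * K ^ (j + 1) + (K ^ 2 / 4) * K ^ j = K ^ (j + 2) / 2 by ring]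
        linarith

/-- Expanding the difference of the recursions by the product rule gives four terms, each at most a
quarter of the bound. -/
theorem abs_gaussMoment_sub_le {R K : ℝ} {J : ℕ} (hR : 0 ≤ R) (hRK : 4 * R ≤ K)
    (hJK : 4 * (J * R) ≤ K ^ 2) (hJK' : 4 * (J : ℝ) ≤ K ^ 2) (hK : 4 ≤ K) {μ v μ' v' : ℝ}
    (hμ : |μ| ≤ R) (hv : |v| ≤ R) (hμ' : |μ'| ≤ R) (hv' : |v'| ≤ R) {j : ℕ} (hj : j ≤ J) :
    |gaussMoment j μ v - gaussMoment j μ' v'| ≤ (|μ - μ'| + |v - v'|) * K ^ j := by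
  induction j using Nat.twoStepInduction with
  | zero => simp [gaussMoment]; positivity
  | one =>
    simp only [gaussMoment, pow_one]
    have := abs_nonneg (μ - μ')
    have := abs_nonneg (v - v')
    nlinarith
  | more j h h' =>
    have h := h (by omega)
    have h' := h' (by omega)
    have hj' : ((j : ℝ) + 1) ≤ J := by exact_mod_cast (by omega : j + 1 ≤ J)
    have hp : 0 ≤ K ^ j := by positivity
    set Δ := |μ - μ'| + |v - v'| with hΔ
    have hΔ1 : |μ - μ'| ≤ Δ := by linarith [abs_nonneg (v - v')]
    have hΔ2 : |v - v'| ≤ Δ := by linarith [abs_nonneg (μ - μ')]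
    have hΔ0 : 0 ≤ Δ := by positivity
    have b1 := abs_gaussMoment_le hR hRK hJK hK hμ' hv' (j := j + 1) (by omega)
    have b0 := abs_gaussMoment_le hR hRK hJK hK hμ' hv' (j := j) (by omega)
    rw [gaussMoment, gaussMoment]
    have e : μ * gaussMoment (j + 1) μ v + (j + 1) * v * gaussMoment j μ v -
        (μ' * gaussMoment (j + 1) μ' v' + (j + 1) * v' * gaussMoment j μ' v') =
        (μ * (gaussMoment (j + 1) μ v - gaussMoment (j + 1) μ' v') +
          (μ - μ') * gaussMoment (j + 1) μ' v') +
        ((j + 1) * v * (gaussMoment j μ v - gaussMoment j μ' v') +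
          (j + 1) * (v - v') * gaussMoment j μ' v') := by ring
    have hj0 : |(j : ℝ) + 1| ≤ J := by rwa [abs_of_nonneg (by positivity)]
    rw [e]
    have h1 : |μ * (gaussMoment (j + 1) μ v - gaussMoment (j + 1) μ' v')| ≤
        R * (Δ * K ^ (j + 1)) := by rw [abs_mul]; gcongr
    have h2 : |(μ - μ') * gaussMoment (j + 1) μ' v'| ≤ Δ * K ^ (j + 1) := by
      rw [abs_mul]; gcongr
    have h3 : |(j + 1) * v * (gaussMoment j μ v - gaussMoment j μ' v')| ≤
        (J * R) * (Δ * K ^ j) := by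
      rw [abs_mul, abs_mul]; gcongr
    have h4 : |(j + 1) * (v - v') * gaussMoment j μ' v'| ≤ (J * Δ) * K ^ j := by
      rw [abs_mul, abs_mul]; gcongr
    have hk1 : Δ * K ^ (j + 1) ≤ Δ * K ^ (j + 2) / 4 := by
      have : 0 ≤ Δ * K ^ (j + 1) := by positivity
      rw [pow_succ K (j + 1)]; nlinarith
    refine ((abs_add_le _ _).trans (add_le_add (abs_add_le _ _) (abs_add_le _ _))).trans ?_
    calc _ ≤ (R * (Δ * K ^ (j + 1)) + Δ * K ^ (j + 1)) +
          ((J * R) * (Δ * K ^ j) + (J * Δ) * K ^ j) :=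
        add_le_add (add_le_add h1 h2) (add_le_add h3 h4)
      _ ≤ ((K / 4) * (Δ * K ^ (j + 1)) + Δ * K ^ (j + 2) / 4) +
          ((K ^ 2 / 4) * (Δ * K ^ j) + ((K ^ 2 / 4) * Δ) * K ^ j) := by
        gcongr <;> linarith
      _ = Δ * K ^ (j + 2) := by ring

/-- Moments of a signed combination of Gaussians stay small when all variances are shifted. -/
theorem abs_sum_gaussMoment_shift_le {ι : Type*} (S : Finset ι) (c μ v : ι → ℝ) {e R K : ℝ}
    {J : ℕ} (he : 0 ≤ e) (hR : 0 ≤ R) (hK : 1 ≤ K) (hJK : R * J ^ 2 ≤ K ^ 2)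
    (h0 : ∀ j ≤ J, |∑ i ∈ S, c i * gaussMoment j (μ i) (v i)| ≤ e) {j : ℕ} (hj : j ≤ J) {s : ℝ}
    (hs : |s| ≤ R) : |∑ i ∈ S, c i * gaussMoment j (μ i) (v i + s)| ≤ e * K ^ j * 2 ^ j := by
  induction j using Nat.strong_induction_on generalizing s with
  | _ j ih =>
    match j, ih, hj with
    | 0, _, _ => simpa [gaussMoment] using h0 0 (by omega)
    | 1, _, hj =>
      have := h0 1 hj
      simp only [gaussMoment] at this ⊢
      nlinarith
    | j + 2, ih, hj =>
      have hJ : ((j : ℝ) + 2) ≤ J := by exact_mod_cast hj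
      have hd : ∀ x : ℝ, HasDerivAt (fun s => ∑ i ∈ S, c i * gaussMoment (j + 2) (μ i) (v i + s))
          (∑ i ∈ S, c i * ((j + 1) * (j + 2) / 2 * gaussMoment j (μ i) (v i + x))) x := by
        intro x
        refine HasDerivAt.fun_sum fun i _ => HasDerivAt.const_mul _ ?_
        have := (hasDerivAt_gaussMoment (μ i) j (v i + x)).comp x
          ((hasDerivAt_id x).const_add (v i))
        simpa [Function.comp_def] using this
      have hb : ∀ x ∈ Set.Icc (-R) R,
          ‖∑ i ∈ S, c i * ((j + 1) * (j + 2) / 2 * gaussMoment j (μ i) (v i + x))‖ ≤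
            J ^ 2 * (e * K ^ j * 2 ^ j) := by
        intro x hx
        have := ih j (by omega) (by omega) (abs_le.mpr hx)
        have e1 : ∑ i ∈ S, c i * ((j + 1) * (j + 2) / 2 * gaussMoment j (μ i) (v i + x)) =
            ((j + 1) * (j + 2) / 2) * ∑ i ∈ S, c i * gaussMoment j (μ i) (v i + x) := by
          rw [Finset.mul_sum]; exact Finset.sum_congr rfl fun i _ => by ring
        rw [e1, Real.norm_eq_abs, abs_mul, abs_of_nonneg (by positivity)]
        gcongr
        nlinarith
      -- By the heat equation the derivative in s of moment j + 2 is a multiple of moment j, which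
      -- the induction controls on all of [-R, R]. The factor 4 = 2 ^ (j + 2) / 2 ^ j leaves room
      -- for the value at s = 0 plus this increment.
      have hmv := Convex.norm_image_sub_le_of_norm_hasDerivWithin_le
        (fun x _ => (hd x).hasDerivWithinAt) hb (convex_Icc _ _)
        (x := 0) (y := s) ⟨by linarith, hR⟩ (abs_le.mp hs)
      simp only [Real.norm_eq_abs, add_zero, sub_zero] at hmv
      have h1 := h0 (j + 2) hj
      have hA := abs_sub_abs_le_abs_sub (∑ i ∈ S, c i * gaussMoment (j + 2) (μ i) (v i + s))
        (∑ i ∈ S, c i * gaussMoment (j + 2) (μ i) (v i))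
      have hP : (1 : ℝ) ≤ K ^ (j + 2) := one_le_pow₀ hK
      have h2 : (1 : ℝ) ≤ 2 ^ j := one_le_pow₀ (by norm_num)
      have h3 : J ^ 2 * (e * K ^ j * 2 ^ j) * |s| ≤ e * K ^ (j + 2) * 2 ^ j := by
        calc J ^ 2 * (e * K ^ j * 2 ^ j) * |s| ≤ J ^ 2 * (e * K ^ j * 2 ^ j) * R := by gcongr
          _ = (R * J ^ 2) * (e * K ^ j * 2 ^ j) := by ring
          _ ≤ K ^ 2 * (e * K ^ j * 2 ^ j) := by gcongr
          _ = _ := by ring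
      have h4 : e ≤ e * K ^ (j + 2) * 2 ^ j := by
        have := mul_le_mul hP h2 (by norm_num) (by positivity)
        nlinarith
      have h5 : e * K ^ (j + 2) * 2 ^ (j + 2) = 4 * (e * K ^ (j + 2) * 2 ^ j) := by ring
      have : 0 ≤ e * K ^ (j + 2) * 2 ^ j := by positivity
      linarith

/-- The Gaussian expectation of a Gaussian bump. -/
theorem integral_bump_gaussianReal (μ a : ℝ) (v : NNReal) {s : ℝ} (hs : 0 < s) :
    ∫ y, Real.exp (-(y - a) ^ 2 / (2 * s)) ∂gaussianReal μ v =
      √(s / (s + v)) * Real.exp (-(μ - a) ^ 2 / (2 * (s + v))) := by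
  rcases eq_or_ne v 0 with rfl | hv
  · rw [gaussianReal_zero_var, integral_dirac]
    simp [hs.ne']
  have hv' : (0 : ℝ) < v := by positivity
  obtain ⟨u, hucoe⟩ : ∃ u : NNReal, (u : ℝ) = s * v / (s + v) :=
    ⟨⟨s * v / (s + v), by positivity⟩, rfl⟩
  have hu0 : (0 : ℝ) < s * v / (s + v) := by positivity
  have hu' : u ≠ 0 := fun h => hu0.ne' (by rw [← hucoe, h, NNReal.coe_zero])
  obtain ⟨m, hm⟩ : ∃ m : ℝ, m = (s * μ + v * a) / (s + v) := ⟨_, rfl⟩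
  rw [integral_gaussianReal_eq_integral_smul hv]
  -- Completing the square: the product of the bump and the density is a multiple of the density
  -- with mean m and variance u.
  have key : ∀ y, gaussianPDFReal μ v y • Real.exp (-(y - a) ^ 2 / (2 * s)) =
      (√(s / (s + v)) * Real.exp (-(μ - a) ^ 2 / (2 * (s + v)))) * gaussianPDFReal m u y := by
    intro y
    simp only [gaussianPDFReal_def, smul_eq_mul]
    have h1 : Real.exp (-(y - μ) ^ 2 / (2 * v)) * Real.exp (-(y - a) ^ 2 / (2 * s)) =
        Real.exp (-(μ - a) ^ 2 / (2 * (s + v))) * Real.exp (-(y - m) ^ 2 / (2 * u)) := by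
      rw [← Real.exp_add, ← Real.exp_add]
      congr 1
      rw [hucoe, hm]
      field_simp
      ring
    have h2 : (√(2 * Real.pi * v))⁻¹ = √(s / (s + v)) * (√(2 * Real.pi * u))⁻¹ := by
      rw [← Real.sqrt_inv, ← Real.sqrt_inv, ← Real.sqrt_mul (by positivity)]
      congr 1
      rw [hucoe]
      field_simp
    rw [mul_assoc, h1, h2]
    ring
  simp_rw [key]
  rw [integral_const_mul, integral_gaussianPDFReal_eq_one m hu', mul_one]

/-! ### Sign changes -/

/-- The function `f` has at least `n` sign changes, the first of them starting at `a`. -/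
def Alternates (f : ℝ → ℝ) : ℕ → ℝ → Prop
  | 0, _ => True
  | n + 1, a => ∃ b, a < b ∧ f a * f b < 0 ∧ Alternates f n b

theorem Alternates.of_succ {f : ℝ → ℝ} {n : ℕ} {a : ℝ} (h : Alternates f (n + 1) a) :
    Alternates f n a := by
  induction n generalizing a with
  | zero => trivial
  | succ n ih =>
    obtain ⟨b, h1, h2, h3⟩ := h
    exact ⟨b, h1, h2, ih h3⟩

/-- Only the signs of products matter. As S is closed to the right, it contains all alternation
points once it contains the first. -/
theorem Alternates.congr {f g : ℝ → ℝ} {S : Set ℝ} (hS : ∀ x ∈ S, ∀ y, x < y → y ∈ S)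
    (hfg : ∀ x ∈ S, ∀ y ∈ S, f x * f y < 0 → g x * g y < 0) {n : ℕ} {a : ℝ} (ha : a ∈ S)
    (h : Alternates f n a) : Alternates g n a := by
  induction n generalizing a with
  | zero => trivial
  | succ n ih =>
    obtain ⟨b, h1, h2, h3⟩ := h
    have hb := hS a ha b h1
    exact ⟨b, h1, hfg a ha b hb h2, ih hb h3⟩

theorem mul_neg_of_mul_neg_of_mul_neg {a b c : ℝ} (h1 : a * b < 0) (h2 : b * c < 0) :
    0 < a * c := by
  rcases mul_neg_iff.mp h1 with ⟨h, h'⟩ | ⟨h, h'⟩ <;>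
  rcases mul_neg_iff.mp h2 with ⟨k, k'⟩ | ⟨k, k'⟩ <;>
  first
  | exact mul_pos h k'
  | exact mul_pos_of_neg_of_neg h k'
  | linarith

/-- Rolle's theorem for sign changes. -/
theorem Alternates.deriv {u u' : ℝ → ℝ} (hu : ∀ x, HasDerivAt u (u' x) x) {n : ℕ} {a : ℝ}
    (h : Alternates u (n + 1) a) : ∃ y, a < y ∧ u a * u' y < 0 ∧ Alternates u' n y := by
  -- The derivative takes a value of sign opposite to u a between a and b. Remembering this sign
  -- through the induction is what makes consecutive derivative points alternate.
  have mvt : ∀ a b, a < b → u a * u b < 0 → ∃ y, a < y ∧ y < b ∧ u a * u' y < 0 := by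
    intro a b hab h
    obtain ⟨y, hy, e⟩ := exists_hasDerivAt_eq_slope u u' hab
      (fun x _ => (hu x).continuousAt.continuousWithinAt) (fun x _ => hu x)
    refine ⟨y, hy.1, hy.2, ?_⟩
    rw [e, ← mul_div_assoc]
    refine div_neg_of_neg_of_pos ?_ (by linarith)
    nlinarith [mul_self_nonneg (u a)]
  induction n generalizing a with
  | zero =>
    obtain ⟨b, h1, h2, -⟩ := h
    obtain ⟨y, h3, -, h4⟩ := mvt a b h1 h2
    exact ⟨y, h3, h4, trivial⟩
  | succ n ih =>
    obtain ⟨b, h1, h2, h3⟩ := h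
    obtain ⟨y, h4, h5, h6⟩ := mvt a b h1 h2
    obtain ⟨y', h7, h8, h9⟩ := ih h3
    refine ⟨y, h4, h6, y', h5.trans h7, ?_, h9⟩
    have h10 := mul_neg_of_mul_neg_of_mul_neg (by rwa [mul_comm] at h6) h2
    rcases mul_neg_iff.mp h8 with ⟨k, k'⟩ | ⟨k, k'⟩
    · exact mul_neg_of_pos_of_neg (by_contra fun h => by nlinarith) k'
    · exact mul_neg_of_neg_of_pos (by_contra fun h => by nlinarith) k'

/-- The monic real-rooted polynomial with the given list of roots. -/
noncomputable def rootsPoly (l : List ℝ) : Polynomial ℝ :=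
  (l.map fun z => Polynomial.X - Polynomial.C z).prod

theorem rootsPoly_nil : rootsPoly [] = 1 := rfl

theorem rootsPoly_cons (z : ℝ) (l : List ℝ) :
    rootsPoly (z :: l) = (Polynomial.X - Polynomial.C z) * rootsPoly l := by
  simp [rootsPoly]

theorem eval_rootsPoly_cons (z x : ℝ) (l : List ℝ) :
    (rootsPoly (z :: l)).eval x = (x - z) * (rootsPoly l).eval x := by
  simp [rootsPoly_cons]

/-- A function with at most `n` sign changes has the sign of a real-rooted polynomial of degree at
most `n`. -/
theorem exists_rootsPoly_of_not_alternates {n : ℕ} {f : ℝ → ℝ}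
    (h : ∀ a, ¬ Alternates f (n + 1) a) :
    ∃ l : List ℝ, l.length ≤ n ∧ ∃ σ : ℝ, (σ = 1 ∨ σ = -1) ∧
      ∀ x, 0 ≤ σ * ((rootsPoly l).eval x * f x) := by
  induction n generalizing f with
  | zero =>
    refine ⟨[], le_rfl, ?_⟩
    simp only [rootsPoly_nil, Polynomial.eval_one, one_mul]
    have hh : ∀ x y, 0 ≤ f x * f y := by
      intro x y
      rcases lt_trichotomy x y with hxy | rfl | hxy
      · exact not_lt.mp fun hlt => h x ⟨y, hxy, hlt, trivial⟩
      · exact mul_self_nonneg _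
      · rw [mul_comm]; exact not_lt.mp fun hlt => h y ⟨x, hxy, hlt, trivial⟩
    by_cases hn : ∃ x, f x < 0
    · obtain ⟨x, hx⟩ := hn
      exact ⟨-1, Or.inr rfl, fun y => by nlinarith [hh x y]⟩
    · push Not at hn
      exact ⟨1, Or.inl rfl, fun y => by simpa using hn y⟩
  | succ n ih =>
    by_cases hA : ∀ a, ¬ Alternates f (n + 1) a
    · obtain ⟨l, hl, h⟩ := ih hA
      exact ⟨l, by omega, h⟩
    push Not at hA
    obtain ⟨x₀, hx₀⟩ := hA
    -- It is enough to find the first sign change z: multiplying by x - z removes one change.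
    -- Passing to -f if necessary, f is positive at x₀.
    suffices H : ∀ f : ℝ → ℝ, (∀ a, ¬ Alternates f (n + 1 + 1) a) → Alternates f (n + 1) x₀ →
        0 < f x₀ → ∃ z, ∀ a, ¬ Alternates (fun x => (x - z) * f x) (n + 1) a by
      obtain ⟨z, hz⟩ : ∃ z, ∀ a, ¬ Alternates (fun x => (x - z) * f x) (n + 1) a := by
        have h0 : f x₀ ≠ 0 := by
          obtain ⟨b, -, h2, -⟩ := hx₀
          rintro h0
          simp [h0] at h2
        rcases lt_or_gt_of_ne h0 with h0 | h0
        · have hneg : ∀ g : ℝ → ℝ, ∀ n a, Alternates (fun x => - g x) n a → Alternates g n a :=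
            fun g n a => Alternates.congr (S := Set.univ) (by simp) (by simp) (by simp)
          obtain ⟨z, hz⟩ := H (fun x => - f x) (fun a ha => h a (hneg _ _ _ ha))
            (hneg (fun x => - f x) _ _ (by simpa using hx₀)) (by simpa using h0)
          refine ⟨z, fun a ha => hz a ?_⟩
          refine Alternates.congr (S := Set.univ) (by simp) ?_ (by simp) ha
          intro x _ y _ h
          nlinarith
        · exact H f h hx₀ h0
      obtain ⟨l, hl, σ, hσ, hl'⟩ := ih hz
      refine ⟨z :: l, by simpa using hl, σ, hσ, fun x => ?_⟩
      rw [eval_rootsPoly_cons]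
      have := hl' x
      nlinarith
    clear h hx₀ f
    intro f h hx₀ hpos
    -- A negative value to the left of x₀ would prepend one sign change too many.
    have hleft : ∀ u < x₀, 0 ≤ f u := by
      intro u hu
      by_contra hneg
      push Not at hneg
      exact h u ⟨x₀, hu, mul_neg_of_neg_of_pos hneg hpos, hx₀⟩
    obtain ⟨x₁, hx₁, hneg, -⟩ := hx₀
    have hneg : f x₁ < 0 := by nlinarith
    -- The supremum z of Y is the first sign change of f: nonnegative values to its left, and
    -- negative values arbitrarily close to it or at it.
    set Y : Set ℝ := {y | ∀ u ≤ y, 0 ≤ f u} with hY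
    have hYx₀ : x₀ ∈ Y := by
      intro u hu
      rcases hu.lt_or_eq with hu | rfl
      · exact hleft u hu
      · exact hpos.le
    have hYb : BddAbove Y := ⟨x₁, fun y hy => by
      by_contra hlt
      push Not at hlt
      exact absurd (hy x₁ hlt.le) (not_le.mpr hneg)⟩
    set z := sSup Y with hz
    have hx₀z : x₀ ≤ z := le_csSup hYb hYx₀
    have hlt : ∀ u < z, 0 ≤ f u := by
      intro u hu
      obtain ⟨y, hy, huy⟩ := exists_lt_of_lt_csSup ⟨x₀, hYx₀⟩ hu
      exact hy u huy.le
    have hgt : ∀ y > z, ∃ u, x₀ < u ∧ u < y ∧ f u < 0 := by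
      intro y hy
      have : (z + y) / 2 ∉ Y := fun hmem => by
        have := le_csSup hYb hmem
        linarith
      simp only [hY, Set.mem_ofPred_eq, not_forall, not_le] at this
      obtain ⟨u, hu, hfu⟩ := this
      refine ⟨u, ?_, by linarith, hfu⟩
      by_contra hle
      exact absurd (hYx₀ u (not_lt.mp hle)) (not_le.mpr hfu)
    have hup : ∀ n a, z < a → Alternates (fun x => (x - z) * f x) n a → Alternates f n a := by
      intro n a ha
      refine Alternates.congr (S := Set.Ioi z) (fun x hx y hxy => lt_trans hx hxy) ?_ ha
      intro x hx y hy hlt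
      have h1 : 0 < (x - z) * (y - z) := mul_pos (sub_pos.mpr hx) (sub_pos.mpr hy)
      by_contra hge
      push Not at hge
      have := mul_nonneg h1.le hge
      nlinarith
    refine ⟨z, fun a ha => ?_⟩
    have ha' := ha
    obtain ⟨b, hab, hprod, hb⟩ := ha
    simp only at hprod
    -- In each case n + 1 changes of (x - z) f yield n + 2 changes of f starting at x₀. If a < z,
    -- the next point b lies beyond z with f b > 0, and x₀ together with a negative point before b
    -- replaces a. If a > z, the signs of f alternate along the same points, and x₀, if necessary
    -- with a negative point before a, goes in front.
    rcases lt_trichotomy a z with haz | rfl | haz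
    · have h1 : (a - z) * f a ≤ 0 := mul_nonpos_of_nonpos_of_nonneg (by linarith) (hlt a haz)
      have h2 : 0 < (b - z) * f b := by
        by_contra hle
        push Not at hle
        nlinarith
      have hbz : z < b := by
        by_contra hle
        push Not at hle
        rcases hle.lt_or_eq with hlt' | rfl
        · have := mul_nonpos_of_nonpos_of_nonneg (sub_nonpos.mpr hle) (hlt b hlt')
          linarith
        · simp at h2
      have hfb : 0 < f b := (mul_pos_iff_of_pos_left (by linarith)).mp h2
      obtain ⟨u, hu1, hu2, hu3⟩ := hgt b hbz
      exact h x₀ ⟨u, hu1, mul_neg_of_pos_of_neg hpos hu3, b, hu2, mul_neg_of_neg_of_pos hu3 hfb,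
        hup n b hbz hb⟩
    · simp at hprod
    · have hf := hup _ a haz ha'
      have h0 : f a ≠ 0 := by rintro h0; simp [h0] at hprod
      rcases lt_or_gt_of_ne h0 with h0 | h0
      · exact h x₀ ⟨a, by linarith, mul_neg_of_pos_of_neg hpos h0, hf⟩
      · obtain ⟨u, hu1, hu2, hu3⟩ := hgt a haz
        refine h x₀ (Alternates.of_succ ⟨u, hu1, mul_neg_of_pos_of_neg hpos hu3, a, hu2,
          mul_neg_of_neg_of_pos hu3 h0, hf⟩)

/-! ### Test functions and Laplace transforms of signed combinations -/

/-- Functions whose products with polynomials are integrable against all Gaussians. -/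
def Tempered (ψ : ℝ → ℝ) : Prop :=
  ∀ (p : Polynomial ℝ) (μ : ℝ) (v : NNReal),
    Integrable (fun y => p.eval y * ψ y) (gaussianReal μ v)

theorem Tempered.integrable {ψ : ℝ → ℝ} (h : Tempered ψ) (μ : ℝ) (v : NNReal) :
    Integrable ψ (gaussianReal μ v) := by
  simpa using h 1 μ v

theorem Tempered.eval_mul {ψ : ℝ → ℝ} (h : Tempered ψ) (q : Polynomial ℝ) :
    Tempered fun y => q.eval y * ψ y := by
  intro p μ v
  simpa [mul_assoc] using h (p * q) μ v

theorem tempered_of_continuous_of_bounded {ψ : ℝ → ℝ} (hc : Continuous ψ) {C : ℝ}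
    (hb : ∀ x, |ψ x| ≤ C) : Tempered ψ := by
  intro p μ v
  exact (integrable_eval_gaussianReal μ v p).mul_bdd hc.aestronglyMeasurable
    (Filter.Eventually.of_forall hb)

theorem tempered_eval (p : Polynomial ℝ) : Tempered fun y => p.eval y := by
  have := (tempered_of_continuous_of_bounded (ψ := fun _ => 1) continuous_const
    (C := 1) (by simp)).eval_mul p
  simpa using this

/-- Completing the square. The bound does not depend on y and is locally bounded in x, so it serves
as the dominating function for differentiation under the integral. -/
theorem exp_mul_sub_le {s : ℝ} (hs : 0 < s) (x y : ℝ) :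
    Real.exp (x * y - y ^ 2 / (2 * s)) ≤ Real.exp (x ^ 2 * s / 2) := by
  apply Real.exp_le_exp.mpr
  have : x ^ 2 * s / 2 - (x * y - y ^ 2 / (2 * s)) = (x * s - y) ^ 2 / (2 * s) := by
    field_simp; ring
  have h2 : 0 ≤ (x * s - y) ^ 2 / (2 * s) := by positivity
  linarith

theorem tempered_exp {s : ℝ} (hs : 0 < s) (x : ℝ) :
    Tempered fun y => Real.exp (x * y - y ^ 2 / (2 * s)) := by
  refine tempered_of_continuous_of_bounded (by fun_prop) (C := Real.exp (x ^ 2 * s / 2)) fun y => ?_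
  rw [abs_of_pos (Real.exp_pos _)]
  exact exp_mul_sub_le hs x y

/-- The derivative of a weighted Laplace transform of a Gaussian. -/
theorem hasDerivAt_laplace {s : ℝ} (hs : 0 < s) (μ : ℝ) (v : NNReal) (q : Polynomial ℝ) (x : ℝ) :
    HasDerivAt (fun x => ∫ y, q.eval y * Real.exp (x * y - y ^ 2 / (2 * s)) ∂gaussianReal μ v)
      (∫ y, (Polynomial.X * q).eval y * Real.exp (x * y - y ^ 2 / (2 * s)) ∂gaussianReal μ v)
      x := by
  set B := Real.exp ((|x| + 1) ^ 2 * s / 2)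
  refine (hasDerivAt_integral_of_dominated_loc_of_deriv_le (μ := gaussianReal μ v)
    (F := fun x y => q.eval y * Real.exp (x * y - y ^ 2 / (2 * s)))
    (F' := fun x y => (Polynomial.X * q).eval y * Real.exp (x * y - y ^ 2 / (2 * s)))
    (bound := fun y => |(Polynomial.X * q).eval y| * B) (Metric.ball_mem_nhds x one_pos)
    (Filter.Eventually.of_forall fun x =>
      (Continuous.aestronglyMeasurable (by fun_prop))) (tempered_exp hs x q μ v)
    (Continuous.aestronglyMeasurable (by fun_prop)) ?_
    ((integrable_eval_gaussianReal μ v _).abs.mul_const _) ?_).2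
  · refine Filter.Eventually.of_forall fun y x' hx' => ?_
    rw [norm_mul, Real.norm_eq_abs, Real.norm_eq_abs, abs_of_pos (Real.exp_pos _)]
    refine mul_le_mul_of_nonneg_left ((exp_mul_sub_le hs x' y).trans ?_) (abs_nonneg _)
    apply Real.exp_le_exp.mpr
    have h1 : |x'| ≤ |x| + 1 := by
      have h2 : |x' - x| < 1 := by simpa [Real.dist_eq] using hx'
      have := abs_sub_abs_le_abs_sub x' x
      linarith
    rw [← sq_abs x']
    gcongr
  · refine Filter.Eventually.of_forall fun y x' _ => ?_
    have := ((((hasDerivAt_id x').mul_const y).sub_const (y ^ 2 / (2 * s))).exp).const_mul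
      (q.eval y)
    refine this.congr_deriv ?_
    simp
    ring

variable {ι : Type*}

/-- The integral of `ψ` against the signed combination `∑ i ∈ S, c i * N(μ i, v i)`. -/
noncomputable def combInt (S : Finset ι) (c μ : ι → ℝ) (v : ι → NNReal) (ψ : ℝ → ℝ) : ℝ :=
  ∑ i ∈ S, c i * ∫ y, ψ y ∂gaussianReal (μ i) (v i)

theorem combInt_sub_mul {S : Finset ι} {c μ : ι → ℝ} {v : ι → NNReal} {ψ φ : ℝ → ℝ}
    (hψ : Tempered ψ) (hφ : Tempered φ) (z : ℝ) :
    combInt S c μ v (fun y => ψ y - z * φ y) = combInt S c μ v ψ - z * combInt S c μ v φ := by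
  simp only [combInt, Finset.mul_sum, ← Finset.sum_sub_distrib]
  refine Finset.sum_congr rfl fun i _ => ?_
  rw [integral_sub (hψ.integrable _ _) ((hφ.integrable _ _).const_mul _), integral_const_mul]
  ring

/-- If a signed combination of Gaussians is nonnegative after multiplication with a real-rooted
polynomial of degree `n`, its Laplace transform has at most `n` sign changes. -/
theorem not_alternates_laplace {S : Finset ι} {c μ : ι → ℝ} {v : ι → NNReal} {s : ℝ} (hs : 0 < s)
    {σ : ℝ} (hσ : σ = 1 ∨ σ = -1) (l l' : List ℝ)
    (h : ∀ ψ, Tempered ψ → (∀ x, 0 ≤ ψ x) →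
      0 ≤ σ * combInt S c μ v fun y => (rootsPoly (l.reverse ++ l')).eval y * ψ y) (a : ℝ) :
    ¬ Alternates (fun x => combInt S c μ v
      fun y => (rootsPoly l').eval y * Real.exp (x * y - y ^ 2 / (2 * s))) (l.length + 1) a := by
  -- Roots move one at a time from `l` to `l'`, where they become factors of the integrand; the full
  -- list `l.reverse ++ l'` in the hypothesis stays the same. When `l` is exhausted the transform
  -- itself has constant sign.
  induction l generalizing l' a with
  | nil =>
    rintro ⟨b, -, hlt, -⟩
    have ha := h _ (tempered_exp hs a) fun x => (Real.exp_pos _).le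
    have hb := h _ (tempered_exp hs b) fun x => (Real.exp_pos _).le
    simp only [List.reverse_nil, List.nil_append] at ha hb
    have := mul_nonneg ha hb
    rcases hσ with rfl | rfl <;> linarith
  | cons z l ih =>
    intro hA
    have ih' := ih (z :: l') (by simpa using h)
    set L : ℝ → ℝ := fun x => combInt S c μ v
      fun y => (rootsPoly l').eval y * Real.exp (x * y - y ^ 2 / (2 * s)) with hL
    set L' : ℝ → ℝ := fun x => combInt S c μ v
      fun y => (rootsPoly (z :: l')).eval y * Real.exp (x * y - y ^ 2 / (2 * s)) with hL'
    have hd0 : ∀ x, HasDerivAt L (L' x + z * L x) x := by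
      intro x
      have : HasDerivAt L (combInt S c μ v fun y => (Polynomial.X * rootsPoly l').eval y *
          Real.exp (x * y - y ^ 2 / (2 * s))) x :=
        HasDerivAt.fun_sum fun i _ => (hasDerivAt_laplace hs _ _ _ x).const_mul _
      refine this.congr_deriv ?_
      have e := combInt_sub_mul (S := S) (c := c) (μ := μ) (v := v)
        ((tempered_exp hs x).eval_mul (Polynomial.X * rootsPoly l'))
        ((tempered_exp hs x).eval_mul (rootsPoly l')) z
      have e2 : L' x = combInt S c μ v (fun y => (Polynomial.X * rootsPoly l').eval y *
          Real.exp (x * y - y ^ 2 / (2 * s)) - z * ((rootsPoly l').eval y *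
          Real.exp (x * y - y ^ 2 / (2 * s)))) := by
        simp only [hL']
        congr 1
        funext y
        rw [eval_rootsPoly_cons]
        simp
        ring
      rw [e2, e]
      ring
    -- Differentiating exp (-z x) L amounts to inserting the factor y - z in the integrand, and the
    -- exponential prefactor does not affect signs. So Rolle's theorem trades the root z for one
    -- sign change.
    have hd : ∀ x, HasDerivAt (fun x => Real.exp (-z * x) * L x) (Real.exp (-z * x) * L' x) x := by
      intro x
      have := (((hasDerivAt_id x).const_mul (-z)).exp).mul (hd0 x)
      refine this.congr_deriv ?_
      simp
      ring
    have key : ∀ f : ℝ → ℝ, ∀ x y : ℝ, (Real.exp (-z * x) * f x) * (Real.exp (-z * y) * f y) =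
        (Real.exp (-z * x) * Real.exp (-z * y)) * (f x * f y) := fun f x y => by ring
    have hA' : Alternates (fun x => Real.exp (-z * x) * L x) (l.length + 1 + 1) a := by
      refine Alternates.congr (S := Set.univ) (by simp) ?_ (by simp) hA
      intro x _ y _ hlt
      rw [key]
      exact mul_neg_of_pos_of_neg (by positivity) hlt
    obtain ⟨y, -, -, hy⟩ := hA'.deriv hd
    refine ih' y (Alternates.congr (S := Set.univ) (by simp) ?_ (by simp) hy)
    intro x _ y _ hlt
    rw [key] at hlt
    exact neg_of_mul_neg_right hlt (by positivity)

/-! ### Gaussian convolution does not increase the number of sign changes -/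

variable {ι : Type*}

/-- The density of the signed combination `∑ i ∈ S, c i * N(μ i, v i)`. -/
noncomputable def combPDF (S : Finset ι) (c μ : ι → ℝ) (v : ι → NNReal) (x : ℝ) : ℝ :=
  ∑ i ∈ S, c i * gaussianPDFReal (μ i) (v i) x

theorem integrable_pdf_mul {μ : ℝ} {v : NNReal} (hv : v ≠ 0) {f : ℝ → ℝ}
    (hf : Integrable f (gaussianReal μ v)) :
    Integrable (fun x => gaussianPDFReal μ v x * f x) := by
  rw [gaussianReal_of_var_ne_zero _ hv, integrable_withDensity_iff_integrable_smul'
    (measurable_gaussianPDF μ v) (Filter.Eventually.of_forall fun x => gaussianPDF_lt_top)] at hf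
  simpa [toReal_gaussianPDF] using hf

theorem combInt_eq_integral {S : Finset ι} {c μ : ι → ℝ} {v : ι → NNReal}
    (hv : ∀ i ∈ S, v i ≠ 0) {ψ : ℝ → ℝ} (hψ : Tempered ψ) :
    combInt S c μ v ψ = ∫ x, combPDF S c μ v x * ψ x := by
  simp only [combPDF, combInt, Finset.sum_mul]
  rw [integral_finsetSum]
  · refine Finset.sum_congr rfl fun i hi => ?_
    rw [integral_gaussianReal_eq_integral_smul (hv i hi), ← integral_const_mul]
    simp [mul_assoc]
  · intro i hi
    simp only [mul_assoc]
    exact (integrable_pdf_mul (hv i hi) (hψ.integrable _ _)).const_mul _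

theorem integrable_combPDF_mul {S : Finset ι} {c μ : ι → ℝ} {v : ι → NNReal}
    (hv : ∀ i ∈ S, v i ≠ 0) {ψ : ℝ → ℝ} (hψ : Tempered ψ) :
    Integrable fun x => combPDF S c μ v x * ψ x := by
  simp only [combPDF, Finset.sum_mul, mul_assoc]
  exact integrable_finsetSum _ fun i hi =>
    (integrable_pdf_mul (hv i hi) (hψ.integrable _ _)).const_mul _

/-- The left side is the convolution of N(μ, v) with a Gaussian bump of variance s. Expanding (y -
x)² in the bump splits off a positive factor depending on x only and leaves a Laplace transform at x
/ s. -/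
theorem gaussianPDFReal_add_var (μ x : ℝ) (v : NNReal) {s : NNReal} (hs : 0 < s) :
    gaussianPDFReal μ (v + s) x = ((√(2 * Real.pi * s))⁻¹ * Real.exp (-x ^ 2 / (2 * s))) *
      ∫ y, Real.exp (x / s * y - y ^ 2 / (2 * s)) ∂gaussianReal μ v := by
  have hs' : (0 : ℝ) < s := hs
  have hb := integral_bump_gaussianReal μ x v hs'
  have e : ∀ y : ℝ, Real.exp (-(y - x) ^ 2 / (2 * s)) =
      Real.exp (-x ^ 2 / (2 * s)) * Real.exp (x / s * y - y ^ 2 / (2 * s)) := by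
    intro y
    rw [← Real.exp_add]
    congr 1
    field_simp
    ring
  simp_rw [e] at hb
  rw [integral_const_mul] at hb
  rw [mul_assoc, hb, gaussianPDFReal_def]
  have h2 : (√(2 * Real.pi * (v + s : NNReal)))⁻¹ = (√(2 * Real.pi * s))⁻¹ * √(s / (s + v)) := by
    rw [← Real.sqrt_inv, ← Real.sqrt_inv, ← Real.sqrt_mul (by positivity)]
    congr 1
    push_cast
    field_simp
    ring
  rw [h2, ← mul_assoc]
  push_cast
  congr 2
  ring

theorem Alternates.comp_div {f : ℝ → ℝ} {s : ℝ} (hs : 0 < s) {n : ℕ} {a : ℝ}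
    (h : Alternates (fun x => f (x / s)) n a) : Alternates f n (a / s) := by
  induction n generalizing a with
  | zero => trivial
  | succ n ih =>
    obtain ⟨b, h1, h2, h3⟩ := h
    exact ⟨b / s, by gcongr, h2, ih h3⟩

/-- Convolution with a Gaussian does not increase the number of sign changes. -/
theorem exists_rootsPoly_combPDF {S : Finset ι} {c μ : ι → ℝ} {v : ι → NNReal} {s : NNReal}
    (hs : 0 < s) {l : List ℝ} {σ : ℝ} (hσ : σ = 1 ∨ σ = -1)
    (h : ∀ ψ, Tempered ψ → (∀ x, 0 ≤ ψ x) →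
      0 ≤ σ * combInt S c μ v fun y => (rootsPoly l).eval y * ψ y) :
    ∃ l' : List ℝ, l'.length ≤ l.length ∧ ∃ σ : ℝ, (σ = 1 ∨ σ = -1) ∧
      ∀ x, 0 ≤ σ * ((rootsPoly l').eval x * combPDF S c μ (fun i => v i + s) x) := by
  refine exists_rootsPoly_of_not_alternates fun a ha => ?_
  have hs' : (0 : ℝ) < s := hs
  have hL := not_alternates_laplace (S := S) (c := c) (μ := μ) (v := v) hs' hσ l.reverse []
    (by simpa using h) (a / s)
  rw [List.length_reverse] at hL
  refine hL (Alternates.comp_div hs'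
    (Alternates.congr (S := Set.univ) (by simp) ?_ (by simp) ha))
  intro x _ y _ hlt
  have e : ∀ x, combPDF S c μ (fun i => v i + s) x =
      ((√(2 * Real.pi * s))⁻¹ * Real.exp (-x ^ 2 / (2 * s))) *
      combInt S c μ v fun y => (rootsPoly []).eval y * Real.exp (x / s * y - y ^ 2 / (2 * s)) := by
    intro x
    simp only [combPDF, combInt, Finset.mul_sum, rootsPoly_nil, Polynomial.eval_one, one_mul]
    refine Finset.sum_congr rfl fun i _ => ?_
    rw [gaussianPDFReal_add_var _ _ _ hs]
    ring
  rw [e, e, mul_mul_mul_comm] at hlt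
  exact neg_of_mul_neg_right hlt (by positivity)

/-- Translates the pointwise sign condition into the integrated one, which remains meaningful for
components of variance zero. -/
theorem nonneg_combInt_of_combPDF {S : Finset ι} {c μ : ι → ℝ} {v : ι → NNReal}
    (hv : ∀ i ∈ S, v i ≠ 0) {l : List ℝ} {σ : ℝ}
    (h : ∀ x, 0 ≤ σ * ((rootsPoly l).eval x * combPDF S c μ v x)) {ψ : ℝ → ℝ} (hψ : Tempered ψ)
    (h0 : ∀ x, 0 ≤ ψ x) :
    0 ≤ σ * combInt S c μ v fun y => (rootsPoly l).eval y * ψ y := by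
  rw [combInt_eq_integral hv (hψ.eval_mul _), ← integral_const_mul]
  refine integral_nonneg fun x => ?_
  have := mul_nonneg (h x) (h0 x)
  simp only [Pi.zero_apply]
  linarith

/-- A signed combination of `n + 1` Gaussians (some of which may be point masses) has at most `2 n`
sign changes. -/
theorem exists_rootsPoly_combInt (c μ : ι → ℝ) {n : ℕ} {S : Finset ι}
    (hS : S.card = n + 1) (v : ι → NNReal) :
    ∃ l : List ℝ, l.length ≤ 2 * n ∧ ∃ σ : ℝ, (σ = 1 ∨ σ = -1) ∧
      ∀ ψ, Tempered ψ → (∀ x, 0 ≤ ψ x) →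
        0 ≤ σ * combInt S c μ v fun y => (rootsPoly l).eval y * ψ y := by
  classical
  induction n generalizing S v with
  | zero =>
    obtain ⟨i, rfl⟩ := Finset.card_eq_one.mp hS
    have hpos : ∀ ψ : ℝ → ℝ, (∀ x, 0 ≤ ψ x) → 0 ≤ ∫ y, ψ y ∂gaussianReal (μ i) (v i) :=
      fun ψ h => integral_nonneg h
    refine ⟨[], le_rfl, ?_⟩
    simp only [rootsPoly_nil, Polynomial.eval_one, one_mul, combInt, Finset.sum_singleton]
    rcases le_total 0 (c i) with hc | hc
    · exact ⟨1, Or.inl rfl, fun ψ _ h => by have := mul_nonneg hc (hpos ψ h); linarith⟩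
    · refine ⟨-1, Or.inr rfl, fun ψ _ h => ?_⟩
      have := mul_nonneg (neg_nonneg.mpr hc) (hpos ψ h)
      linarith
  | succ n ih =>
    obtain ⟨i₀, hi₀, hmin⟩ := S.exists_min_image v (Finset.card_pos.mp (by omega))
    -- Subtracting the smallest variance turns component i₀ into a point mass.
    set s := v i₀ with hs
    have hv : ∀ i ∈ S, v i - s + s = v i := fun i hi => tsub_add_cancel_of_le (hmin i hi)
    obtain ⟨l, hl, σ, hσ, h⟩ := ih (S := S.erase i₀)
      (by rw [Finset.card_erase_of_mem hi₀, hS]; omega) (fun i => v i - s)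
    -- The square (y - μ i₀)² vanishes at the point mass and is nonnegative elsewhere. So two
    -- additional roots restore component i₀ without disturbing the sign condition.
    have h' : ∀ ψ, Tempered ψ → (∀ x, 0 ≤ ψ x) →
        0 ≤ σ * combInt S c μ (fun i => v i - s) fun y =>
          (rootsPoly (μ i₀ :: μ i₀ :: l)).eval y * ψ y := by
      intro ψ hψ h0
      have h1 := h (fun y => ((Polynomial.X - Polynomial.C (μ i₀)) ^ 2).eval y * ψ y)
        (hψ.eval_mul _) (fun x => by
          rw [Polynomial.eval_pow]; exact mul_nonneg (sq_nonneg _) (h0 x))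
      convert h1 using 2
      simp only [combInt]
      rw [← Finset.add_sum_erase _ _ hi₀]
      have e0 : v i₀ - s = 0 := by rw [hs, tsub_self]
      rw [e0, gaussianReal_zero_var, integral_dirac, eval_rootsPoly_cons]
      simp only [sub_self, zero_mul, mul_zero, zero_add]
      refine Finset.sum_congr rfl fun i _ => ?_
      congr 2
      funext y
      simp [eval_rootsPoly_cons]
      ring
    have hlen : (μ i₀ :: μ i₀ :: l).length ≤ 2 * (n + 1) := by simp; omega
    have hcongr : ∀ ψ, combInt S c μ (fun i => v i - s + s) ψ = combInt S c μ v ψ := by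
      intro ψ
      exact Finset.sum_congr rfl fun i hi => by simp only; rw [hv i hi]
    -- If s = 0 nothing was subtracted; otherwise convolution with variance s restores the original
    -- variances.
    rcases eq_or_ne s 0 with hs0 | hs0
    · refine ⟨_, hlen, σ, hσ, fun ψ hψ h0 => ?_⟩
      have := h' ψ hψ h0
      simp only [hs0, tsub_zero] at this
      exact this
    · have hs1 : 0 < s := pos_iff_ne_zero.mpr hs0
      obtain ⟨l', hl', σ', hσ', h2⟩ := exists_rootsPoly_combPDF hs1 hσ h'
      refine ⟨l', hl'.trans hlen, σ', hσ', fun ψ hψ h0 => ?_⟩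
      have := nonneg_combInt_of_combPDF (fun i _ => by
        have : 0 < v i - s + s := by positivity
        exact this.ne') h2 hψ h0
      rwa [hcongr] at this

/-- The density of a signed combination of `n + 1` nondegenerate Gaussians has the sign of a
real-rooted polynomial of degree at most `2 n`. -/
theorem exists_rootsPoly_mul_combPDF_nonneg (c μ : ι → ℝ) {n : ℕ} {S : Finset ι}
    (hS : S.card = n + 1) {v : ι → NNReal} (hv : ∀ i ∈ S, v i ≠ 0) :
    ∃ l : List ℝ, l.length ≤ 2 * n ∧ ∃ σ : ℝ, (σ = 1 ∨ σ = -1) ∧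
      ∀ x, 0 ≤ σ * ((rootsPoly l).eval x * combPDF S c μ v x) := by
  obtain ⟨i₀, hi₀, hmin⟩ := S.exists_min_image v (Finset.card_pos.mp (by omega))
  -- Only half of the smallest variance is removed, so that a genuine convolution restores it and
  -- upgrades the integrated sign condition to one at every point.
  have hs : 0 < v i₀ / 2 := half_pos (pos_iff_ne_zero.mpr (hv i₀ hi₀))
  obtain ⟨l, hl, σ, hσ, h⟩ := exists_rootsPoly_combInt c μ hS (fun i => v i - v i₀ / 2)
  obtain ⟨l', hl', σ', hσ', h'⟩ := exists_rootsPoly_combPDF hs hσ h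
  refine ⟨l', hl'.trans hl, σ', hσ', fun x => ?_⟩
  have e : combPDF S c μ (fun i => v i - v i₀ / 2 + v i₀ / 2) x = combPDF S c μ v x := by
    refine Finset.sum_congr rfl fun i hi => ?_
    simp only
    rw [tsub_add_cancel_of_le ((half_le_self zero_le).trans (hmin i hi))]
  rw [← e]
  exact h' x

/-! ### Small moments force a small coefficient at the smallest variance -/

variable {ι : Type*}

/-- The normalizing factor of a real-rooted polynomial. -/
noncomputable def rootsNorm (l : List ℝ) : ℝ := (l.map fun z => 1 + |z|).prod

theorem rootsNorm_cons (z : ℝ) (l : List ℝ) : rootsNorm (z :: l) = (1 + |z|) * rootsNorm l := by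
  simp [rootsNorm]

theorem rootsNorm_pos (l : List ℝ) : 0 < rootsNorm l := by
  induction l with
  | nil => simp [rootsNorm]
  | cons z l ih => rw [rootsNorm_cons]; positivity

/-- Multiplying out one factor y - z costs at most 1 + |z|. The power X ^ j records the factors y
chosen so far, so only moments up to the total degree enter. -/
theorem abs_combInt_rootsPoly_le {S : Finset ι} {c μ : ι → ℝ} {v : ι → NNReal} {M : ℝ} {d : ℕ}
    (hM : ∀ j ≤ d, |combInt S c μ v fun y => y ^ j| ≤ M) (l : List ℝ) (j : ℕ)
    (hj : j + l.length ≤ d) :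
    |combInt S c μ v fun y => (Polynomial.X ^ j * rootsPoly l).eval y| ≤ M * rootsNorm l := by
  induction l generalizing j with
  | nil => simpa [rootsPoly_nil, rootsNorm] using hM j (by simpa using hj)
  | cons z l ih =>
    rw [List.length_cons] at hj
    have h1 := ih (j + 1) (by omega)
    have h2 := ih j (by omega)
    have e : (fun y => (Polynomial.X ^ j * rootsPoly (z :: l)).eval y) = fun y =>
        (Polynomial.X ^ (j + 1) * rootsPoly l).eval y -
          z * (Polynomial.X ^ j * rootsPoly l).eval y := by
      funext y; simp [rootsPoly_cons]; ring
    rw [e, combInt_sub_mul (tempered_eval _) (tempered_eval _), rootsNorm_cons]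
    calc _ ≤ |combInt S c μ v fun y => (Polynomial.X ^ (j + 1) * rootsPoly l).eval y| +
          |z * combInt S c μ v fun y => (Polynomial.X ^ j * rootsPoly l).eval y| := abs_sub _ _
      _ ≤ M * rootsNorm l + |z| * (M * rootsNorm l) := by rw [abs_mul]; gcongr
      _ = _ := by ring

/-- U is the union of the intervals of radius β around the roots. -/
theorem exists_cover_of_roots {β : ℝ} (hβ : 0 ≤ β) (l : List ℝ) :
    ∃ U : Set ℝ, MeasurableSet U ∧ volume U ≤ ENNReal.ofReal (2 * β * l.length) ∧
      ∀ x ∉ U, ∀ z ∈ l, β ≤ |x - z| := by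
  induction l with
  | nil => exact ⟨∅, MeasurableSet.empty, by simp, by simp⟩
  | cons z l ih =>
    obtain ⟨U, h1, h2, h3⟩ := ih
    refine ⟨Set.Ioo (z - β) (z + β) ∪ U, measurableSet_Ioo.union h1, ?_, ?_⟩
    · refine (measure_union_le _ _).trans ?_
      rw [Real.volume_Ioo]
      refine (add_le_add_right h2 _).trans ?_
      rw [← ENNReal.ofReal_add (by linarith) (by positivity)]
      apply ENNReal.ofReal_le_ofReal
      rw [List.length_cons]
      push_cast
      linarith
    · intro x hx w hw
      rw [Set.mem_union, not_or] at hx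
      rcases List.mem_cons.mp hw with rfl | hw
      · by_contra hlt
        push Not at hlt
        rw [abs_lt] at hlt
        exact hx.1 ⟨by linarith, by linarith⟩
      · exact h3 x hx.2 w hw

/-- The lower bound has the same factor `rootsNorm l` as the upper bound in
`abs_combInt_rootsPoly_le`, so the size of the roots cancels when the two are compared. -/
theorem pow_mul_rootsNorm_le {a x : ℝ} (ha : 0 ≤ a) (l : List ℝ)
    (h : ∀ z ∈ l, a * (1 + |z|) ≤ |x - z|) :
    a ^ l.length * rootsNorm l ≤ |(rootsPoly l).eval x| := by
  induction l with
  | nil => simp [rootsPoly_nil, rootsNorm]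
  | cons z l ih =>
    rw [eval_rootsPoly_cons, rootsNorm_cons, abs_mul, List.length_cons]
    have h1 := h z (by simp)
    have h2 := ih fun w hw => h w (by simp [hw])
    have := rootsNorm_pos l
    calc _ = (a * (1 + |z|)) * (a ^ l.length * rootsNorm l) := by ring
      _ ≤ _ := by gcongr

theorem exp_neg_le_inv {y : ℝ} (hy : 0 < y) : Real.exp (-y) ≤ y⁻¹ := by
  rw [Real.exp_neg]
  have := Real.add_one_le_exp y
  exact inv_anti₀ hy (by linarith)

theorem gaussianPDFReal_le {μ x a : ℝ} {v : NNReal} (ha : 0 < a) (h : a ^ 2 ≤ v) :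
    gaussianPDFReal μ v x ≤ a⁻¹ := by
  rw [gaussianPDFReal_def]
  have h1 : a ≤ √(2 * Real.pi * v) := by
    apply Real.le_sqrt_of_sq_le
    have := Real.pi_gt_three
    nlinarith [v.coe_nonneg]
  have h2 : Real.exp (-(x - μ) ^ 2 / (2 * v)) ≤ 1 := by
    apply Real.exp_le_one_iff.mpr
    rw [neg_div]
    exact neg_nonpos.mpr (by positivity)
  exact (mul_le_mul (inv_anti₀ ha h1) h2 (Real.exp_pos _).le (by positivity)).trans_eq (mul_one _)

theorem integral_abs_combPDF_le (S : Finset ι) (c μ : ι → ℝ) {v : ι → NNReal}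
    (hv : ∀ i ∈ S, v i ≠ 0) : ∫ x, |combPDF S c μ v x| ≤ ∑ i ∈ S, |c i| := by
  have hi : ∀ i ∈ S, Integrable fun x => |c i| * gaussianPDFReal (μ i) (v i) x :=
    fun i _ => (integrable_gaussianPDFReal _ _).const_mul _
  calc ∫ x, |combPDF S c μ v x| ≤ ∫ x, ∑ i ∈ S, |c i| * gaussianPDFReal (μ i) (v i) x := by
        refine integral_mono_of_nonneg (Filter.Eventually.of_forall fun _ => abs_nonneg _)
          (integrable_finsetSum _ hi) (Filter.Eventually.of_forall fun x => ?_)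
        refine (Finset.abs_sum_le_sum_abs _ _).trans (Finset.sum_le_sum fun i _ => ?_)
        rw [abs_mul, abs_of_nonneg (gaussianPDFReal_nonneg _ _ _)]
    _ = ∑ i ∈ S, |c i| := by
      rw [integral_finsetSum _ hi]
      refine Finset.sum_congr rfl fun i hiS => ?_
      rw [integral_const_mul, integral_gaussianPDFReal_eq_one _ (hv i hiS), mul_one]

/-- The bump at the component of smallest variance nearly annihilates the other components. -/
theorem bump_le_of_separated {t m m₀ d : ℝ} (ht : 0 < t) (ht1 : t ≤ 1 / 1000) (hd : 0 ≤ d)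
    (hsep : t ≤ |m - m₀| + d) :
    √(t ^ 12 / (t ^ 12 + (d + t ^ 12))) * Real.exp (-(m - m₀) ^ 2 / (2 * (t ^ 12 + (d + t ^ 12))))
      ≤ t ^ 2 / 8 := by
  have hp : ∀ k, 0 < t ^ k := fun k => pow_pos ht k
  have hs : ∀ k, t ^ (k + 1) ≤ t ^ k / 1000 := fun k => by
    rw [pow_succ]; nlinarith [hp k]
  have hs1 := hs 2
  have hs2 := hs 3
  have hs3 := hs 1
  have hs4 := hs 5
  have h12 : t ^ 12 ≤ t ^ 6 / 2 := by
    have : t ^ 12 ≤ t ^ 7 := pow_le_pow_of_le_one ht.le (by linarith) (by norm_num)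
    linarith [hs 6, hp 6]
  have hp12 := hp 12
  have hexp : Real.exp (-(m - m₀) ^ 2 / (2 * (t ^ 12 + (d + t ^ 12)))) ≤ 1 := by
    apply Real.exp_le_one_iff.mpr
    rw [neg_div]
    exact neg_nonpos.mpr (by positivity)
  have hsqrt : √(t ^ 12 / (t ^ 12 + (d + t ^ 12))) ≤ 1 := by
    rw [Real.sqrt_le_one]
    exact (div_le_one (by positivity)).mpr (by linarith)
  -- Either the other component is much wider than the bump, and then the square root is at most t ^
  -- 3; or the variances nearly agree, so the means are t / 2 apart and the exponential is at most
  -- 16 t ^ 4.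
  rcases le_or_gt (t ^ 6) d with h | h
  · have : √(t ^ 12 / (t ^ 12 + (d + t ^ 12))) ≤ t ^ 3 := by
      rw [Real.sqrt_le_left (by positivity), div_le_iff₀ (by positivity)]
      have : t ^ 12 = (t ^ 3) ^ 2 * t ^ 6 := by ring
      nlinarith [hp 6]
    calc _ ≤ t ^ 3 * 1 := by gcongr
      _ ≤ t ^ 2 / 8 := by linarith [hp 2]
  · have h6 : t ^ 6 ≤ t / 2 := by
      have : t ^ 6 ≤ t ^ 2 := pow_le_pow_of_le_one ht.le (by linarith) (by norm_num)
      rw [pow_one] at hs3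
      linarith
    have hm : t / 2 ≤ |m - m₀| := by linarith
    have hy : (16 * t ^ 4)⁻¹ ≤ (m - m₀) ^ 2 / (2 * (t ^ 12 + (d + t ^ 12))) := by
      have h1 : (t / 2) ^ 2 ≤ (m - m₀) ^ 2 := by
        rw [← sq_abs (m - m₀)]; gcongr
      calc (16 * t ^ 4)⁻¹ = (t / 2) ^ 2 / (2 * (2 * t ^ 6)) := by field_simp; norm_num
        _ ≤ _ := by
          gcongr
          linarith
    have h2 : Real.exp (-(m - m₀) ^ 2 / (2 * (t ^ 12 + (d + t ^ 12)))) ≤ 16 * t ^ 4 := by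
      rw [neg_div]
      calc _ ≤ Real.exp (-(16 * t ^ 4)⁻¹) := Real.exp_le_exp.mpr (neg_le_neg hy)
        _ ≤ ((16 * t ^ 4)⁻¹)⁻¹ := exp_neg_le_inv (by positivity)
        _ = _ := inv_inv _
    calc _ ≤ 1 * (16 * t ^ 4) := by gcongr
      _ ≤ t ^ 2 / 8 := by linarith [hp 2]

/-- If the low order moments of a separated signed combination of Gaussians are small, then so is
the coefficient of the component of smallest variance. -/
theorem abs_coeff_le_of_min_var {S : Finset ι} {c μ v : ι → ℝ} {n : ℕ} (hS : S.card = n + 1)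
    {t : ℝ} (ht : 0 < t) (ht1 : t ≤ 1 / 1000) (hn : 2 * (n + 1 : ℝ) * t ≤ 1)
    (hv : ∀ i ∈ S, |v i| ≤ t⁻¹) (hμ : ∀ i ∈ S, |μ i| ≤ t⁻¹) (hc : ∑ i ∈ S, |c i| ≤ t⁻¹)
    (hsep : ∀ i ∈ S, ∀ j ∈ S, i ≠ j → t ≤ |μ i - μ j| + |v i - v j|)
    (hm : ∀ j ≤ 2 * n, |∑ i ∈ S, c i * gaussMoment j (μ i) (v i)| ≤ t ^ (30 * (n + 1)))
    {i₀ : ι} (hi₀ : i₀ ∈ S) (hmin : ∀ i ∈ S, v i₀ ≤ v i) : |c i₀| ≤ t := by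
  classical
  by_contra hlt
  push Not at hlt
  have hp : ∀ k, 0 < t ^ k := fun k => pow_pos ht k
  have ht1' : t ≤ 1 := by linarith
  have hti : 1000 ≤ t⁻¹ := by
    rw [le_inv_comm₀ (by norm_num) ht]; linarith
  have htt : t * t⁻¹ = 1 := mul_inv_cancel₀ ht.ne'
  -- The variances are shifted so that the smallest becomes s, far below the separation t; the bump
  -- below has variance s too.
  set s : ℝ := t ^ 12 with hs
  have hs0 : 0 < s := hp 12
  set w : ι → NNReal := fun i => (v i - v i₀ + s).toNNReal with hw
  have hwc : ∀ i ∈ S, (w i : ℝ) = v i - v i₀ + s := fun i hi =>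
    Real.coe_toNNReal _ (by linarith [hmin i hi])
  have hws : ∀ i ∈ S, s ≤ w i := fun i hi => by rw [hwc i hi]; linarith [hmin i hi]
  have hw0 : ∀ i ∈ S, w i ≠ 0 := fun i hi h => by
    have := hws i hi
    rw [h, NNReal.coe_zero] at this
    linarith
  -- the bump detects the coefficient
  set φ : ℝ → ℝ := fun x => Real.exp (-(x - μ i₀) ^ 2 / (2 * s)) with hφ
  have hφ0 : ∀ x, 0 ≤ φ x := fun x => (Real.exp_pos _).le
  have hφ1 : ∀ x, φ x ≤ 1 := fun x => by
    apply Real.exp_le_one_iff.mpr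
    rw [neg_div]
    exact neg_nonpos.mpr (by positivity)
  have hφt : Tempered φ := tempered_of_continuous_of_bounded (by fun_prop) (C := 1) fun x => by
    rw [abs_of_nonneg (hφ0 x)]; exact hφ1 x
  have hbump : t / 2 ≤ |combInt S c μ w φ| := by
    have e : combInt S c μ w φ = ∑ i ∈ S, c i * (√(s / (s + w i)) *
        Real.exp (-(μ i - μ i₀) ^ 2 / (2 * (s + w i)))) :=
      Finset.sum_congr rfl fun i _ => by rw [hφ, integral_bump_gaussianReal _ _ _ hs0]
    rw [e, ← Finset.add_sum_erase _ _ hi₀]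
    have h1 : |∑ i ∈ S.erase i₀, c i * (√(s / (s + w i)) *
        Real.exp (-(μ i - μ i₀) ^ 2 / (2 * (s + w i))))| ≤ t / 8 := by
      calc _ ≤ ∑ i ∈ S.erase i₀, |c i| * (t ^ 2 / 8) := by
            refine (Finset.abs_sum_le_sum_abs _ _).trans (Finset.sum_le_sum fun i hi => ?_)
            obtain ⟨hne, hi⟩ := Finset.mem_erase.mp hi
            rw [abs_mul, abs_of_nonneg (by positivity : 0 ≤ √(s / (s + w i)) *
              Real.exp (-(μ i - μ i₀) ^ 2 / (2 * (s + w i))))]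
            refine mul_le_mul_of_nonneg_left ?_ (abs_nonneg _)
            rw [hwc i hi]
            refine bump_le_of_separated ht ht1 (by linarith [hmin i hi]) ?_
            have := hsep i hi i₀ hi₀ hne
            rwa [abs_of_nonneg (by linarith [hmin i hi] : 0 ≤ v i - v i₀)] at this
        _ ≤ ∑ i ∈ S, |c i| * (t ^ 2 / 8) :=
          Finset.sum_le_sum_of_subset_of_nonneg (Finset.erase_subset _ _)
            fun i _ _ => by positivity
        _ ≤ t⁻¹ * (t ^ 2 / 8) := by
          rw [← Finset.sum_mul]; gcongr
        _ = t / 8 := by field_simp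
    -- The bump and component i₀ have equal variance, so the integral of the bump against that
    -- component is √(1/2) > 7/10.
    have h2 : t * (7 / 10) ≤ |c i₀ * (√(s / (s + w i₀)) *
        Real.exp (-(μ i₀ - μ i₀) ^ 2 / (2 * (s + w i₀))))| := by
      rw [hwc i₀ hi₀]
      have e2 : s / (s + (v i₀ - v i₀ + s)) = 1 / 2 := by
        rw [sub_self, zero_add, ← two_mul]; field_simp
      have h3 : 7 / 10 ≤ √(1 / 2 : ℝ) := Real.le_sqrt_of_sq_le (by norm_num)
      rw [e2, sub_self, zero_pow two_ne_zero, neg_zero, zero_div, Real.exp_zero, mul_one, abs_mul,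
        abs_of_nonneg (Real.sqrt_nonneg (1 / 2))]
      gcongr
    have h3 := abs_sub_abs_le_abs_add (c i₀ * (√(s / (s + w i₀)) *
        Real.exp (-(μ i₀ - μ i₀) ^ 2 / (2 * (s + w i₀))))) (∑ i ∈ S.erase i₀, c i *
        (√(s / (s + w i)) * Real.exp (-(μ i - μ i₀) ^ 2 / (2 * (s + w i)))))
    linarith
  -- the sign polynomial
  obtain ⟨l, hl, σ, hσ, hsign⟩ := exists_rootsPoly_mul_combPDF_nonneg c μ hS hw0
  set N := rootsNorm l with hN
  have hN0 : 0 < N := rootsNorm_pos l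
  set f := combPDF S c μ w with hf
  set r : ℝ → ℝ := fun x => (rootsPoly l).eval x with hr
  -- Constant sign turns the integral of |r f|, up to the sign σ, into the integral of the
  -- polynomial r against f, which the moments control.
  have habs : ∀ x, |r x| * |f x| = σ * (r x * f x) := by
    intro x
    rw [← abs_mul]
    have := hsign x
    rcases hσ with rfl | rfl
    · rw [one_mul] at this ⊢; exact abs_of_nonneg this
    · have h' : r x * f x ≤ 0 := by simp only [hr]; linarith
      rw [abs_of_nonpos h']; ring
  -- upper bound on its integral
  have hdt : ((2 * n : ℕ) : ℝ) ≤ t⁻¹ := by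
    rw [← one_div, le_div_iff₀ ht]
    push_cast
    nlinarith
  -- Shifting the variances inflates the moments by at most t ^ (-6 n).
  have hmom : ∀ j ≤ 2 * n, |combInt S c μ w fun y => y ^ j| ≤ t ^ (24 * n + 30) := by
    intro j hj
    have e : combInt S c μ w (fun y => y ^ j) =
        ∑ i ∈ S, c i * gaussMoment j (μ i) (v i + (s - v i₀)) := by
      refine Finset.sum_congr rfl fun i hi => ?_
      rw [integral_pow_gaussianReal, hwc i hi]
      congr 2
      ring
    rw [e]
    have hsv : |s - v i₀| ≤ 2 * t⁻¹ := by
      have h1 := hv i₀ hi₀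
      have h2 : s ≤ 1 := pow_le_one₀ ht.le ht1'
      have h3 := abs_sub s (v i₀)
      rw [abs_of_pos hs0] at h3
      linarith
    have hK : (2 * t⁻¹) * ((2 * n : ℕ) : ℝ) ^ 2 ≤ ((t⁻¹) ^ 2) ^ 2 := by
      calc _ ≤ (2 * t⁻¹) * (t⁻¹) ^ 2 := by gcongr
        _ ≤ (t⁻¹ * t⁻¹) * (t⁻¹) ^ 2 := by gcongr; linarith
        _ = _ := by ring
    have h1 := abs_sum_gaussMoment_shift_le S c μ v (hp _).le (by positivity)
      (one_le_pow₀ (by linarith)) hK hm hj hsv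
    refine h1.trans ?_
    have h2 : ((t⁻¹) ^ 2) ^ j * 2 ^ j ≤ (t⁻¹) ^ (6 * n) := by
      calc ((t⁻¹) ^ 2) ^ j * 2 ^ j ≤ ((t⁻¹) ^ 2) ^ j * (t⁻¹) ^ j := by gcongr; linarith
        _ = (t⁻¹) ^ (3 * j) := by ring
        _ ≤ (t⁻¹) ^ (6 * n) := pow_le_pow_right₀ (by linarith) (by omega)
    calc t ^ (30 * (n + 1)) * ((t⁻¹) ^ 2) ^ j * 2 ^ j
        = t ^ (30 * (n + 1)) * (((t⁻¹) ^ 2) ^ j * 2 ^ j) := by ring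
      _ ≤ t ^ (30 * (n + 1)) * (t⁻¹) ^ (6 * n) := by gcongr
      _ = t ^ (24 * n + 30) * (t * t⁻¹) ^ (6 * n) := by ring
      _ = _ := by rw [htt, one_pow, mul_one]
  have hupper : ∫ x, |r x| * |f x| ≤ t ^ (24 * n + 30) * N := by
    have h1 := abs_combInt_rootsPoly_le hmom l 0 (by omega)
    simp only [pow_zero, one_mul] at h1
    rw [combInt_eq_integral hw0 (tempered_eval _)] at h1
    simp_rw [habs]
    rw [integral_const_mul]
    have e : ∫ x, r x * f x = ∫ x, f x * r x := by simp_rw [mul_comm]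
    rw [e]
    refine (le_abs_self _).trans ?_
    rw [abs_mul]
    have : |σ| = 1 := by rcases hσ with rfl | rfl <;> simp
    rw [this, one_mul]
    exact h1
  -- lower bound away from the roots
  obtain ⟨U, hU1, hU2, hU3⟩ := exists_cover_of_roots (hp 10).le l
  -- One term for each of three regions. Near the roots, |f| is at most t ^ (-7) on a set of tiny
  -- measure; elsewhere with |x| ≤ 1/t + 1, |r| is at least t ^ (24 n) N; for larger |x| the bump is
  -- at most 2 s.
  have hpt : ∀ x, |f x| * φ x ≤ ((t⁻¹) ^ (24 * n) * N⁻¹) * (|r x| * |f x|) +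
      U.indicator (fun _ => (t⁻¹) ^ 7) x + 2 * s * |f x| := by
    intro x
    have hA : 0 ≤ ((t⁻¹) ^ (24 * n) * N⁻¹) * (|r x| * |f x|) := by positivity
    have hB : 0 ≤ U.indicator (fun _ => (t⁻¹) ^ 7) x :=
      Set.indicator_nonneg (fun _ _ => by positivity) _
    have hC : 0 ≤ 2 * s * |f x| := by positivity
    by_cases hxU : x ∈ U
    · have : |f x| ≤ (t⁻¹) ^ 7 := by
        calc |f x| ≤ ∑ i ∈ S, |c i| * (t⁻¹) ^ 6 := by
              refine (Finset.abs_sum_le_sum_abs _ _).trans (Finset.sum_le_sum fun i hi => ?_)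
              rw [abs_mul, abs_of_nonneg (gaussianPDFReal_nonneg _ _ _)]
              gcongr
              rw [inv_pow]
              refine gaussianPDFReal_le (hp 6) ?_
              rw [← pow_mul]
              exact hws i hi
          _ ≤ t⁻¹ * (t⁻¹) ^ 6 := by rw [← Finset.sum_mul]; gcongr
          _ = _ := by ring
      rw [Set.indicator_of_mem hxU]
      have := mul_le_mul this (hφ1 x) (hφ0 x) (by positivity)
      linarith
    · by_cases hxB : |x| ≤ t⁻¹ + 1
      -- Roots of size at most about 2/t are at distance t ^ 10 or more, which exceeds t ^ 12 (1 +
      -- |z|); the remaining roots are so far from x that |x - z| is comparable to |z|.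
      · have h1 : (t ^ 12) ^ l.length * N ≤ |r x| := by
          refine pow_mul_rootsNorm_le (hp 12).le l fun z hz => ?_
          have h2 := hU3 x hxU z hz
          by_cases hzB : |z| ≤ 2 * t⁻¹ + 3
          · have h3 : 1 + |z| ≤ 3 * t⁻¹ := by linarith
            calc t ^ 12 * (1 + |z|) ≤ t ^ 12 * (3 * t⁻¹) := by gcongr
              _ = t ^ 10 * (3 * t) * (t * t⁻¹) := by ring
              _ ≤ t ^ 10 * 1 * 1 := by rw [htt]; gcongr; linarith
              _ ≤ _ := by linarith
          · push Not at hzB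
            have h3 := abs_sub_abs_le_abs_sub z x
            rw [abs_sub_comm z x] at h3
            have h4 : t ^ 12 ≤ t := by
              calc t ^ 12 ≤ t ^ 1 := pow_le_pow_of_le_one ht.le ht1' (by norm_num)
                _ = t := pow_one t
            have h5 : t ^ 12 * (1 + |z|) ≤ (1 / 1000) * (1 + |z|) := by gcongr; linarith
            linarith
        have h2 : 1 ≤ (t⁻¹) ^ (24 * n) * N⁻¹ * |r x| := by
          have h3 : t ^ (24 * n) * N ≤ |r x| := by
            refine le_trans ?_ h1
            rw [← pow_mul]
            gcongr ?_ * N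
            exact pow_le_pow_of_le_one ht.le ht1' (by omega)
          calc (1 : ℝ) = (t * t⁻¹) ^ (24 * n) * (N * N⁻¹) := by
                rw [htt, mul_inv_cancel₀ hN0.ne']; simp
            _ = (t⁻¹) ^ (24 * n) * N⁻¹ * (t ^ (24 * n) * N) := by ring
            _ ≤ _ := by gcongr
        have h3 : |f x| * φ x ≤ |f x| * 1 := by gcongr; exact hφ1 x
        have h4 : |f x| * 1 ≤ |f x| * ((t⁻¹) ^ (24 * n) * N⁻¹ * |r x|) := by gcongr
        linarith
      · push Not at hxB
        have h1 : 1 ≤ |x - μ i₀| := by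
          have := hμ i₀ hi₀
          have := abs_sub_abs_le_abs_sub x (μ i₀)
          linarith
        have h2 : φ x ≤ 2 * s := by
          simp only [hφ]
          rw [neg_div]
          have h3 : (2 * s)⁻¹ ≤ (x - μ i₀) ^ 2 / (2 * s) := by
            rw [← one_div, ← sq_abs (x - μ i₀)]
            gcongr
            exact one_le_pow₀ h1
          calc _ ≤ Real.exp (-(2 * s)⁻¹) := Real.exp_le_exp.mpr (neg_le_neg h3)
            _ ≤ ((2 * s)⁻¹)⁻¹ := exp_neg_le_inv (by positivity)
            _ = _ := inv_inv _
        have h3 : |f x| * φ x ≤ |f x| * (2 * s) := by gcongr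
        linarith
  -- integrate
  have hfi : Integrable fun x => |f x| := by
    have := (integrable_combPDF_mul (S := S) (c := c) (μ := μ) hw0
      (tempered_eval 1)).abs
    simpa using this
  have hrf : Integrable fun x => |r x| * |f x| := by
    have := (integrable_combPDF_mul (S := S) (c := c) (μ := μ) hw0
      (tempered_eval (rootsPoly l))).abs
    refine this.congr (Filter.Eventually.of_forall fun x => ?_)
    simp only [abs_mul]
    rw [mul_comm]
  have hUfin : volume U ≠ ⊤ := (hU2.trans_lt ENNReal.ofReal_lt_top).ne
  have hUi : Integrable (U.indicator fun _ : ℝ => (t⁻¹) ^ 7) :=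
    (integrable_indicator_iff hU1).mpr (integrableOn_const hUfin)
  -- Each of the three integrals on the right is shown below to be at most t / 8, a contradiction.
  have hint : t / 2 ≤ ((t⁻¹) ^ (24 * n) * N⁻¹) * (∫ x, |r x| * |f x|) +
      volume.real U * (t⁻¹) ^ 7 + 2 * s * ∫ x, |f x| := by
    refine hbump.trans ?_
    rw [combInt_eq_integral hw0 hφt]
    refine (abs_integral_le_integral_abs).trans ?_
    have e : ∀ x, |combPDF S c μ w x * φ x| = |f x| * φ x := fun x => by
      rw [abs_mul, abs_of_nonneg (hφ0 x)]
    simp_rw [e]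
    refine (integral_mono_of_nonneg
      (Filter.Eventually.of_forall fun x => mul_nonneg (abs_nonneg _) (hφ0 x))
      (((hrf.const_mul _).add hUi).add (hfi.const_mul _))
      (Filter.Eventually.of_forall hpt)).trans_eq ?_
    rw [integral_add' ((hrf.const_mul _).add hUi) (hfi.const_mul _),
      integral_add' (hrf.const_mul _) hUi, integral_const_mul, integral_const_mul,
      integral_indicator_const _ hU1, smul_eq_mul]
  have hU4 : volume.real U * (t⁻¹) ^ 7 ≤ t / 8 := by
    have h1 : volume.real U ≤ 2 * t ^ 10 * l.length :=
      ENNReal.toReal_le_of_le_ofReal (by positivity) hU2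
    have h2 : (l.length : ℝ) ≤ t⁻¹ := le_trans (by exact_mod_cast hl) hdt
    calc _ ≤ (2 * t ^ 10 * t⁻¹) * (t⁻¹) ^ 7 := by
          gcongr; exact h1.trans (by gcongr)
      _ = 2 * t * t * (t * t⁻¹) ^ 8 := by ring
      _ = 2 * t * t := by rw [htt]; ring
      _ ≤ t / 8 := by nlinarith
  have hf4 : 2 * s * ∫ x, |f x| ≤ t / 8 := by
    have h1 := (integral_abs_combPDF_le S c μ hw0).trans hc
    have h3 : t ^ 10 ≤ 1 / 1000 := by
      calc t ^ 10 ≤ t ^ 1 := pow_le_pow_of_le_one ht.le ht1' (by norm_num)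
        _ ≤ _ := by linarith [pow_one t]
    calc _ ≤ 2 * s * t⁻¹ := by gcongr
      _ = 2 * t ^ 10 * t * (t * t⁻¹) := by rw [hs]; ring
      _ = 2 * t ^ 10 * t := by rw [htt]; ring
      _ ≤ 2 * (1 / 1000) * t := by gcongr
      _ ≤ t / 8 := by linarith
  have hr4 : ((t⁻¹) ^ (24 * n) * N⁻¹) * (∫ x, |r x| * |f x|) ≤ t / 8 := by
    calc _ ≤ ((t⁻¹) ^ (24 * n) * N⁻¹) * (t ^ (24 * n + 30) * N) := by gcongr
      _ = (t * t⁻¹) ^ (24 * n) * (N * N⁻¹) * t ^ 30 := by ring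
      _ = t ^ 30 := by rw [htt, mul_inv_cancel₀ hN0.ne']; simp
      _ ≤ t ^ 2 := pow_le_pow_of_le_one ht.le ht1' (by norm_num)
      _ ≤ t / 8 := by nlinarith
  linarith

/-! ### Identifiability from moments -/

variable {ι : Type*}

/-- The bounds on moments in terms of the scale `t`. -/
theorem abs_gaussMoment_le_scale {t : ℝ} (ht : 0 < t) (ht1 : t ≤ 1 / 1000) {J : ℕ}
    (hJ : (J : ℝ) ≤ t⁻¹) {μ v : ℝ} (hμ : |μ| ≤ t⁻¹) (hv : |v| ≤ t⁻¹) {j : ℕ} (hj : j ≤ J) :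
    |gaussMoment j μ v| ≤ (t⁻¹) ^ (2 * j) := by
  have hti : 1000 ≤ t⁻¹ := by
    rw [le_inv_comm₀ (by norm_num) ht]; linarith
  rw [pow_mul]
  refine abs_gaussMoment_le (R := t⁻¹) (by positivity) (by nlinarith) ?_ (by nlinarith) hμ hv hj
  calc 4 * ((J : ℝ) * t⁻¹) ≤ (t⁻¹ * t⁻¹) * (t⁻¹ * t⁻¹) := by gcongr; nlinarith
    _ = _ := by ring

theorem abs_gaussMoment_sub_le_scale {t : ℝ} (ht : 0 < t) (ht1 : t ≤ 1 / 1000) {J : ℕ}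
    (hJ : (J : ℝ) ≤ t⁻¹) {μ v μ' v' : ℝ} (hμ : |μ| ≤ t⁻¹) (hv : |v| ≤ t⁻¹) (hμ' : |μ'| ≤ t⁻¹)
    (hv' : |v'| ≤ t⁻¹) {j : ℕ} (hj : j ≤ J) :
    |gaussMoment j μ v - gaussMoment j μ' v'| ≤ (|μ - μ'| + |v - v'|) * (t⁻¹) ^ (2 * j) := by
  have hti : 1000 ≤ t⁻¹ := by
    rw [le_inv_comm₀ (by norm_num) ht]; linarith
  have h4 : 4 * ((J : ℝ) * t⁻¹) ≤ ((t⁻¹) ^ 2) ^ 2 := by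
    calc 4 * ((J : ℝ) * t⁻¹) ≤ (t⁻¹ * t⁻¹) * (t⁻¹ * t⁻¹) := by gcongr; nlinarith
      _ = _ := by ring
  rw [pow_mul]
  refine abs_gaussMoment_sub_le (R := t⁻¹) (by positivity) (by nlinarith) h4 (le_trans ?_ h4)
    (by nlinarith) hμ hv hμ' hv' hj
  have : (J : ℝ) * 1 ≤ J * t⁻¹ := by gcongr; linarith
  linarith

/-- If the low order moments of a separated signed combination of Gaussians are small, then so are
all coefficients. -/
theorem abs_coeff_le (P n : ℕ) {S : Finset ι} {c μ v : ι → ℝ} (hS : S.card = n)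
    (hP : 60 * n ≤ P) {t : ℝ} (ht : 0 < t) (ht1 : t ≤ 1 / 1000) (hn : 2 * (n : ℝ) * t ≤ 1)
    (hv : ∀ i ∈ S, |v i| ≤ t⁻¹) (hμ : ∀ i ∈ S, |μ i| ≤ t⁻¹) (hc : ∑ i ∈ S, |c i| ≤ t⁻¹)
    (hsep : ∀ i ∈ S, ∀ j ∈ S, i ≠ j → t ≤ |μ i - μ j| + |v i - v j|)
    (hm : ∀ j, j + 2 ≤ 2 * n → |∑ i ∈ S, c i * gaussMoment j (μ i) (v i)| ≤ t ^ P ^ n) :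
    ∀ i ∈ S, |c i| ≤ t := by
  classical
  -- The condition j + 2 ≤ 2 n stands for j ≤ 2 (n - 1) and is void for n = 0.
  induction n generalizing S with
  | zero => simp [Finset.card_eq_zero.mp hS]
  | succ n ih =>
    have ht1' : t ≤ 1 := by linarith
    have hti : 1000 ≤ t⁻¹ := by
      rw [le_inv_comm₀ (by norm_num) ht]; linarith
    have htt : t * t⁻¹ = 1 := mul_inv_cancel₀ ht.ne'
    obtain ⟨i₀, hi₀, hmin⟩ := S.exists_min_image v (Finset.card_pos.mp (by omega))
    have hPn : 1 ≤ P ^ n := Nat.one_le_pow _ _ (by omega)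
    -- The coefficient of smallest variance is bounded by this much smaller t', so that discarding
    -- its term costs only t * t ^ P ^ n in every moment needed later. The available accuracy
    -- suffices for t' because 60 (n + 1) ≤ P.
    set t' := t ^ (2 * P ^ n) with ht'
    have ht'0 : 0 < t' := by positivity
    have ht't : t' ≤ t := by
      calc t' ≤ t ^ 1 := pow_le_pow_of_le_one ht.le ht1' (by omega)
        _ = t := pow_one t
    have hinv : t⁻¹ ≤ t'⁻¹ := inv_anti₀ ht'0 ht't
    push_cast at hn
    have h₀ : |c i₀| ≤ t' := by
      refine abs_coeff_le_of_min_var hS ht'0 (ht't.trans ht1)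
        (le_trans (by gcongr) hn) (fun i hi => (hv i hi).trans hinv)
        (fun i hi => (hμ i hi).trans hinv) (hc.trans hinv)
        (fun i hi j hj hij => ht't.trans (hsep i hi j hj hij)) (fun j hj => ?_) hi₀ hmin
      refine (hm j (by omega)).trans ?_
      rw [ht', ← pow_mul]
      refine pow_le_pow_of_le_one ht.le ht1' ?_
      rw [pow_succ]
      calc 2 * P ^ n * (30 * (n + 1)) = P ^ n * (60 * (n + 1)) := by ring
        _ ≤ P ^ n * P := Nat.mul_le_mul_left _ hP
    intro i hi
    by_cases hii : i = i₀
    · rw [hii]; exact h₀.trans ht't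
    refine ih (S := S.erase i₀) (by rw [Finset.card_erase_of_mem hi₀]; omega) (by omega)
      (by nlinarith) (fun i hi => hv i (Finset.mem_of_mem_erase hi))
      (fun i hi => hμ i (Finset.mem_of_mem_erase hi))
      ((Finset.sum_le_sum_of_subset_of_nonneg (Finset.erase_subset _ _)
        fun i _ _ => abs_nonneg _).trans hc)
      (fun i hi j hj hij => hsep i (Finset.mem_of_mem_erase hi) j (Finset.mem_of_mem_erase hj) hij)
      (fun j hj => ?_) i (Finset.mem_erase.mpr ⟨hii, hi⟩)
    have h1 := hm j (by omega)
    rw [← Finset.add_sum_erase _ _ hi₀] at h1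
    have hJ : ((2 * n : ℕ) : ℝ) ≤ t⁻¹ := by
      rw [← one_div, le_div_iff₀ ht]
      push_cast
      nlinarith
    have h2 := abs_gaussMoment_le_scale ht ht1 hJ (hμ i₀ hi₀) (hv i₀ hi₀) (j := j) (by omega)
    have h3 : |c i₀ * gaussMoment j (μ i₀) (v i₀)| ≤ t * t ^ P ^ n := by
      rw [abs_mul]
      have hbig : 4 * n + 1 ≤ P ^ n := by
        calc 4 * n + 1 ≤ P := by omega
          _ = P ^ 1 := (pow_one P).symm
          _ ≤ P ^ n := Nat.pow_le_pow_right (by omega) (by omega)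
      obtain ⟨e, he⟩ := Nat.exists_eq_add_of_le hbig
      calc _ ≤ t' * (t⁻¹) ^ (2 * j) := by gcongr
        _ ≤ t' * (t⁻¹) ^ (4 * n) := by
          gcongr ?_ * ?_
          exact pow_le_pow_right₀ (by linarith) (by omega)
        _ = (t * t ^ P ^ n) * (t * t⁻¹) ^ (4 * n) * t ^ e := by
          rw [ht', two_mul, pow_add]
          nth_rewrite 2 [he]
          ring
        _ ≤ (t * t ^ P ^ n) * 1 * 1 := by
          rw [htt, one_pow]
          gcongr
          exact pow_le_one₀ ht.le ht1'
        _ = _ := by ring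
    have h4 : t ^ P ^ (n + 1) ≤ t * t ^ P ^ n := by
      rw [← pow_succ']
      refine pow_le_pow_of_le_one ht.le ht1' ?_
      rw [pow_succ]
      nlinarith
    have h5 : |∑ i ∈ S.erase i₀, c i * gaussMoment j (μ i) (v i)| ≤
        t * t ^ P ^ n + t * t ^ P ^ n := by
      have := abs_sub_abs_le_abs_add (∑ i ∈ S.erase i₀, c i * gaussMoment j (μ i) (v i))
        (c i₀ * gaussMoment j (μ i₀) (v i₀))
      rw [add_comm] at h1
      linarith
    have h6 : 0 < t ^ P ^ n := by positivity
    nlinarith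

/-- Among `N` numbers, none lies in one of `N + 1` successive gaps. -/
theorem exists_gap {κ : Type*} [Fintype κ] (d : κ → ℝ) {τ : ℕ → ℝ} (hτ : Antitone τ) :
    ∃ l ≤ Fintype.card κ, ∀ x, d x < τ (l + 1) ∨ τ l ≤ d x := by
  by_contra hcon
  push Not at hcon
  -- Otherwise each of the N + 1 disjoint intervals [τ (l + 1), τ l) would contain one of the N
  -- numbers.
  choose f hf using fun l : Fin (Fintype.card κ + 1) => hcon l (by omega)
  obtain ⟨a, b, hab, he⟩ := Fintype.exists_ne_map_eq_of_card_lt f (by simp)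
  have key : ∀ a b : Fin (Fintype.card κ + 1), a < b → f a = f b → False := by
    intro a b hlt he
    have h1 := (hf a).1
    have h2 := (hf b).2
    have h3 : τ b ≤ τ (a + 1) := hτ (by have : (a : ℕ) < b := hlt; omega)
    rw [he] at h1
    linarith
  rcases lt_or_gt_of_ne hab with h | h
  · exact key a b h he
  · exact key b a h he.symm

/-- Polynomial identifiability: separated mixtures with nearly the same low order moments have
nearly the same parameters. -/
theorem Params.close_of_moments {k : ℕ} (hk : 1 ≤ k) {F G : Params k} {a t : ℝ} (ht : 0 < t)
    (ht1 : t ≤ 1 / 1000) (hkt : 4 * (k : ℝ) * t ≤ 1) (hta : 2 * t < a)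
    (hF : F.IsGMM) (hG : G.IsGMM) (hFa : F.IsSeparated a) (hGa : G.IsSeparated a)
    (hFb : ∀ i, |F.μ i| ≤ t⁻¹ ∧ |F.v i| ≤ t⁻¹) (hGb : ∀ i, |G.μ i| ≤ t⁻¹ ∧ |G.v i| ≤ t⁻¹)
    (hm : ∀ j ≤ 4 * k - 2, |∑ i, F.w i * gaussMoment j (F.μ i) (F.v i) -
      ∑ i, G.w i * gaussMoment j (G.μ i) (G.v i)| ≤
        t ^ (120 * k) ^ ((2 * k + 1) * (k ^ 2 + 1))) :
    F.Close t G := by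
  classical
  set P := 120 * k with hP
  have hP1 : 1 ≤ P := by omega
  -- Merging moves parameters by less than T ^ Q. This has to stay below the accuracy T ^ P ^ n
  -- required for n ≤ 2 k components, even after multiplication by T ^ (-8 k).
  set Q := P ^ (2 * k + 1) with hQ
  have hQ1 : 1 ≤ Q := Nat.one_le_pow _ _ hP1
  have ht1' : t ≤ 1 := by linarith
  set dist : Fin k × Fin k → ℝ := fun x => |F.μ x.1 - G.μ x.2| + |F.v x.1 - G.v x.2| with hdist
  have hanti : Antitone fun l : ℕ => t ^ Q ^ l := fun l l' h =>
    pow_le_pow_of_le_one ht.le ht1' (Nat.pow_le_pow_right hQ1 h)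
  -- There are k² distances between a component of F and one of G, so among k² + 1 scales some T has
  -- none of them in [T ^ Q, T).
  obtain ⟨l, hl, hgap⟩ := exists_gap dist hanti
  rw [Fintype.card_prod, Fintype.card_fin] at hl
  set T := t ^ Q ^ l with hT
  have hT' : t ^ Q ^ (l + 1) = T ^ Q := by rw [hT, ← pow_mul t, ← pow_succ Q]
  rw [hT'] at hgap
  have hT0 : 0 < T := by positivity
  have hTt : T ≤ t := by
    calc T ≤ t ^ 1 := pow_le_pow_of_le_one ht.le ht1' (Nat.one_le_pow _ _ hQ1)
      _ = t := pow_one t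
  have hT1 : T ≤ 1 := hTt.trans ht1'
  have hTQ : T ^ Q ≤ T := by
    calc T ^ Q ≤ T ^ 1 := pow_le_pow_of_le_one hT0.le hT1 hQ1
      _ = T := pow_one T
  have hTQ0 : 0 < T ^ Q := by positivity
  have hinv : t⁻¹ ≤ T⁻¹ := inv_anti₀ hT0 hTt
  have hTi : 1000 ≤ T⁻¹ := by
    rw [le_inv_comm₀ (by norm_num) hT0]; linarith
  have hTT : T * T⁻¹ = 1 := mul_inv_cancel₀ hT0.ne'
  -- the combined family
  let ρ : Fin k → Fin k ⊕ Fin k := fun j =>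
    if h : ∃ i, dist (i, j) < T ^ Q then Sum.inl h.choose else Sum.inr j
  have hρl : ∀ i j, ρ j = Sum.inl i → dist (i, j) < T ^ Q := by
    intro i j h
    simp only [ρ] at h
    split_ifs at h with h'
    rw [← Sum.inl.inj h]
    exact h'.choose_spec
  have hρr : ∀ j j', ρ j = Sum.inr j' → j = j' ∧ ∀ i, T ≤ dist (i, j) := by
    intro j j' h
    simp only [ρ] at h
    split_ifs at h with h'
    refine ⟨Sum.inr.inj h, fun i => ?_⟩
    push Not at h'
    rcases hgap (i, j) with h1 | h1
    · exact absurd h1 (not_lt.mpr (h' i))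
    · exact h1
  let M : Fin k ⊕ Fin k → ℝ := Sum.elim F.μ G.μ
  let V : Fin k ⊕ Fin k → ℝ := Sum.elim F.v G.v
  -- ρ sends a component of G to one of F within T ^ Q if there is one, and to itself otherwise. S
  -- keeps all of F and the unmerged part of G.
  let S : Finset (Fin k ⊕ Fin k) := Finset.univ.filter fun x => (∃ i, Sum.inl i = x) ∨ ∃ j, ρ j = x
  have hSl : ∀ i, Sum.inl i ∈ S := fun i => by simp [S]
  have hSρ : ∀ j, ρ j ∈ S := fun j => by simp [S]
  have hSr : ∀ j, Sum.inr j ∈ S → ∀ i, T ≤ dist (i, j) := by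
    intro j hj
    simp only [S, Finset.mem_filter, Finset.mem_univ, true_and] at hj
    rcases hj with ⟨i, hi⟩ | ⟨j', hj'⟩
    · simp at hi
    · obtain ⟨rfl, h⟩ := hρr j' j hj'
      exact h
  let wl : Fin k ⊕ Fin k → ℝ := Sum.elim F.w fun _ => 0
  -- The coefficients of F - G after merging.
  let c : Fin k ⊕ Fin k → ℝ := fun x => wl x - ∑ j with ρ j = x, G.w j
  have hsumS : ∀ h : Fin k ⊕ Fin k → ℝ, ∑ x ∈ S, wl x * h x = ∑ i, F.w i * h (Sum.inl i) := by
    intro h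
    rw [Finset.sum_subset (Finset.subset_univ S), Fintype.sum_sum_type]
    · simp [wl]
    · intro x _ hx
      rcases x with i | j
      · exact absurd (hSl i) hx
      · simp [wl]
  have hsumG : ∀ h : Fin k ⊕ Fin k → ℝ,
      ∑ x ∈ S, (∑ j with ρ j = x, G.w j) * h x = ∑ j, G.w j * h (ρ j) := by
    intro h
    rw [← Finset.sum_fiberwise_of_maps_to (s := Finset.univ) (t := S) (g := ρ)
      (fun j _ => hSρ j)]
    refine Finset.sum_congr rfl fun x _ => ?_
    rw [Finset.sum_mul]
    refine Finset.sum_congr rfl fun j hj => ?_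
    rw [(Finset.mem_filter.mp hj).2]
  have hsum : ∀ h : Fin k ⊕ Fin k → ℝ,
      ∑ x ∈ S, c x * h x = ∑ i, F.w i * h (Sum.inl i) - ∑ j, G.w j * h (ρ j) := by
    intro h
    rw [← hsumS, ← hsumG, ← Finset.sum_sub_distrib]
    exact Finset.sum_congr rfl fun x _ => sub_mul _ _ _
  have hcard : S.card ≤ 2 * k := by
    refine (Finset.card_le_univ S).trans ?_
    simp
    omega
  have hcardR : (S.card : ℝ) ≤ 2 * k := by exact_mod_cast hcard
  have hJ : ((4 * k : ℕ) : ℝ) ≤ T⁻¹ := by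
    rw [← one_div, le_div_iff₀ hT0]
    push_cast
    calc 4 * (k : ℝ) * T ≤ 4 * k * t := by gcongr
      _ ≤ 1 := hkt
  have hMb : ∀ x, |M x| ≤ T⁻¹ := by
    rintro (i | j)
    · exact (hFb i).1.trans hinv
    · exact (hGb j).1.trans hinv
  have hVb : ∀ x, |V x| ≤ T⁻¹ := by
    rintro (i | j)
    · exact (hFb i).2.trans hinv
    · exact (hGb j).2.trans hinv
  have hcoef : ∀ x ∈ S, |c x| ≤ T := by
    refine abs_coeff_le P S.card (μ := M) (v := V) rfl (by omega) hT0 (hTt.trans ht1) ?_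
      (fun x _ => hVb x) (fun x _ => hMb x) ?_ ?_ ?_
    · calc 2 * (S.card : ℝ) * T ≤ 2 * (2 * k) * t := by gcongr
        _ ≤ 1 := by linarith
    · calc ∑ x ∈ S, |c x| ≤ ∑ x ∈ S, (wl x * 1 + (∑ j with ρ j = x, G.w j) * 1) := by
            refine Finset.sum_le_sum fun x _ => ?_
            have h1 : 0 ≤ wl x := by
              rcases x with i | j
              · exact hF.1 i
              · exact le_rfl
            have h2 : 0 ≤ ∑ j with ρ j = x, G.w j := Finset.sum_nonneg fun j _ => hG.1 j
            rw [mul_one, mul_one, abs_le]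
            constructor <;> simp only [c] <;> linarith
        _ = 2 := by
          rw [Finset.sum_add_distrib, hsumS fun _ => 1, hsumG fun _ => 1]
          simp only [mul_one]
          rw [hF.2.1, hG.2.1]
          norm_num
        _ ≤ T⁻¹ := by linarith
    -- Within F or within G the separation is a > 2 t ≥ T; between F and an unmerged component of G
    -- it is at least T by the gap.
    · rintro (i | i) hi (j | j) hj hij
      · have := hFa.2 i j (by simpa using hij)
        simp only [Params.compDist] at this
        simp only [M, V, Sum.elim_inl]
        linarith
      · exact hSr j hj i
      · have := hSr i hi j
        simp only [M, V, Sum.elim_inl, Sum.elim_inr]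
        rw [abs_sub_comm, abs_sub_comm (G.v i)]
        exact this
      · have := hGa.2 i j (by simpa using hij)
        simp only [Params.compDist] at this
        simp only [M, V, Sum.elim_inr]
        linarith
    · intro j hj
      rw [hsum fun x => gaussMoment j (M x) (V x)]
      have h1 := hm j (by omega)
      -- The change of the moments caused by merging.
      have h2 : |∑ i, G.w i * gaussMoment j (G.μ i) (G.v i) -
          ∑ i, G.w i * gaussMoment j (M (ρ i)) (V (ρ i))| ≤ T ^ Q * (T⁻¹) ^ (8 * k) := by
        rw [← Finset.sum_sub_distrib]
        calc _ ≤ ∑ i, G.w i * (T ^ Q * (T⁻¹) ^ (8 * k)) := by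
              refine (Finset.abs_sum_le_sum_abs _ _).trans (Finset.sum_le_sum fun i _ => ?_)
              rw [← mul_sub, abs_mul, abs_of_nonneg (hG.1 i)]
              refine mul_le_mul_of_nonneg_left ?_ (hG.1 i)
              have h3 := abs_gaussMoment_sub_le_scale hT0 (hTt.trans ht1) hJ
                ((hGb i).1.trans hinv) ((hGb i).2.trans hinv) (hMb (ρ i)) (hVb (ρ i))
                (j := j) (by omega)
              have h4 : |G.μ i - M (ρ i)| + |G.v i - V (ρ i)| ≤ T ^ Q := by
                rcases hx : ρ i with i' | i'
                · have := hρl i' i hx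
                  simp only [hdist] at this
                  simp only [M, V, Sum.elim_inl]
                  rw [abs_sub_comm, abs_sub_comm (G.v i)]
                  exact this.le
                · obtain ⟨rfl, -⟩ := hρr i i' hx
                  simp [M, V, hTQ0.le]
              refine h3.trans (mul_le_mul h4 ?_ (by positivity) hTQ0.le)
              exact pow_le_pow_right₀ (by linarith) (by omega)
          _ = _ := by rw [← Finset.sum_mul, hG.2.1, one_mul]
      have h5 : t ^ P ^ ((2 * k + 1) * (k ^ 2 + 1)) ≤ T ^ Q * 1 := by
        rw [mul_one, ← hT', pow_mul, ← hQ]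
        exact hanti (by rw [sq]; omega)
      have h6 : P ^ S.card + 8 * k + 1 ≤ Q := by
        have h7 : P ^ S.card ≤ P ^ (2 * k) := Nat.pow_le_pow_right hP1 hcard
        have h8 : P ≤ P ^ (2 * k) := Nat.le_self_pow (by omega) P
        rw [hQ, pow_succ]
        nlinarith
      obtain ⟨e, he⟩ := Nat.exists_eq_add_of_le h6
      have h7 : T ^ Q * (T⁻¹) ^ (8 * k) ≤ T * T ^ P ^ S.card := by
        calc T ^ Q * (T⁻¹) ^ (8 * k) = T * T ^ P ^ S.card * (T * T⁻¹) ^ (8 * k) * T ^ e := by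
              rw [he]; ring
          _ ≤ T * T ^ P ^ S.card * 1 * 1 := by
            rw [hTT, one_pow]
            gcongr
            exact pow_le_one₀ hT0.le hT1
          _ = _ := by ring
      have h8 : T ^ Q * 1 ≤ T ^ Q * (T⁻¹) ^ (8 * k) := by
        gcongr
        exact one_le_pow₀ (by linarith)
      have h9 := abs_sub_le (∑ i, F.w i * gaussMoment j (F.μ i) (F.v i))
        (∑ i, G.w i * gaussMoment j (G.μ i) (G.v i))
        (∑ i, G.w i * gaussMoment j (M (ρ i)) (V (ρ i)))
      have h10 : 0 < T ^ P ^ S.card := by positivity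
      have h11 : T * T ^ P ^ S.card ≤ (1 / 1000) * T ^ P ^ S.card := by gcongr; linarith
      simp only [M, V, Sum.elim_inl] at h2 h9 ⊢
      linarith
  -- every component of `F` is matched
  have hex : ∀ i, ∃ j, ρ j = Sum.inl i := by
    intro i
    by_contra hno
    push Not at hno
    have h1 := hcoef _ (hSl i)
    have h2 : c (Sum.inl i) = F.w i := by
      simp only [c, wl, Sum.elim_inl]
      rw [Finset.filter_false_of_mem fun j _ => hno j]
      simp
    rw [h2] at h1
    -- An unmatched component of F would keep its full weight, at least a > 2 t, contradicting the
    -- bound T ≤ t on the coefficients.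
    have := hFa.1 i
    have := le_abs_self (F.w i)
    linarith
  choose π hπ using hex
  have hinj : Function.Injective π := fun i i' h => by
    have := hπ i
    rw [h, hπ i'] at this
    exact (Sum.inl.inj this).symm
  have hbij : Function.Bijective π := Finite.injective_iff_bijective.mp hinj
  refine ⟨Equiv.ofBijective π hbij, fun i => ?_⟩
  rw [Equiv.ofBijective_apply]
  have hd := hρl i (π i) (hπ i)
  simp only [hdist] at hd
  have h1 := abs_nonneg (F.μ i - G.μ (π i))
  have h2 := abs_nonneg (F.v i - G.v (π i))
  refine ⟨?_, by linarith, by linarith⟩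
  -- By bijectivity exactly one component of G is merged into i, so the coefficient at i is the
  -- difference of the two weights.
  have h3 : (Finset.univ.filter fun j => ρ j = Sum.inl i) = {π i} := by
    ext j
    simp only [Finset.mem_filter, Finset.mem_univ, true_and, Finset.mem_singleton]
    constructor
    · intro hj
      obtain ⟨i', rfl⟩ := hbij.2 j
      rw [hπ i'] at hj
      rw [Sum.inl.inj hj]
    · rintro rfl
      exact hπ i
  have h4 := hcoef _ (hSl i)
  simp only [c, wl, Sum.elim_inl, h3, Finset.sum_singleton] at h4
  exact h4.trans hTt

/-! ### Admissible mixtures: bounds, rounding and sampling error -/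

namespace Params

variable {k : ℕ}

theorem integral_law {F : Params k} (hF : F.IsGMM) {f : ℝ → ℝ}
    (hf : ∀ μ v, Integrable f (gaussianReal μ v)) :
    ∫ x, f x ∂F.law = ∑ i, F.w i * ∫ x, f x ∂gaussianReal (F.μ i) (F.v i).toNNReal := by
  rw [law, integral_finsetSum_measure fun i _ => (hf _ _).smul_measure ENNReal.ofReal_ne_top]
  refine Finset.sum_congr rfl fun i _ => ?_
  rw [integral_smul_measure, ENNReal.toReal_ofReal (hF.1 i), smul_eq_mul]

theorem integrable_law (F : Params k) {f : ℝ → ℝ}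
    (hf : ∀ μ v, Integrable f (gaussianReal μ v)) : Integrable f F.law := by
  rw [law, integrable_finsetSum_measure]
  exact fun i _ => (hf _ _).smul_measure ENNReal.ofReal_ne_top

theorem rawMoment_eq {F : Params k} (hF : F.IsGMM) (j : ℕ) :
    F.rawMoment j = ∑ i, F.w i * gaussMoment j (F.μ i) (F.v i) := by
  rw [rawMoment, integral_law hF fun μ v => integrable_pow_gaussianReal μ v j]
  refine Finset.sum_congr rfl fun i _ => ?_
  rw [integral_pow_gaussianReal, Real.coe_toNNReal _ (hF.2.2 i).le]

theorem isProbabilityMeasure_law {F : Params k} (hF : F.IsGMM) : IsProbabilityMeasure F.law := by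
  constructor
  simp only [law, Measure.coe_finsetSum, Finset.sum_apply, Measure.smul_apply, measure_univ,
    smul_eq_mul, mul_one]
  rw [← ENNReal.ofReal_sum_of_nonneg fun i _ => hF.1 i, hF.2.1, ENNReal.ofReal_one]

/-- Components of an admissible mixture have bounded parameters. -/
theorem sq_add_le_of_variance {F : Params k} (hF : F.IsGMM) {ε : ℝ} (hε : 0 < ε)
    (hsep : F.IsSeparated ε) (hmean : ∫ y, y ∂F.law = 0) (hvar : Var[id; F.law] ≤ 2) (i : Fin k) :
    F.μ i ^ 2 + F.v i ≤ 2 / ε := by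
  have := isProbabilityMeasure_law hF
  have h1 : Var[id; F.law] = F.rawMoment 2 := by
    rw [variance_of_integral_eq_zero aemeasurable_id (by simpa using hmean)]
    simp [rawMoment]
  rw [h1, rawMoment_eq hF] at hvar
  -- The second moment is a sum of nonnegative contributions, so each is at most 2; dividing by a
  -- weight of at least ε gives the bound.
  have h2 : F.w i * gaussMoment 2 (F.μ i) (F.v i) ≤ 2 := by
    refine le_trans (Finset.single_le_sum (f := fun i => F.w i * gaussMoment 2 (F.μ i) (F.v i))
      (fun i _ => ?_) (Finset.mem_univ i)) hvar
    have := hF.1 i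
    have := hF.2.2 i
    simp only [gaussMoment]
    push_cast
    nlinarith [mul_nonneg (hF.1 i) this.le, mul_nonneg (hF.1 i) (mul_self_nonneg (F.μ i))]
  have h3 : gaussMoment 2 (F.μ i) (F.v i) = F.μ i ^ 2 + F.v i := by
    simp [gaussMoment]; ring
  rw [h3] at h2
  rw [le_div_iff₀ hε]
  have h4 : 0 ≤ F.μ i ^ 2 + F.v i := by have := hF.2.2 i; positivity
  have := mul_le_mul_of_nonneg_right (hsep.1 i) h4
  linarith

/-- The weight errors contribute k summands of size k η times a moment bound. The parameter errors
contribute 2 η times a Lipschitz bound, as the weights of G sum to one. -/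
theorem abs_moment_sub_le {F G : Params k} (hG : G.IsGMM) {t η : ℝ} (ht : 0 < t)
    (ht1 : t ≤ 1 / 1000) {J : ℕ} (hJ : (J : ℝ) ≤ t⁻¹) (hη : 0 ≤ η)
    (hFb : ∀ i, |F.μ i| ≤ t⁻¹ ∧ |F.v i| ≤ t⁻¹) (hGb : ∀ i, |G.μ i| ≤ t⁻¹ ∧ |G.v i| ≤ t⁻¹)
    (hw : ∀ i, |F.w i - G.w i| ≤ k * η) (hμ : ∀ i, |F.μ i - G.μ i| ≤ η)
    (hv : ∀ i, |F.v i - G.v i| ≤ η) {j : ℕ} (hj : j ≤ J) :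
    |∑ i, F.w i * gaussMoment j (F.μ i) (F.v i) - ∑ i, G.w i * gaussMoment j (G.μ i) (G.v i)| ≤
      (k ^ 2 + 2) * η * (t⁻¹) ^ (2 * J) := by
  have hti : 1000 ≤ t⁻¹ := by
    rw [le_inv_comm₀ (by norm_num) ht]; linarith
  have hpow : (t⁻¹) ^ (2 * j) ≤ (t⁻¹) ^ (2 * J) := pow_le_pow_right₀ (by linarith) (by omega)
  rw [← Finset.sum_sub_distrib]
  calc _ ≤ ∑ i, (k * η * (t⁻¹) ^ (2 * J) + G.w i * ((η + η) * (t⁻¹) ^ (2 * J))) := by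
        refine (Finset.abs_sum_le_sum_abs _ _).trans (Finset.sum_le_sum fun i _ => ?_)
        have e : F.w i * gaussMoment j (F.μ i) (F.v i) - G.w i * gaussMoment j (G.μ i) (G.v i) =
          (F.w i - G.w i) * gaussMoment j (F.μ i) (F.v i) +
            G.w i * (gaussMoment j (F.μ i) (F.v i) - gaussMoment j (G.μ i) (G.v i)) := by ring
        rw [e]
        refine (abs_add_le _ _).trans (add_le_add ?_ ?_)
        · rw [abs_mul]
          have := abs_gaussMoment_le_scale ht ht1 hJ (hFb i).1 (hFb i).2 hj
          exact mul_le_mul (hw i) (this.trans hpow) (abs_nonneg _) (by positivity)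
        · rw [abs_mul, abs_of_nonneg (hG.1 i)]
          refine mul_le_mul_of_nonneg_left ?_ (hG.1 i)
          have := abs_gaussMoment_sub_le_scale ht ht1 hJ (hFb i).1 (hFb i).2 (hGb i).1 (hGb i).2 hj
          exact this.trans (mul_le_mul (add_le_add (hμ i) (hv i)) hpow (by positivity)
            (by positivity))
    _ = _ := by
      rw [Finset.sum_add_distrib, ← Finset.sum_mul Finset.univ G.w, hG.2.1]
      simp
      ring

theorem floor_div_near {x : ℝ} {N : ℕ} (hN : 0 < N) :
    (⌊x * N⌋ : ℝ) * (1 / N) ≤ x ∧ x - 1 / N ≤ (⌊x * N⌋ : ℝ) * (1 / N) := by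
  have hN' : (0 : ℝ) < N := by exact_mod_cast hN
  rw [mul_one_div, div_le_iff₀ hN', le_div_iff₀ hN', sub_mul, one_div, inv_mul_cancel₀ hN'.ne']
  exact ⟨Int.floor_le _, (Int.sub_one_lt_floor _).le⟩

/-- Rounding the parameters of an admissible mixture to the grid. -/
theorem exists_candidate_near {F : Params k} (hF : F.IsGMM) {ε : ℝ} (hε : 0 < ε) (hε1 : ε ≤ 1)
    (hsep : F.IsSeparated ε) (hbd : ∀ i, F.μ i ^ 2 + F.v i ≤ 2 / ε) {N : ℕ} (hN : 0 < N)
    (hkN : (k : ℝ) / N ≤ ε / 2) (h8N : (8 : ℝ) / N ≤ ε) :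
    ∃ G : Params k, G.IsCandidate ε (1 / N) ∧ ∀ i, |F.w i - G.w i| ≤ k * (1 / N) ∧
      |F.μ i - G.μ i| ≤ 1 / N ∧ |F.v i - G.v i| ≤ 1 / N := by
  classical
  have hN' : (0 : ℝ) < N := by exact_mod_cast hN
  have hγ0 : (0 : ℝ) < 1 / N := by positivity
  have h8 : 8 * (1 / (N : ℝ)) ≤ ε := by rw [mul_one_div]; exact h8N
  have hkγ : k * (1 / (N : ℝ)) ≤ ε / 2 := by rw [mul_one_div]; exact hkN
  have h2ε : 2 ≤ 2 / ε := by rw [le_div_iff₀ hε]; linarith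
  obtain ⟨i₀⟩ : Nonempty (Fin k) := by
    by_contra hne
    rw [not_nonempty_iff] at hne
    simpa using hF.2.1
  set S := Finset.univ.erase i₀ with hS
  have hScard : (S.card : ℝ) ≤ k := by
    exact_mod_cast (Finset.card_le_univ S).trans_eq (Fintype.card_fin k)
  have hsumF : F.w i₀ = 1 - ∑ i ∈ S, F.w i := by
    rw [← hF.2.1, ← Finset.add_sum_erase _ _ (Finset.mem_univ i₀)]; ring
  -- All weights but one are rounded down, and that one absorbs the total error so that the sum is
  -- exactly 1.
  let W : Fin k → ℤ := fun i => if i = i₀ then N - ∑ i ∈ S, ⌊F.w i * N⌋ else ⌊F.w i * N⌋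
  -- The maximum keeps the rounded variance positive.
  let Z : Fin k → ℤ := fun i => max ⌊F.v i * N⌋ 1
  let G : Params k := ⟨fun i => W i * (1 / N),
    fun i => ⌊F.μ i * N⌋ * (1 / N), fun i => Z i * (1 / N)⟩
  have hw₀ : (W i₀ : ℝ) * (1 / N) = 1 - ∑ i ∈ S, (⌊F.w i * N⌋ : ℝ) * (1 / N) := by
    simp only [W, if_true]
    push_cast
    rw [sub_mul, Finset.sum_mul]
    field_simp
  have hwi : ∀ i, i ≠ i₀ → (W i : ℝ) = ⌊F.w i * N⌋ := fun i hi => by simp [W, hi]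
  have hwlow : ∀ i, F.w i - 1 / N ≤ W i * (1 / N) := by
    intro i
    by_cases hi : i = i₀
    · rw [hi, hw₀, hsumF]
      have := Finset.sum_le_sum fun i (_ : i ∈ S) => (floor_div_near (x := F.w i) hN).1
      linarith
    · rw [hwi i hi]; exact (floor_div_near hN).2
  have hk1 : (1 : ℝ) ≤ k := by exact_mod_cast Fin.pos i₀
  have hγk : 1 / (N : ℝ) ≤ k * (1 / N) := by nlinarith
  have hwclose : ∀ i, |F.w i - W i * (1 / N)| ≤ k * (1 / N) := by
    intro i
    rw [abs_le]
    have h1 := hwlow i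
    refine ⟨?_, by linarith⟩
    by_cases hi : i = i₀
    · rw [hi, hw₀, hsumF]
      have := Finset.sum_le_sum fun i (_ : i ∈ S) => (floor_div_near (x := F.w i) hN).2
      rw [Finset.sum_sub_distrib, Finset.sum_const, nsmul_eq_mul] at this
      have h2 : (S.card : ℝ) * (1 / N) ≤ k * (1 / N) := by gcongr
      linarith
    · rw [hwi i hi]
      have := (floor_div_near (x := F.w i) hN).1
      linarith
  have hμclose : ∀ i, |F.μ i - ⌊F.μ i * N⌋ * (1 / N)| ≤ 1 / N := by
    intro i
    have := floor_div_near (x := F.μ i) hN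
    rw [abs_le]
    constructor <;> linarith
  have hZ : ∀ i, (Z i : ℝ) * (1 / N) = max ((⌊F.v i * N⌋ : ℝ) * (1 / N)) (1 / N) := by
    intro i
    simp only [Z]
    push_cast
    rw [max_mul_of_nonneg _ _ hγ0.le, one_mul]
  have hvclose : ∀ i, |F.v i - Z i * (1 / N)| ≤ 1 / N := by
    intro i
    have h1 := floor_div_near (x := F.v i) hN
    have h2 := hF.2.2 i
    rw [hZ, abs_le]
    rcases max_cases ((⌊F.v i * N⌋ : ℝ) * (1 / N)) (1 / N) with ⟨h, h'⟩ | ⟨h, h'⟩ <;> rw [h] <;>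
      constructor <;> linarith
  have hZpos : ∀ i, 0 < (Z i : ℝ) * (1 / N) := fun i => by
    rw [hZ]; exact lt_of_lt_of_le hγ0 (le_max_right _ _)
  have hsumG : ∑ i, (W i : ℝ) * (1 / N) = 1 := by
    rw [← Finset.add_sum_erase _ _ (Finset.mem_univ i₀), hw₀]
    have : ∑ i ∈ S, (W i : ℝ) * (1 / N) = ∑ i ∈ S, (⌊F.w i * N⌋ : ℝ) * (1 / N) :=
      Finset.sum_congr rfl fun i hi => by rw [hwi i (Finset.ne_of_mem_erase hi)]
    rw [← hS, this]
    ring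
  have hwε : ∀ i, ε / 2 ≤ W i * (1 / N) := fun i => by
    have := hwlow i
    have := hsep.1 i
    linarith
  refine ⟨G, ⟨⟨fun i => ?_, hsumG, hZpos⟩, ⟨hwε, ?_⟩, ?_, fun i => ⟨⟨_, rfl⟩, ⟨_, rfl⟩, _, rfl⟩⟩,
    fun i => ⟨hwclose i, hμclose i, hvclose i⟩⟩
  · have := hwε i
    change 0 ≤ (W i : ℝ) * (1 / N)
    linarith
  -- Every mean and variance moves by at most 1/N, hence every parameter distance by at most 4/N ≤
  -- ε/2.
  · intro i j hij
    have h1 := hsep.2 i j hij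
    simp only [compDist, G] at h1 ⊢
    have h2 := abs_sub_abs_le_abs_sub (F.μ i - F.μ j)
      ((F.μ i - ⌊F.μ i * N⌋ * (1 / N)) - (F.μ j - ⌊F.μ j * N⌋ * (1 / N)))
    have h3 := abs_sub_abs_le_abs_sub (F.v i - F.v j)
      ((F.v i - Z i * (1 / N)) - (F.v j - Z j * (1 / N)))
    have h4 := abs_sub (F.μ i - ⌊F.μ i * N⌋ * (1 / N)) (F.μ j - ⌊F.μ j * N⌋ * (1 / N))
    have h5 := abs_sub (F.v i - Z i * (1 / N)) (F.v j - Z j * (1 / N))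
    have e1 : F.μ i - F.μ j - ((F.μ i - ⌊F.μ i * N⌋ * (1 / N)) - (F.μ j - ⌊F.μ j * N⌋ * (1 / N))) =
      ⌊F.μ i * N⌋ * (1 / N) - ⌊F.μ j * N⌋ * (1 / N) := by ring
    have e2 : F.v i - F.v j - ((F.v i - Z i * (1 / N)) - (F.v j - Z j * (1 / N))) =
      Z i * (1 / N) - Z j * (1 / N) := by ring
    rw [e1] at h2
    rw [e2] at h3
    linarith [hμclose i, hμclose j, hvclose i, hvclose j]
  · intro i
    have h1 := hbd i
    have h2 := hF.2.2 i
    constructor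
    · change |(⌊F.μ i * N⌋ : ℝ) * (1 / N)| ≤ 2 / ε
      have h3 := abs_sub_abs_le_abs_sub ((⌊F.μ i * N⌋ : ℝ) * (1 / N)) (F.μ i)
      rw [abs_sub_comm] at h3
      have h4 := hμclose i
      have h5 : |F.μ i| ^ 2 ≤ 2 / ε := by rw [sq_abs]; linarith
      nlinarith [sq_nonneg (|F.μ i| - 3 / 2)]
    · change |(Z i : ℝ) * (1 / N)| ≤ 2 / ε
      rw [abs_of_pos (hZpos i), hZ]
      refine max_le ?_ (by linarith)
      have := (floor_div_near (x := F.v i) hN).1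
      nlinarith [sq_nonneg (F.μ i)]

/-- Chebyshev's inequality for the sample moments. -/
theorem measure_sampleMoment_le {F : Params k} {Ω : Type*} [MeasurableSpace Ω]
    (P : Measure Ω) [IsProbabilityMeasure P] {X : ℕ → Ω → ℝ} (hX : ∀ l, Measurable (X l))
    (hind : iIndepFun X P) (hlaw : ∀ l, P.map (X l) = F.law) {J m : ℕ} {a B δ : ℝ} (hm : 0 < m)
    (ha : 0 < a) (hB : ∀ j ≤ J, F.rawMoment (2 * j) ≤ B) (hδ : J * B ≤ m * a ^ 2 * δ) :
    P {ω | ∃ j ∈ Finset.Icc 1 J, a ≤ |sampleMoment (fun l => X l ω) m j - F.rawMoment j|} ≤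
      ENNReal.ofReal δ := by
  have hm' : (0 : ℝ) < m := by exact_mod_cast hm
  have hint : ∀ (l : ℕ) (j : ℕ), ∫ ω, X l ω ^ j ∂P = F.rawMoment j := by
    intro l j
    rw [rawMoment, ← hlaw l, integral_map (hX l).aemeasurable (by fun_prop)]
  have hinte : ∀ (l : ℕ) (j : ℕ), Integrable (fun ω => X l ω ^ j) P := by
    intro l j
    have := F.integrable_law fun μ v => integrable_pow_gaussianReal μ v j
    rw [← hlaw l, integrable_map_measure (by fun_prop) (hX l).aemeasurable] at this
    exact this
  have hLp : ∀ (l : ℕ) (j : ℕ), MemLp (fun ω => X l ω ^ j) 2 P := by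
    intro l j
    rw [memLp_two_iff_integrable_sq (by have := hX l; fun_prop)]
    simp_rw [← pow_mul]
    exact hinte l _
  -- Chebyshev for the sum of m independent powers, each of variance at most E[x ^ (2 j)] ≤ B. The
  -- union over j costs the factor J.
  have hone : ∀ j ∈ Finset.Icc 1 J,
      P {ω | a ≤ |sampleMoment (fun l => X l ω) m j - F.rawMoment j|} ≤
        ENNReal.ofReal (B / (m * a ^ 2)) := by
    intro j hj
    have hj := (Finset.mem_Icc.mp hj).2
    set Y : Ω → ℝ := ∑ l ∈ Finset.range m, fun ω => X l ω ^ j with hY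
    have hYL : MemLp Y 2 P := memLp_finsetSum' _ fun l _ => hLp l j
    have hYE : P[Y] = m * F.rawMoment j := by
      have : Y = fun ω => ∑ l ∈ Finset.range m, X l ω ^ j := by
        funext ω; simp [hY]
      rw [this, integral_finsetSum _ fun l _ => hinte l j]
      simp [hint]
    have hYV : Var[Y; P] ≤ m * B := by
      rw [hY, IndepFun.variance_sum (fun l _ => hLp l j)]
      · calc _ ≤ ∑ _l ∈ Finset.range m, B := by
              refine Finset.sum_le_sum fun l _ => ?_
              refine (variance_le_expectation_sq (by have := hX l; fun_prop)).trans ?_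
              have : P[(fun ω => X l ω ^ j) ^ 2] = F.rawMoment (2 * j) := by
                rw [← hint l (2 * j)]
                refine integral_congr_ae (Filter.Eventually.of_forall fun ω => ?_)
                simp only [Pi.pow_apply]
                rw [← pow_mul, mul_comm]
              rw [this]
              exact hB j hj
          _ = _ := by simp
      · intro l _ l' _ hne
        have := (hind.indepFun hne).comp (φ := fun x => x ^ j) (ψ := fun x => x ^ j)
          (by fun_prop) (by fun_prop)
        exact this
    have hch := meas_ge_le_variance_div_sq hYL (c := m * a) (by positivity)
    refine (measure_mono fun ω hω => ?_).trans (hch.trans (ENNReal.ofReal_le_ofReal ?_))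
    · simp only [Set.mem_ofPred_eq] at hω ⊢
      have e : Y ω - P[Y] = m * (sampleMoment (fun l => X l ω) m j - F.rawMoment j) := by
        rw [hYE, sampleMoment, hY]
        simp only [Finset.sum_apply]
        field_simp
      rw [e, abs_mul, abs_of_pos hm']
      gcongr
    · rw [div_le_div_iff₀ (by positivity) (by positivity)]
      calc _ ≤ m * B * (m * a ^ 2) := by gcongr
        _ = _ := by ring
  have hset : {ω | ∃ j ∈ Finset.Icc 1 J, a ≤ |sampleMoment (fun l => X l ω) m j - F.rawMoment j|} =
      ⋃ j ∈ Finset.Icc 1 J, {ω | a ≤ |sampleMoment (fun l => X l ω) m j - F.rawMoment j|} := by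
    ext ω; simp
  rw [hset]
  refine (measure_biUnion_finset_le _ _).trans ((Finset.sum_le_sum hone).trans ?_)
  rw [Finset.sum_const, Nat.card_Icc, Nat.add_sub_cancel, nsmul_eq_mul,
    ← ENNReal.ofReal_natCast, ← ENNReal.ofReal_mul (by positivity)]
  apply ENNReal.ofReal_le_ofReal
  rw [← mul_div_assoc, div_le_iff₀ (by positivity)]
  linarith

end Params

/-! ### The parameters of the search

Here `q` and `d` are integers above `1 / ε` and `1 / δ`. -/

/-- The inverse of the basic length scale. -/
def baseScale (k q : ℕ) : ℕ := 1000 * k * q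

/-- The exponent relating the tolerance to the basic scale. -/
def tolExp (k : ℕ) : ℕ := (120 * k) ^ (7 * k * k * k)

/-- The inverse of the tolerance. -/
def invTol (k q : ℕ) : ℕ := baseScale k q ^ tolExp k

/-- The inverse of the mesh width. -/
def invMesh (k q : ℕ) : ℕ := invTol k q * invTol k q

/-- The sample size. -/
def sampleSize (k q d : ℕ) : ℕ := invMesh k q * invMesh k q * d

section

variable {k q : ℕ}

theorem one_le_baseScale (hq : 1 ≤ q) : 1000 * k ≤ baseScale k q := by
  rw [baseScale]; nlinarith

/-- The first bound leaves one power of the base scale beyond what `Params.close_of_moments` asks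
for; the second leaves room for moment bounds and constants. -/
theorem pow_lt_tolExp (hk : 1 ≤ k) :
    (120 * k) ^ ((2 * k + 1) * (k ^ 2 + 1)) + 1 ≤ tolExp k ∧ 16 * k + 2 ≤ tolExp k := by
  have h1 : (2 * k + 1) * (k ^ 2 + 1) + 1 ≤ 7 * k * k * k := by
    obtain ⟨n, rfl⟩ := Nat.exists_eq_add_of_le hk
    ring_nf
    nlinarith [Nat.zero_le (n ^ 2), Nat.zero_le (n ^ 3)]
  have h2 : (120 * k) ^ ((2 * k + 1) * (k ^ 2 + 1) + 1) ≤ tolExp k :=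
    Nat.pow_le_pow_right (by omega) h1
  rw [pow_succ] at h2
  have h3 : 1 ≤ (120 * k) ^ ((2 * k + 1) * (k ^ 2 + 1)) := Nat.one_le_pow _ _ (by omega)
  constructor <;> nlinarith

theorem invTol_pos (hk : 1 ≤ k) (hq : 1 ≤ q) : 0 < invTol k q :=
  Nat.pow_pos (by have := one_le_baseScale (k := k) hq; omega)

theorem invMesh_pos (hk : 1 ≤ k) (hq : 1 ≤ q) : 0 < invMesh k q :=
  Nat.mul_pos (invTol_pos hk hq) (invTol_pos hk hq)

theorem baseScale_pow_le_invTol (hk : 1 ≤ k) (hq : 1 ≤ q) :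
    baseScale k q ^ (16 * k + 2) ≤ invTol k q :=
  Nat.pow_le_pow_right (by have := one_le_baseScale (k := k) hq; omega) (pow_lt_tolExp hk).2

/-- Two spare powers of the base scale absorb 16 (k² + 2). This margin pays for both the rounding
error and the variance of the sample moments. -/
theorem mul_baseScale_pow_le_invTol (hk : 1 ≤ k) (hq : 1 ≤ q) :
    16 * (k ^ 2 + 2) * baseScale k q ^ (16 * k) ≤ invTol k q := by
  refine le_trans ?_ (baseScale_pow_le_invTol hk hq)
  rw [pow_add, mul_comm]
  have := one_le_baseScale (k := k) hq
  refine Nat.mul_le_mul_left _ ?_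
  nlinarith

theorem baseScale_le_invTol (hk : 1 ≤ k) (hq : 1 ≤ q) : baseScale k q ≤ invTol k q := by
  refine le_trans ?_ (baseScale_pow_le_invTol hk hq)
  exact Nat.le_self_pow (by omega) _

variable {ε : ℝ}

/-- With t the inverse base scale, these are the smallness conditions on t in the identifiability
theorem; the last one says that all parameters are bounded by 1/t. -/
theorem inv_baseScale_facts (hk : 1 ≤ k) (hq : 1 ≤ q) (hε : 0 < ε) (hqε : 1 ≤ q * ε) :
    (0 : ℝ) < (baseScale k q : ℝ)⁻¹ ∧ (baseScale k q : ℝ)⁻¹ ≤ 1 / 1000 ∧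
      8 * (k : ℝ) * (baseScale k q : ℝ)⁻¹ ≤ 1 ∧ (baseScale k q : ℝ)⁻¹ ≤ ε / 1000 ∧
      2 / ε ≤ ((baseScale k q : ℝ)⁻¹)⁻¹ := by
  have h := one_le_baseScale (k := k) hq
  have hkR : (1 : ℝ) ≤ k := by exact_mod_cast hk
  have hqR : (1 : ℝ) ≤ q := by exact_mod_cast hq
  have hB : (baseScale k q : ℝ) = 1000 * k * q := by simp [baseScale]
  have hB0 : (0 : ℝ) < baseScale k q := by rw [hB]; positivity
  have h1 : (1000 : ℝ) * q ≤ baseScale k q := by rw [hB]; nlinarith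
  have h2 : (1000 : ℝ) * k ≤ baseScale k q := by rw [hB]; nlinarith
  refine ⟨by positivity, ?_, ?_, ?_, ?_⟩
  · rw [← one_div]
    gcongr
    linarith
  · rw [← div_eq_mul_inv, div_le_one hB0]; linarith
  · rw [inv_le_iff_one_le_mul₀ hB0]
    nlinarith
  · rw [inv_inv, div_le_iff₀ hε]; nlinarith

/-- The output of the search is accurate. -/
theorem Params.close_of_isMatch {F G : Params k} (hk : 1 ≤ k) (hq : 1 ≤ q) (hε : 0 < ε)
    (hqε : 1 ≤ q * ε) (hε1 : ε ≤ 1) (hF : F.IsGMM) (hsep : F.IsSeparated ε)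
    (hbd : ∀ i, F.μ i ^ 2 + F.v i ≤ 2 / ε) {x : ℕ → ℝ} {m : ℕ} {γ : ℝ}
    (hG : IsMatch ε (1 / (invTol k q : ℝ)) γ x m G)
    (hx : ∀ j ∈ Finset.Icc 1 (4 * k - 2),
      |sampleMoment x m j - F.rawMoment j| < 1 / (invTol k q : ℝ) / 2) : F.Close ε G := by
  obtain ⟨ht, ht1, hkt, htε, htb⟩ := inv_baseScale_facts hk hq hε hqε
  obtain ⟨⟨hG1, hG2, hG3, -⟩, hG4⟩ := hG
  set t := (baseScale k q : ℝ)⁻¹ with ht_def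
  have hα : 1 / (invTol k q : ℝ) = t ^ tolExp k := by
    rw [invTol, ht_def]; push_cast; rw [one_div, inv_pow]
  have h2ε : 2 ≤ 2 / ε := by rw [le_div_iff₀ hε]; linarith
  have hclose : F.Close t G := by
    -- The separation is taken as ε/2, as candidates satisfy no more than that.
    refine Params.close_of_moments hk ht ht1 (by linarith [mul_nonneg k.cast_nonneg ht.le])
      (a := ε / 2) (by linarith) hF hG1 ?_ hG2 (fun i => ?_)
      (fun i => ⟨(hG3 i).1.trans htb, (hG3 i).2.trans htb⟩) fun j hj => ?_
    · exact ⟨fun i => by linarith [hsep.1 i], fun i j hij => by linarith [hsep.2 i j hij]⟩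
    · have h1 := hbd i
      have h2 := hF.2.2 i
      rw [abs_of_pos h2]
      constructor
      · rw [abs_le]
        constructor <;> nlinarith [sq_nonneg (F.μ i - 1), sq_nonneg (F.μ i + 1)]
      · nlinarith [sq_nonneg (F.μ i)]
    · rcases Nat.eq_zero_or_pos j with rfl | hj0
      · simp only [gaussMoment, mul_one]
        rw [hF.2.1, hG1.2.1, sub_self, abs_zero]
        positivity
      · have hj' := Finset.mem_Icc.mpr ⟨hj0, hj⟩
        have h1 := hx j hj'
        have h2 := hG4 j hj'
        rw [← rawMoment_eq hF, ← rawMoment_eq hG1]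
        have h3 := abs_sub_le (G.rawMoment j) (sampleMoment x m j) (F.rawMoment j)
        rw [abs_sub_comm]
        rw [hα] at h1 h2
        -- The moments differ by at most α + α/2; the spare factor t absorbs the 3/2.
        have h4 : t ^ tolExp k ≤ t * t ^ (120 * k) ^ ((2 * k + 1) * (k ^ 2 + 1)) := by
          rw [← pow_succ']
          exact pow_le_pow_of_le_one ht.le (by linarith) (pow_lt_tolExp hk).1
        have h5 : 0 < t ^ (120 * k) ^ ((2 * k + 1) * (k ^ 2 + 1)) := by positivity
        nlinarith
  obtain ⟨π, hπ⟩ := hclose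
  refine ⟨π, fun i => ?_⟩
  obtain ⟨h1, h2, h3⟩ := hπ i
  exact ⟨by linarith, by linarith, by linarith⟩

/-- On typical samples the rounded mixture is a match. -/
theorem Params.exists_isMatch {F : Params k} (hk : 1 ≤ k) (hq : 1 ≤ q) (hε : 0 < ε)
    (hqε : 1 ≤ q * ε) (hε1 : ε ≤ 1) (hF : F.IsGMM) (hsep : F.IsSeparated ε)
    (hbd : ∀ i, F.μ i ^ 2 + F.v i ≤ 2 / ε) {x : ℕ → ℝ} {m : ℕ}
    (hx : ∀ j ∈ Finset.Icc 1 (4 * k - 2),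
      |sampleMoment x m j - F.rawMoment j| < 1 / (invTol k q : ℝ) / 2) :
    ∃ G : Params k, IsMatch ε (1 / (invTol k q : ℝ)) (1 / (invMesh k q : ℝ)) x m G := by
  obtain ⟨ht, ht1, hkt, htε, htb⟩ := inv_baseScale_facts hk hq hε hqε
  have hA0 : (0 : ℝ) < invTol k q := by exact_mod_cast invTol_pos hk hq
  have hA1 : (1 : ℝ) ≤ invTol k q := by exact_mod_cast invTol_pos hk hq
  have hBA : (baseScale k q : ℝ) ≤ invTol k q := by exact_mod_cast baseScale_le_invTol hk hq
  have hN : (invMesh k q : ℝ) = invTol k q * invTol k q := by simp [invMesh]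
  have hNB : (baseScale k q : ℝ) ≤ invMesh k q := by rw [hN]; nlinarith
  have hB0 : (0 : ℝ) < baseScale k q := inv_pos.mp ht
  have hkR : (1 : ℝ) ≤ k := by exact_mod_cast hk
  have hqR : (1 : ℝ) ≤ q := by exact_mod_cast hq
  have hB : (baseScale k q : ℝ) = 1000 * k * q := by simp [baseScale]
  have hN0 : (0 : ℝ) < invMesh k q := by linarith
  have hkq : (k : ℝ) ≤ k * (q * ε) := by nlinarith
  obtain ⟨G, hG, hFG⟩ := exists_candidate_near hF hε hε1 hsep hbd (invMesh_pos hk hq)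
    (by rw [div_le_iff₀ hN0]
        have : ε * (baseScale k q : ℝ) ≤ ε * invMesh k q := by gcongr
        rw [hB] at this
        linarith)
    (by rw [div_le_iff₀ hN0]
        have : ε * (baseScale k q : ℝ) ≤ ε * invMesh k q := by gcongr
        rw [hB] at this
        linarith)
  refine ⟨G, hG, fun j hj => ?_⟩
  have h1 := hx j hj
  rw [rawMoment_eq hG.1]
  rw [rawMoment_eq hF] at h1
  have h2ε : 2 ≤ 2 / ε := by rw [le_div_iff₀ hε]; linarith
  have h2 := abs_moment_sub_le (F := F) hG.1 ht ht1 (J := 4 * k)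
    (by push_cast; rw [inv_inv, hB]; nlinarith) (η := 1 / (invMesh k q : ℝ)) (by positivity)
    (fun i => by
      have h1 := hbd i
      have h2 := hF.2.2 i
      rw [abs_of_pos h2]
      constructor
      · rw [abs_le]
        constructor <;> nlinarith [sq_nonneg (F.μ i - 1), sq_nonneg (F.μ i + 1)]
      · nlinarith [sq_nonneg (F.μ i)])
    (fun i => ⟨(hG.2.2.1 i).1.trans htb, (hG.2.2.1 i).2.trans htb⟩)
    (fun i => (hFG i).1) (fun i => (hFG i).2.1) (fun i => (hFG i).2.2) (j := j)
    (by have := (Finset.mem_Icc.mp hj).2; omega)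
  -- The mesh is the square of the tolerance α, so one factor α outweighs all constants. Rounding
  -- and sampling then use half of the tolerance each.
  have h3 : ((k : ℝ) ^ 2 + 2) * (1 / (invMesh k q : ℝ)) *
      ((baseScale k q : ℝ)⁻¹)⁻¹ ^ (2 * (4 * k)) ≤
      1 / (invTol k q : ℝ) / 2 := by
    have h4 : (16 * ((k : ℝ) ^ 2 + 2) * (baseScale k q : ℝ) ^ (16 * k)) ≤ invTol k q := by
      exact_mod_cast mul_baseScale_pow_le_invTol hk hq
    have h5 : (baseScale k q : ℝ) ^ (8 * k) ≤ (baseScale k q : ℝ) ^ (16 * k) :=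
      pow_le_pow_right₀ (by rw [hB]; nlinarith) (by omega)
    rw [inv_inv, hN, mul_one_div, div_mul_eq_mul_div, div_div,
      div_le_div_iff₀ (by positivity) (by positivity), one_mul, show 2 * (4 * k) = 8 * k by ring]
    have h6 : ((k : ℝ) ^ 2 + 2) * (baseScale k q : ℝ) ^ (8 * k) * 2 ≤ invTol k q := by
      have : ((k : ℝ) ^ 2 + 2) * (baseScale k q : ℝ) ^ (8 * k) ≤
        ((k : ℝ) ^ 2 + 2) * (baseScale k q : ℝ) ^ (16 * k) := by gcongr
      have : 0 ≤ ((k : ℝ) ^ 2 + 2) * (baseScale k q : ℝ) ^ (16 * k) := by positivity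
      linarith
    nlinarith
  have h7 := abs_sub_le (∑ i, G.w i * gaussMoment j (G.μ i) (G.v i))
    (∑ i, F.w i * gaussMoment j (F.μ i) (F.v i)) (sampleMoment x m j)
  rw [abs_sub_comm, abs_sub_comm _ (sampleMoment x m j)] at h7
  rw [abs_sub_comm]
  rw [abs_sub_comm (∑ i, G.w i * gaussMoment j (G.μ i) (G.v i))
    (∑ i, F.w i * gaussMoment j (F.μ i) (F.v i))] at h7
  linarith

/-- With probability at least `1 - δ` the samples are typical. -/
theorem Params.measure_not_typical_le {F : Params k} {d : ℕ} {δ : ℝ} (hk : 1 ≤ k) (hq : 1 ≤ q)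
    (hd : 1 ≤ d) (hε : 0 < ε) (hqε : 1 ≤ q * ε) (hε1 : ε ≤ 1) (hdδ : 1 ≤ d * δ)
    (hF : F.IsGMM) (hbd : ∀ i, F.μ i ^ 2 + F.v i ≤ 2 / ε)
    {Ω : Type*} [MeasurableSpace Ω]
    (P : Measure Ω) [IsProbabilityMeasure P] {X : ℕ → Ω → ℝ} (hX : ∀ l, Measurable (X l))
    (hind : iIndepFun X P) (hlaw : ∀ l, P.map (X l) = F.law) :
    P {ω | ∃ j ∈ Finset.Icc 1 (4 * k - 2), 1 / (invTol k q : ℝ) / 2 ≤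
      |sampleMoment (fun l => X l ω) (sampleSize k q d) j - F.rawMoment j|} ≤
      ENNReal.ofReal δ := by
  obtain ⟨ht, ht1, hkt, htε, htb⟩ := inv_baseScale_facts hk hq hε hqε
  have hA0 : (0 : ℝ) < invTol k q := by exact_mod_cast invTol_pos hk hq
  have hB0 : (0 : ℝ) < baseScale k q := inv_pos.mp ht
  have h2ε : 2 ≤ 2 / ε := by rw [le_div_iff₀ hε]; linarith
  have hkR : (1 : ℝ) ≤ k := by exact_mod_cast hk
  have hBk : ((8 * k : ℕ) : ℝ) ≤ ((baseScale k q : ℝ)⁻¹)⁻¹ := by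
    have := one_le_baseScale (k := k) hq
    rw [inv_inv]
    exact_mod_cast (by omega : 8 * k ≤ baseScale k q)
  -- B bounds the moments of order 2 j ≤ 8 k that enter the variances.
  refine measure_sampleMoment_le P hX hind hlaw (B := (baseScale k q : ℝ) ^ (16 * k))
    (Nat.mul_pos (Nat.mul_pos (invMesh_pos hk hq) (invMesh_pos hk hq)) hd) (by positivity)
    (fun j hj => ?_) ?_
  · rw [rawMoment_eq hF]
    calc _ ≤ ∑ i, F.w i * (baseScale k q : ℝ) ^ (16 * k) := by
          refine Finset.sum_le_sum fun i _ => mul_le_mul_of_nonneg_left ?_ (hF.1 i)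
          have h1 := hbd i
          have h2 := hF.2.2 i
          have := abs_gaussMoment_le_scale ht ht1 hBk (μ := F.μ i) (v := F.v i)
            (by rw [abs_le]
                constructor <;> nlinarith [sq_nonneg (F.μ i - 1), sq_nonneg (F.μ i + 1)])
            (by rw [abs_of_pos h2]; nlinarith [sq_nonneg (F.μ i)]) (j := 2 * j) (by omega)
          rw [inv_inv] at this
          refine (le_abs_self _).trans (this.trans (pow_le_pow_right₀ ?_ (by omega)))
          have := one_le_baseScale (k := k) hq
          exact_mod_cast (by omega : 1 ≤ baseScale k q)
      _ = _ := by rw [← Finset.sum_mul, hF.2.1, one_mul]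
  · have h4 : (16 * ((k : ℝ) ^ 2 + 2) * (baseScale k q : ℝ) ^ (16 * k)) ≤ invTol k q := by
      exact_mod_cast mul_baseScale_pow_le_invTol hk hq
    have hA1 : (1 : ℝ) ≤ invTol k q := by exact_mod_cast invTol_pos hk hq
    -- The sample size is d / α⁴ with α the tolerance, and the deviation allowed is α/2.
    have e : ((sampleSize k q d : ℕ) : ℝ) * (1 / (invTol k q : ℝ) / 2) ^ 2 * δ =
        (invTol k q : ℝ) ^ 2 / 4 * (d * δ) := by
      simp only [sampleSize, invMesh]
      push_cast
      field_simp
      ring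
    rw [e]
    have h5 : ((4 * k - 2 : ℕ) : ℝ) ≤ 4 * k := by
      exact_mod_cast (by omega : 4 * k - 2 ≤ 4 * k)
    have hB : (0 : ℝ) ≤ (baseScale k q : ℝ) ^ (16 * k) := by positivity
    calc ((4 * k - 2 : ℕ) : ℝ) * (baseScale k q : ℝ) ^ (16 * k)
        ≤ (4 * ((k : ℝ) ^ 2 + 2)) * (baseScale k q : ℝ) ^ (16 * k) := by
          gcongr
          nlinarith
      _ ≤ (invTol k q : ℝ) / 4 := by linarith
      _ ≤ (invTol k q : ℝ) ^ 2 / 4 * 1 := by nlinarith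
      _ ≤ _ := by gcongr

end

/-! ### Reasoning about programs -/

/-- The natural number variables an instruction may change. -/
def Instr.natWrites : Instr → List ℕ
  | .natConst r _ | .natAdd r _ _ | .natSub r _ _ => [r]
  | _ => []

/-- The real variables an instruction may change. -/
def Instr.realWrites : Instr → List ℕ
  | .realConst r _ | .realOp _ r _ _ | .load r _ _ | .sample r => [r]
  | _ => []

/-- The arrays an instruction may change. -/
def Instr.arrWrites : Instr → List ℕ
  | .store a _ _ => [a]
  | _ => []

/-- Whether an instruction draws a sample. -/
def Instr.draws : Instr → Bool
  | .sample _ => true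
  | _ => false

/-- The natural number variables a program may change. -/
def Prog.natWrites : Prog → List ℕ
  | .instr i => i.natWrites
  | .seq c d | .cond _ c d => c.natWrites ++ d.natWrites
  | .loop _ c => c.natWrites

/-- The real variables a program may change. -/
def Prog.realWrites : Prog → List ℕ
  | .instr i => i.realWrites
  | .seq c d | .cond _ c d => c.realWrites ++ d.realWrites
  | .loop _ c => c.realWrites

/-- The arrays a program may change. -/
def Prog.arrWrites : Prog → List ℕ
  | .instr i => i.arrWrites
  | .seq c d | .cond _ c d => c.arrWrites ++ d.arrWrites
  | .loop _ c => c.arrWrites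

/-- Whether a program may draw samples. -/
def Prog.draws : Prog → Bool
  | .instr i => i.draws
  | .seq c d | .cond _ c d => c.draws || d.draws
  | .loop _ c => c.draws

/-- The state `s'` differs from `s` only in what the program `c` may change. -/
structure Frame (c : Prog) (s s' : State) : Prop where
  nat : ∀ r, r ∉ c.natWrites → s'.nat r = s.nat r
  real : ∀ r, r ∉ c.realWrites → s'.real r = s.real r
  arr : ∀ a, a ∉ c.arrWrites → s'.arr a = s.arr a
  pos : c.draws = false → s'.pos = s.pos

theorem Frame.refl (c : Prog) (s : State) : Frame c s s :=
  ⟨fun _ _ => rfl, fun _ _ => rfl, fun _ _ => rfl, fun _ => rfl⟩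

theorem Frame.trans {c : Prog} {s s' s'' : State} (h : Frame c s s') (h' : Frame c s' s'') :
    Frame c s s'' :=
  ⟨fun r hr => (h'.nat r hr).trans (h.nat r hr), fun r hr => (h'.real r hr).trans (h.real r hr),
    fun r hr => (h'.arr r hr).trans (h.arr r hr), fun hr => (h'.pos hr).trans (h.pos hr)⟩

theorem Frame.mono {c d : Prog} {s s' : State} (h : Frame c s s')
    (hn : ∀ r, r ∈ c.natWrites → r ∈ d.natWrites) (hr : ∀ r, r ∈ c.realWrites → r ∈ d.realWrites)
    (ha : ∀ r, r ∈ c.arrWrites → r ∈ d.arrWrites) (hp : d.draws = false → c.draws = false) :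
    Frame d s s' :=
  ⟨fun r h' => h.nat r fun h'' => h' (hn r h''), fun r h' => h.real r fun h'' => h' (hr r h''),
    fun r h' => h.arr r fun h'' => h' (ha r h''), fun h' => h.pos (hp h')⟩

theorem Frame.seq_left {c d : Prog} {s s' : State} (h : Frame c s s') : Frame (.seq c d) s s' :=
  h.mono (by simp +contextual [Prog.natWrites]) (by simp +contextual [Prog.realWrites])
    (by simp +contextual [Prog.arrWrites]) (by simp +contextual [Prog.draws])

theorem Frame.seq_right {c d : Prog} {s s' : State} (h : Frame d s s') : Frame (.seq c d) s s' :=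
  h.mono (by simp +contextual [Prog.natWrites]) (by simp +contextual [Prog.realWrites])
    (by simp +contextual [Prog.arrWrites]) (by simp +contextual [Prog.draws])

theorem Frame.instr (x : ℕ → ℝ) (i : Instr) (s : State) : Frame (.instr i) s (i.apply x s) := by
  constructor
  · intro r hr
    cases i <;> simp_all [Prog.natWrites, Instr.natWrites, Instr.apply]
  · intro r hr
    cases i <;> simp_all [Prog.realWrites, Instr.realWrites, Instr.apply]
  · intro r hr
    cases i <;> simp_all [Prog.arrWrites, Instr.arrWrites, Instr.apply]
  · intro hr
    cases i <;> simp_all [Prog.draws, Instr.draws, Instr.apply]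

/-- The write sets are read off the syntax, so for concrete programs the side conditions of a frame
can be settled by `decide`, and specifications mention only what changes. -/
theorem Exec.frame {x : ℕ → ℝ} {c : Prog} {s s' : State} {n : ℕ} (h : Exec x c s n s') :
    Frame c s s' := by
  induction h with
  | instr i s => exact Frame.instr x i s
  | seq _ _ h h' => exact h.seq_left.trans h'.seq_right
  | cond_true _ _ h =>
    exact h.mono (by simp +contextual [Prog.natWrites]) (by simp +contextual [Prog.realWrites])
      (by simp +contextual [Prog.arrWrites]) (by simp +contextual [Prog.draws])
  | cond_false _ _ h =>
    exact h.mono (by simp +contextual [Prog.natWrites]) (by simp +contextual [Prog.realWrites])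
      (by simp +contextual [Prog.arrWrites]) (by simp +contextual [Prog.draws])
  | loop_false _ => exact Frame.refl _ _
  | loop_true _ _ _ h h' =>
    exact Frame.trans (h.mono (by simp [Prog.natWrites]) (by simp [Prog.realWrites])
      (by simp [Prog.arrWrites]) (by simp [Prog.draws])) h'

/-- Total correctness: started in `s`, the program halts within `T` steps in a state
satisfying `Q`. -/
def Runs (x : ℕ → ℝ) (c : Prog) (s : State) (T : ℕ) (Q : State → Prop) : Prop :=
  ∃ n s', Exec x c s n s' ∧ n ≤ T ∧ Q s'

section

variable {x : ℕ → ℝ} {c d : Prog} {s : State} {T T' : ℕ} {P Q : State → Prop}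

/-- Besides weakening the bounds, this makes the frame condition available to the new postcondition.
-/
theorem Runs.mono (h : Runs x c s T P) (hT : T ≤ T') (hPQ : ∀ s', Frame c s s' → P s' → Q s') :
    Runs x c s T' Q := by
  obtain ⟨n, s', h1, h2, h3⟩ := h
  exact ⟨n, s', h1, h2.trans hT, hPQ s' h1.frame h3⟩

theorem Runs.instr {i : Instr} (h : Q (i.apply x s)) : Runs x (.instr i) s 1 Q :=
  ⟨1, _, Exec.instr i s, le_rfl, h⟩

theorem Runs.seq (h : Runs x c s T P) (h' : ∀ s', P s' → Frame c s s' → Runs x d s' T' Q) :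
    Runs x (.seq c d) s (T + T') Q := by
  obtain ⟨n, s', h1, h2, h3⟩ := h
  obtain ⟨n', s'', h4, h5, h6⟩ := h' s' h3 h1.frame
  exact ⟨_, _, Exec.seq h1 h4, by omega, h6⟩

theorem Runs.cond {t : Test} (h : t.holds s → Runs x c s T Q) (h' : ¬ t.holds s → Runs x d s T Q) :
    Runs x (.cond t c d) s (T + 1) Q := by
  by_cases ht : t.holds s
  · obtain ⟨n, s', h1, h2, h3⟩ := h ht
    exact ⟨_, _, Exec.cond_true ht h1, by omega, h3⟩
  · obtain ⟨n, s', h1, h2, h3⟩ := h' ht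
    exact ⟨_, _, Exec.cond_false ht h1, by omega, h3⟩

end

/-- A nonempty sequence of instructions. -/
def block : Instr → List Instr → Prog
  | i, [] => .instr i
  | i, j :: l => .seq (.instr i) (block j l)

theorem runs_block {x : ℕ → ℝ} {i : Instr} {l : List Instr} {s : State} {Q : State → Prop}
    (h : Q ((i :: l).foldl (fun s i => i.apply x s) s)) :
    Runs x (block i l) s (l.length + 1) Q := by
  induction l generalizing i s with
  | nil => exact Runs.instr h
  | cons j l ih =>
    exact (Runs.seq (Runs.instr (Q := fun s' => s' = i.apply x s) rfl) fun s' hs' _ =>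
      ih (by rw [hs']; exact h)).mono (by simp; omega) fun _ _ h => h

/-- The loop `for i = 0, …, n - 1`; the variable `i'` holds `i + 1`, and variable `1` has to
hold `1`. -/
def forLoop (i i' n : ℕ) (c : Prog) : Prog :=
  .seq (.instr (.natConst i 0)) (.seq (.instr (.natConst i' 1))
    (.loop (.natLe i' n) (.seq c (.seq (.instr (.natAdd i i 1)) (.instr (.natAdd i' i' 1))))))

/-- The state with new values of the loop counters. -/
def State.setCounter (s : State) (i i' a : ℕ) : State :=
  { s with nat := Function.update (Function.update s.nat i a) i' (a + 1) }

section

variable {s : State} {i i' a : ℕ}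

@[simp] theorem State.setCounter_real : (s.setCounter i i' a).real = s.real := rfl
@[simp] theorem State.setCounter_arr : (s.setCounter i i' a).arr = s.arr := rfl
@[simp] theorem State.setCounter_pos : (s.setCounter i i' a).pos = s.pos := rfl

@[simp] theorem State.setCounter_nat {r : ℕ} (h : r ≠ i) (h' : r ≠ i') :
    (s.setCounter i i' a).nat r = s.nat r := by
  simp [State.setCounter, h, h']

theorem State.setCounter_self (hii : i ≠ i') : (s.setCounter i i' a).nat i = a := by
  simp [State.setCounter, hii]

theorem State.setCounter_succ : (s.setCounter i i' a).nat i' = a + 1 := by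
  simp [State.setCounter]

end

/-- The invariant rule for `forLoop`. -/
theorem runs_forLoop {x : ℕ → ℝ} {i i' n : ℕ} {c : Prog} {s : State} {T N : ℕ}
    (I : ℕ → State → Prop) (hii : i ≠ i') (hw : ∀ r ∈ [i, i', n, 1], r ∉ c.natWrites)
    (hn : n ≠ i ∧ n ≠ i') (h1 : 1 ≠ i ∧ 1 ≠ i') (hs : s.nat 1 = 1)
    (hN : s.nat n = N) (h0 : I 0 (s.setCounter i i' 0))
    (hstep : ∀ l < N, ∀ s', I l s' → s'.nat i = l → s'.nat 1 = 1 →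
      Frame (forLoop i i' n c) s s' → Runs x c s' T fun s'' =>
        I (l + 1) (s''.setCounter i i' (l + 1))) :
    Runs x (forLoop i i' n c) s (N * (T + 3) + 3) (I N) := by
  subst hN
  set b := Prog.seq c (.seq (.instr (.natAdd i i 1)) (.instr (.natAdd i' i' 1))) with hb
  have hfrb : ∀ {s s'}, Frame (.loop (.natLe i' n) b) s s' → Frame (forLoop i i' n c) s s' :=
    fun h => h.seq_right.seq_right
  -- Here m counts the remaining rounds. Since only ≤ can be tested, i < n is tested as i' ≤ n with
  -- i' = i + 1. Each round costs the body, one test and two additions.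
  have hloop : ∀ m l, l + m = s.nat n → ∀ s', I l s' → s'.nat i = l → s'.nat i' = l + 1 →
      Frame (forLoop i i' n c) s s' → s'.nat n = s.nat n → s'.nat 1 = 1 →
      Runs x (.loop (.natLe i' n) b) s' (m * (T + 3) + 1) (I (s.nat n)) := by
    intro m
    induction m with
    | zero =>
      intro l hl s' hI hi hi' hF hn' h1'
      refine ⟨1, s', Exec.loop_false ?_, by omega, ?_⟩
      · simp only [Test.holds]; omega
      · rwa [← hl]
    | succ m ih =>
      intro l hl s' hI hi hi' hF hn' h1'
      obtain ⟨k, s₁, he, hk, hI₁⟩ := hstep l (by omega) s' hI hi h1' hF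
      have hfr := he.frame
      have e : (Instr.natAdd i' i' 1).apply x ((Instr.natAdd i i 1).apply x s₁) =
          s₁.setCounter i i' (l + 1) := by
        simp only [Instr.apply, State.setCounter, State.mk.injEq, and_true]
        have e1 : s₁.nat i = l := (hfr.nat i (hw i (by simp))).trans hi
        have e2 : s₁.nat i' = l + 1 := (hfr.nat i' (hw i' (by simp))).trans hi'
        have e3 : s₁.nat 1 = 1 := (hfr.nat 1 (hw 1 (by simp))).trans h1'
        rw [Function.update_of_ne hii.symm, Function.update_of_ne h1.1, e1, e2, e3]
      have hbody : Exec x b s' (k + (1 + 1)) (s₁.setCounter i i' (l + 1)) := by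
        rw [← e]
        exact Exec.seq he (Exec.seq (Exec.instr _ _) (Exec.instr _ _))
      have hF' : Frame (forLoop i i' n c) s (s₁.setCounter i i' (l + 1)) := by
        refine hF.trans (hfrb (hbody.frame.mono ?_ ?_ ?_ ?_)) <;>
          simp [Prog.natWrites, Prog.realWrites, Prog.arrWrites, Prog.draws]
      obtain ⟨k', s₂, he', hk', hI₂⟩ := ih (l + 1) (by omega) _ hI₁
        (State.setCounter_self hii) State.setCounter_succ hF'
        (by rw [State.setCounter_nat hn.1 hn.2, hfr.nat n (hw n (by simp)), hn'])
        (by rw [State.setCounter_nat h1.1 h1.2, hfr.nat 1 (hw 1 (by simp)), h1'])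
      refine ⟨_, s₂, Exec.loop_true ?_ hbody he', ?_, hI₂⟩
      · simp only [Test.holds]; omega
      · rw [Nat.succ_mul]; omega
  have e0 : (Instr.natConst i' 1).apply x ((Instr.natConst i 0).apply x s) =
      s.setCounter i i' 0 := by
    simp [Instr.apply, State.setCounter]
  have hF0 : Frame (forLoop i i' n c) s (s.setCounter i i' 0) := by
    rw [← e0]
    exact ((Frame.instr x _ _).seq_left.trans
      ((Frame.instr x _ _).seq_left (d := .loop (.natLe i' n) b)).seq_right)
  obtain ⟨k, s', he, hk, hI⟩ := hloop (s.nat n) 0 (by omega) _ h0 (State.setCounter_self hii)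
    State.setCounter_succ hF0 (State.setCounter_nat hn.1 hn.2)
    (by rw [State.setCounter_nat h1.1 h1.2, hs])
  refine ⟨1 + (1 + k), s', Exec.seq (Exec.instr _ _) (Exec.seq (Exec.instr _ _) ?_), by omega, hI⟩
  rw [e0]
  exact he

/-! ### Arithmetic subroutines

Natural number variable `1` holds `1` throughout. -/

/-- `r := p * q` on natural number variables. -/
def natMul (r p q : ℕ) : Prog :=
  .seq (.instr (.natConst r 0)) (forLoop 90 91 q (.instr (.natAdd r r p)))

/-- Repeated addition takes time proportional to the value of a factor. This is affordable, as for
fixed k all values involved are polynomial in 1/ε and 1/δ. -/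
theorem runs_natMul {x : ℕ → ℝ} {r p q a b : ℕ} {s : State} (hs : s.nat 1 = 1)
    (hr : r ∉ [1, p, q, 90, 91]) (hp : p ∉ [90, 91]) (hq : q ∉ [90, 91]) (ha : s.nat p = a)
    (hb : s.nat q = b) :
    Runs x (natMul r p q) s (4 * b + 4) fun s' => s'.nat r = a * b := by
  simp only [List.mem_cons, not_or, List.not_mem_nil, not_false_eq_true, and_true] at hr hp hq
  obtain ⟨hr1, hrp, hrq, hr90, hr91⟩ := hr
  refine (Runs.seq (Runs.instr (Q := fun s' => s' = (Instr.natConst r 0).apply x s) rfl)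
    fun s' hs' _ => runs_forLoop (N := b) (T := 1) (fun l s' => s'.nat r = a * l ∧ s'.nat p = a)
    (by decide) ?_ hq (by decide) ?_ ?_ ?_ ?_).mono (by omega) (fun _ _ h => h.1)
  · simp [Prog.natWrites, Instr.natWrites]; tauto
  · simp [hs', Instr.apply, hs, Ne.symm hr1]
  · simp [hs', Instr.apply, hb, Ne.symm hrq]
  · simp [hs', Instr.apply, hr90, hr91, hp, Ne.symm hrp, ha]
  · rintro l hl s'' ⟨h1, h2⟩ _ _ _
    refine Runs.instr ⟨?_, ?_⟩
    · rw [State.setCounter_nat hr90 hr91]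
      simp [Instr.apply, h1, h2]; ring
    · rw [State.setCounter_nat hp.1 hp.2]
      simp [Instr.apply, Ne.symm hrp, h2]

/-- `r := p ^ e` on natural number variables. -/
def natPow (r p e : ℕ) : Prog :=
  .seq (.instr (.natConst r 1)) (forLoop 92 93 e
    (.seq (natMul 94 p r) (block (.natConst r 0) [.natAdd r r 94])))

theorem runs_natPow {x : ℕ → ℝ} {r p e a b : ℕ} {s : State} (hs : s.nat 1 = 1)
    (hr : r ∉ [1, p, e, 90, 91, 92, 93, 94]) (hp : p ∉ [90, 91, 92, 93, 94])
    (he : e ∉ [90, 91, 92, 93, 94]) (ha : s.nat p = a) (hb : s.nat e = b) :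
    Runs x (natPow r p e) s (b * (4 * (a + 1) ^ b + 9) + 4) fun s' => s'.nat r = a ^ b := by
  simp only [List.mem_cons, not_or, List.not_mem_nil, not_false_eq_true, and_true] at hr hp he
  obtain ⟨hr1, hrp, hre, hr90, hr91, hr92, hr93, hr94⟩ := hr
  obtain ⟨hp90, hp91, hp92, hp93, hp94⟩ := hp
  obtain ⟨he90, he91, he92, he93, he94⟩ := he
  refine (Runs.seq (Runs.instr (Q := fun s' => s' = (Instr.natConst r 1).apply x s) rfl)
    fun s' hs' _ => runs_forLoop (N := b) (T := 4 * (a + 1) ^ b + 6)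
    (fun l s' => s'.nat r = a ^ l ∧ s'.nat p = a)
    (by decide) ?_ ⟨he92, he93⟩ (by decide) ?_ ?_ ?_ ?_).mono
    (by rw [Nat.mul_add]; rw [Nat.mul_add]; omega) (fun _ _ h => h.1)
  · simp [natMul, forLoop, block, Prog.natWrites, Instr.natWrites]; tauto
  · simp [hs', Instr.apply, hs, Ne.symm hr1]
  · simp [hs', Instr.apply, hb, Ne.symm hre]
  · simp [hs', Instr.apply, hr92, hr93, hp92, hp93, Ne.symm hrp, ha]
  · rintro l hl s'' ⟨h1, h2⟩ _ h3 _
    refine (Runs.seq (runs_natMul (r := 94) h3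
      (by simp [Ne.symm hp94, Ne.symm hr94]) (by simp [hp90, hp91]) (by simp [hr90, hr91]) h2 h1)
      fun s₁ h4 hF => runs_block (Q := fun s₂ => s₂.nat r = a ^ (l + 1) ∧
        s₂.nat p = a) ?_).mono ?_ ?_
    · have hp' : s₁.nat p = a := by
        rw [hF.nat p (by simp [natMul, forLoop, Prog.natWrites,
          Instr.natWrites, hp90, hp91, hp94]), h2]
      simp [Instr.apply, h4, hp', Ne.symm hr94, Ne.symm hrp]
      ring
    · have : a ^ l ≤ (a + 1) ^ b :=
        (Nat.pow_le_pow_left (by omega) l).trans (Nat.pow_le_pow_right (by omega) hl.le)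
      simp
      omega
    · rintro s₂ _ ⟨h5, h6⟩
      rw [State.setCounter_nat hr92 hr93, State.setCounter_nat hp92 hp93]
      exact ⟨h5, h6⟩

/-- Conversion of a natural number variable to a real variable; real variable `2` holds `1`. -/
def natToReal (r n : ℕ) : Prog :=
  .seq (.instr (.realConst r 0)) (forLoop 90 91 n (.instr (.realOp .add r r 2)))

theorem runs_natToReal {x : ℕ → ℝ} {r n a : ℕ} {s : State} (hs : s.nat 1 = 1) (hs2 : s.real 2 = 1)
    (hr : r ≠ 2) (hn : n ∉ [90, 91]) (ha : s.nat n = a) :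
    Runs x (natToReal r n) s (4 * a + 4) fun s' => s'.real r = a := by
  simp only [List.mem_cons, not_or, List.not_mem_nil, not_false_eq_true, and_true] at hn
  refine (Runs.seq (Runs.instr (Q := fun s' => s' = (Instr.realConst r 0).apply x s) rfl)
    fun s' hs' _ => runs_forLoop (N := a) (T := 1) (fun l s' => s'.real r = l ∧ s'.real 2 = 1)
    (by decide) ?_ hn (by decide) ?_ ?_ ?_ ?_).mono (by omega) (fun _ _ h => h.1)
  · simp [Prog.natWrites, Instr.natWrites]
  · simp [hs', Instr.apply, hs]
  · simp [hs', Instr.apply, ha]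
  · simp [hs', Instr.apply, Ne.symm hr, hs2]
  · rintro l hl s'' ⟨h1, h2⟩ _ _ _
    refine Runs.instr ⟨?_, ?_⟩
    · simp [Instr.apply, Op.eval, h1, h2]
    · simp [Instr.apply, Ne.symm hr, h2]

/-- Computation of the least natural number `n` with `1 < n * r`; real variable `2` holds `1`. -/
def ceilInv (n r a : ℕ) : Prog :=
  .seq (block (.natConst n 0) [.realConst a 0])
    (.loop (.realLe a 2) (block (.natAdd n n 1) [.realOp .add a a r]))

/-- The reciprocal is rounded by adding copies of r until the sum exceeds 1, in ⌊1/r⌋ + 1 rounds. -/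
theorem runs_ceilInv {x : ℕ → ℝ} {n r a : ℕ} {s : State} (hs : s.nat 1 = 1) (hs2 : s.real 2 = 1)
    (hn : n ≠ 1) (ha : a ≠ 2) (hra : r ≠ a) (hpos : 0 < s.real r) :
    Runs x (ceilInv n r a) s (3 * (⌊1 / s.real r⌋₊ + 1) + 3)
      fun s' => s'.nat n = ⌊1 / s.real r⌋₊ + 1 := by
  obtain ⟨e, he⟩ : ∃ e, s.real r = e := ⟨_, rfl⟩
  rw [he] at hpos ⊢
  have hloop : ∀ m l, l + m = ⌊1 / e⌋₊ + 1 → ∀ s' : State, s'.nat n = l → s'.nat 1 = 1 →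
      s'.real 2 = 1 → s'.real r = e → s'.real a = l * e →
      Runs x (.loop (.realLe a 2) (block (.natAdd n n 1) [.realOp .add a a r])) s' (3 * m + 1)
        fun s' => s'.nat n = ⌊1 / e⌋₊ + 1 := by
    intro m
    induction m with
    | zero =>
      intro l hl s' h1 h2 h3 h4 h5
      refine ⟨1, s', Exec.loop_false ?_, by omega, by simp only [h1]; omega⟩
      simp only [Test.holds, h5, h3, not_le]
      have := Nat.lt_floor_add_one (1 / e)
      rw [div_lt_iff₀ hpos] at this
      rw [show l = ⌊1 / e⌋₊ + 1 by omega]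
      exact_mod_cast this
    | succ m ih =>
      intro l hl s' h1 h2 h3 h4 h5
      obtain ⟨k, s₁, h6, h7, h8⟩ := runs_block (x := x) (s := s') (i := .natAdd n n 1)
        (l := [.realOp .add a a r]) (Q := fun s₁ => s₁.nat n = l + 1 ∧ s₁.nat 1 = 1 ∧
          s₁.real 2 = 1 ∧ s₁.real r = e ∧ s₁.real a = (l + 1 : ℕ) * e)
        (by simp [Instr.apply, Op.eval, h1, h2, h3, h4, h5, Ne.symm hn, Ne.symm ha, hra]; ring)
      obtain ⟨k', s₂, h9, h10, h11⟩ := ih (l + 1) (by omega) s₁ h8.1 h8.2.1 h8.2.2.1 h8.2.2.2.1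
        h8.2.2.2.2
      refine ⟨_, s₂, Exec.loop_true ?_ h6 h9, ?_, h11⟩
      · simp only [Test.holds, h5, h3]
        have h12 : (l : ℝ) ≤ 1 / e :=
          le_trans (by exact_mod_cast (by omega : l ≤ ⌊1 / e⌋₊)) (Nat.floor_le (by positivity))
        rwa [le_div_iff₀ hpos] at h12
      · simp at h7; omega
  refine (Runs.seq (runs_block (Q := fun s' => s' = _) rfl) fun s' hs' _ =>
    hloop (⌊1 / e⌋₊ + 1) 0 (by omega) s' ?_ ?_ ?_ ?_ ?_).mono (by simp; omega) fun _ _ h => h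
  all_goals simp [hs', Instr.apply, hs, hs2, Ne.symm hn, Ne.symm ha, hra, he]

/-- Division with remainder: `u := c / n` and `c := c % n`. -/
def natDivMod (u c n : ℕ) : Prog :=
  .seq (.instr (.natConst u 0)) (.loop (.natLe n c) (block (.natSub c c n) [.natAdd u u 1]))

theorem runs_natDivMod {x : ℕ → ℝ} {u c n a b : ℕ} {s : State} (hs : s.nat 1 = 1)
    (hu : u ∉ [1, c, n]) (hc : c ∉ [1, n]) (ha : s.nat c = a) (hb : s.nat n = b) (hb0 : 0 < b) :
    Runs x (natDivMod u c n) s (3 * a + 2)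
      fun s' => s'.nat u = a / b ∧ s'.nat c = a % b := by
  simp only [List.mem_cons, not_or, List.not_mem_nil, not_false_eq_true, and_true] at hu hc
  obtain ⟨hu1, huc, hun⟩ := hu
  have hloop : ∀ c' v, ∀ s' : State, s'.nat c = c' → s'.nat u = v → s'.nat n = b → s'.nat 1 = 1 →
      Runs x (.loop (.natLe n c) (block (.natSub c c n) [.natAdd u u 1])) s' (3 * c' + 1)
        fun s' => s'.nat u = v + c' / b ∧ s'.nat c = c' % b := by
    intro c'
    induction c' using Nat.strong_induction_on with
    | _ c' ih =>
      intro v s' h1 h2 h3 h4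
      by_cases hlt : c' < b
      · refine ⟨1, s', Exec.loop_false (by simp [Test.holds, h1, h3, hlt]), by omega, ?_, ?_⟩
        · rw [h2, Nat.div_eq_of_lt hlt]; rfl
        · rw [h1, Nat.mod_eq_of_lt hlt]
      · push Not at hlt
        obtain ⟨k, s₁, h6, h7, h8⟩ := runs_block (x := x) (s := s') (i := .natSub c c n)
          (l := [.natAdd u u 1]) (Q := fun s₁ => s₁.nat c = c' - b ∧ s₁.nat u = v + 1 ∧
            s₁.nat n = b ∧ s₁.nat 1 = 1)
          (by simp [Instr.apply, h1, h2, h3, h4, huc, Ne.symm hun, Ne.symm hu1,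
            Ne.symm hc.1, Ne.symm hc.2, Ne.symm huc])
        obtain ⟨k', s₂, h9, h10, h11, h12⟩ := ih (c' - b) (by omega) (v + 1) s₁ h8.1 h8.2.1
          h8.2.2.1 h8.2.2.2
        refine ⟨_, s₂, Exec.loop_true (by simp [Test.holds, h1, h3, hlt]) h6 h9, ?_, ?_, ?_⟩
        · simp at h7; omega
        · rw [h11, Nat.div_eq_sub_div hb0 hlt]; ring
        · rw [h12, ← Nat.mod_eq_sub_mod hlt]
  refine (Runs.seq (Runs.instr (Q := fun s' => s' = (Instr.natConst u 0).apply x s) rfl)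
    fun s' hs' _ => hloop a 0 s' ?_ ?_ ?_ ?_).mono (by omega) fun _ _ h => by simpa using h
  all_goals simp [hs', Instr.apply, ha, hb, hs, Ne.symm hu1, Ne.symm huc, Ne.symm hun]

/-! ### Setting up the parameters -/

/-- Operations on natural number variables. -/
inductive NatOp where
  | const (r c : ℕ)
  | add (r p q : ℕ)
  | sub (r p q : ℕ)
  | mul (r p q : ℕ)
  | pow (r p e : ℕ)

/-- The program for an operation. -/
def NatOp.prog : NatOp → Prog
  | .const r c => .instr (.natConst r c)
  | .add r p q => .instr (.natAdd r p q)
  | .sub r p q => .instr (.natSub r p q)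
  | .mul r p q => natMul r p q
  | .pow r p e => natPow r p e

/-- The effect of an operation. -/
def NatOp.eval (f : ℕ → ℕ) : NatOp → ℕ → ℕ
  | .const r c => Function.update f r c
  | .add r p q => Function.update f r (f p + f q)
  | .sub r p q => Function.update f r (f p - f q)
  | .mul r p q => Function.update f r (f p * f q)
  | .pow r p e => Function.update f r (f p ^ f e)

/-- A bound on the running time of an operation. -/
def NatOp.cost (f : ℕ → ℕ) : NatOp → ℕ
  | .const _ _ | .add _ _ _ | .sub _ _ _ => 1
  | .mul _ _ q => 4 * f q + 4
  | .pow _ p e => f e * (4 * (f p + 1) ^ f e + 9) + 4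

/-- The operation does not use the scratch variables. -/
def NatOp.ok : NatOp → Prop
  | .const r _ => r ∉ [1, 90, 91, 92, 93, 94]
  | .add r p q | .sub r p q | .mul r p q | .pow r p q =>
    r ∉ [1, p, q, 90, 91, 92, 93, 94] ∧ p ∉ [90, 91, 92, 93, 94] ∧ q ∉ [90, 91, 92, 93, 94]

instance : DecidablePred NatOp.ok := fun o => by
  cases o <;> unfold NatOp.ok <;> infer_instance

/-- Variables 90 to 94 are scratch space of the subroutines, so the memory is described by f only
outside them. -/
theorem NatOp.runs {x : ℕ → ℝ} {o : NatOp} (ho : o.ok) {s : State} {f : ℕ → ℕ} (hs : s.nat 1 = 1)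
    (hf : ∀ r, r ∉ [90, 91, 92, 93, 94] → s.nat r = f r) :
    Runs x o.prog s (o.cost f) fun s' => s'.nat 1 = 1 ∧
      ∀ r, r ∉ [90, 91, 92, 93, 94] → s'.nat r = o.eval f r := by
  cases o with
  | const r c =>
    simp only [ok, List.mem_cons, not_or] at ho
    refine Runs.instr ⟨by simp [Instr.apply, hs, Ne.symm ho.1], fun r' hr' => ?_⟩
    simp only [Instr.apply, eval, Function.update_apply, hf r' hr']
  | add r p q =>
    obtain ⟨h1, h2, h3⟩ := ho
    simp only [List.mem_cons, not_or] at h1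
    refine Runs.instr ⟨by simp [Instr.apply, hs, Ne.symm h1.1], fun r' hr' => ?_⟩
    simp only [Instr.apply, eval, Function.update_apply, hf r' hr', hf p h2, hf q h3]
  | sub r p q =>
    obtain ⟨h1, h2, h3⟩ := ho
    simp only [List.mem_cons, not_or] at h1
    refine Runs.instr ⟨by simp [Instr.apply, hs, Ne.symm h1.1], fun r' hr' => ?_⟩
    simp only [Instr.apply, eval, Function.update_apply, hf r' hr', hf p h2, hf q h3]
  | mul r p q =>
    obtain ⟨h1, h2, h3⟩ := ho
    have hw : ∀ r', r' ≠ r → r' ∉ [90, 91, 92, 93, 94] → r' ∉ (natMul r p q).natWrites := by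
      intro r' h h'
      simp only [List.mem_cons, not_or] at h'
      simp [natMul, forLoop, Prog.natWrites, Instr.natWrites, h, h']
    refine (runs_natMul hs
      (fun h => h1 (by simp at h ⊢; tauto)) (fun h => h2 (by simp at h ⊢; tauto))
      (fun h => h3 (by simp at h ⊢; tauto)) (hf p h2) (hf q h3)).mono le_rfl
      fun s' hF h => ⟨?_, fun r' hr' => ?_⟩
    · rw [hF.nat 1 (hw 1 (fun h => h1 (by simp [h])) (by decide)), hs]
    · by_cases hrr : r' = r
      · rw [hrr, h, eval, Function.update_self]
      · rw [hF.nat r' (hw r' hrr hr'), hf r' hr', eval, Function.update_of_ne hrr]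
  | pow r p q =>
    obtain ⟨h1, h2, h3⟩ := ho
    have hw : ∀ r', r' ≠ r → r' ∉ [90, 91, 92, 93, 94] → r' ∉ (natPow r p q).natWrites := by
      intro r' h h'
      simp only [List.mem_cons, not_or] at h'
      simp [natPow, block, natMul, forLoop, Prog.natWrites, Instr.natWrites, h, h']
    refine (runs_natPow hs h1 h2 h3 (hf p h2) (hf q h3)).mono le_rfl
      fun s' hF h => ⟨?_, fun r' hr' => ?_⟩
    · rw [hF.nat 1 (hw 1 (fun h => h1 (by simp [h])) (by decide)), hs]
    · by_cases hrr : r' = r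
      · rw [hrr, h, eval, Function.update_self]
      · rw [hF.nat r' (hw r' hrr hr'), hf r' hr', eval, Function.update_of_ne hrr]

/-- The program for a sequence of operations. -/
def natProg : List NatOp → Prog
  | [] => .instr (.natConst 90 0)
  | o :: l => .seq o.prog (natProg l)

/-- The effect of a sequence of operations. -/
def natEval : List NatOp → (ℕ → ℕ) → ℕ → ℕ
  | [], f => f
  | o :: l, f => natEval l (o.eval f)

/-- A bound on the running time of a sequence of operations. -/
def natCost : List NatOp → (ℕ → ℕ) → ℕ
  | [], _ => 1
  | o :: l, f => o.cost f + natCost l (o.eval f)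

theorem runs_natProg {x : ℕ → ℝ} {l : List NatOp} (hl : ∀ o ∈ l, o.ok) {s : State} {f : ℕ → ℕ}
    (hs : s.nat 1 = 1) (hf : ∀ r, r ∉ [90, 91, 92, 93, 94] → s.nat r = f r) :
    Runs x (natProg l) s (natCost l f) fun s' =>
      ∀ r, r ∉ [90, 91, 92, 93, 94] → s'.nat r = natEval l f r := by
  induction l generalizing s f with
  | nil =>
    refine Runs.instr fun r hr => ?_
    have hr' : r ≠ 90 := fun h => hr (by simp [h])
    simp [Instr.apply, natEval, hf r hr, hr']
  | cons o l ih =>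
    exact (NatOp.runs (hl o (by simp)) hs hf).seq fun s' h _ =>
      ih (fun o ho => hl o (by simp [ho])) h.1 h.2

/-- The bound on the numerators of the grid points. -/
def gridBound (k q : ℕ) : ℕ := (q + q) * invMesh k q

/-- The number of grid points for each parameter. -/
def gridSize (k q : ℕ) : ℕ := gridBound k q + gridBound k q + 1

/-- The number of grid points for the tuple of all parameters. -/
def numCandidates (k q : ℕ) : ℕ := gridSize k q ^ (k + k + k)

/-- The computation of the natural number parameters of the search. -/
def paramOps : List NatOp :=
  [.const 20 7, .mul 21 20 0, .mul 22 21 0, .mul 23 22 0, .const 24 120, .mul 25 24 0,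
    .pow 26 25 23, .const 27 1000, .mul 28 27 0, .mul 29 28 2, .pow 4 29 26, .mul 5 4 4,
    .mul 30 5 5, .mul 6 30 3, .add 31 2 2, .mul 7 31 5, .add 32 7 7, .add 8 32 1, .add 12 0 0,
    .add 11 12 0, .pow 9 8 11, .add 33 12 12, .sub 10 33 1]

/-- The values of the variables after the computation of the parameters. -/
theorem natEval_paramOps {f : ℕ → ℕ} {k q d : ℕ} (h0 : f 0 = k) (h1 : f 1 = 1) (h2 : f 2 = q)
    (h3 : f 3 = d) :
    natEval paramOps f 0 = k ∧ natEval paramOps f 1 = 1 ∧ natEval paramOps f 4 = invTol k q ∧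
      natEval paramOps f 5 = invMesh k q ∧ natEval paramOps f 6 = sampleSize k q d ∧
      natEval paramOps f 7 = gridBound k q ∧ natEval paramOps f 8 = gridSize k q ∧
      natEval paramOps f 9 = numCandidates k q ∧ natEval paramOps f 10 = k + k + (k + k) - 1 ∧
      natEval paramOps f 11 = k + k + k := by
  refine ⟨?_, ?_, ?_, ?_, ?_, ?_, ?_, ?_, ?_, ?_⟩ <;>
    simp [paramOps, natEval, NatOp.eval, h0, h1, h2, h3, numCandidates, gridSize, gridBound,
      sampleSize, invMesh, invTol, tolExp, baseScale]

/-- A bound on the time for the computation of the parameters. -/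
def paramCost (k q d : ℕ) : ℕ :=
  natCost paramOps fun r => if r = 0 then k else if r = 1 then 1 else if r = 2 then q else
    if r = 3 then d else 0

/-! ### The pieces of the search program -/

/-- The variables holding the parameters of the search have been set. -/
structure Ready (k q d : ℕ) (ε : ℝ) (s : State) : Prop where
  n0 : s.nat 0 = k
  n1 : s.nat 1 = 1
  n6 : s.nat 6 = sampleSize k q d
  n7 : s.nat 7 = gridBound k q
  n8 : s.nat 8 = gridSize k q
  n9 : s.nat 9 = numCandidates k q
  n10 : s.nat 10 = k + k + (k + k) - 1
  n11 : s.nat 11 = k + k + k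
  r2 : s.real 2 = 1
  r3 : s.real 3 = 1 / (invTol k q : ℝ)
  r4 : s.real 4 = 1 / (invMesh k q : ℝ)
  r5 : s.real 5 = ε / 2
  r6 : s.real 6 = 2 / ε
  r7 : s.real 7 = -(2 / ε)
  r8 : s.real 8 = gridBound k q
  r9 : s.real 9 = sampleSize k q d
  r10 : s.real 10 = 0

/-- The parameters live in variables that no later subprogram writes to; both hypotheses are
decidable for concrete programs. -/
theorem Ready.of_frame {k q d : ℕ} {ε : ℝ} {s s' : State} (h : Ready k q d ε s) {c : Prog}
    (hF : Frame c s s') (hn : ∀ r ∈ [0, 1, 6, 7, 8, 9, 10, 11], r ∉ c.natWrites)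
    (hr : ∀ r ∈ [2, 3, 4, 5, 6, 7, 8, 9, 10], r ∉ c.realWrites) : Ready k q d ε s' := by
  constructor
  · rw [hF.nat _ (hn 0 (by simp)), h.n0]
  · rw [hF.nat _ (hn 1 (by simp)), h.n1]
  · rw [hF.nat _ (hn 6 (by simp)), h.n6]
  · rw [hF.nat _ (hn 7 (by simp)), h.n7]
  · rw [hF.nat _ (hn 8 (by simp)), h.n8]
  · rw [hF.nat _ (hn 9 (by simp)), h.n9]
  · rw [hF.nat _ (hn 10 (by simp)), h.n10]
  · rw [hF.nat _ (hn 11 (by simp)), h.n11]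
  · rw [hF.real _ (hr 2 (by simp)), h.r2]
  · rw [hF.real _ (hr 3 (by simp)), h.r3]
  · rw [hF.real _ (hr 4 (by simp)), h.r4]
  · rw [hF.real _ (hr 5 (by simp)), h.r5]
  · rw [hF.real _ (hr 6 (by simp)), h.r6]
  · rw [hF.real _ (hr 7 (by simp)), h.r7]
  · rw [hF.real _ (hr 8 (by simp)), h.r8]
  · rw [hF.real _ (hr 9 (by simp)), h.r9]
  · rw [hF.real _ (hr 10 (by simp)), h.r10]

/-- Drawing the samples and computing their power sums. -/
def samplesProg : Prog :=
  forLoop 40 41 6 (.seq (block (.sample 20) [.realConst 21 1])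
    (forLoop 42 43 10 (block (.load 22 3 42)
      [.realOp .add 22 22 21, .store 3 42 22, .realOp .mul 21 21 20])))

section

variable {x : ℕ → ℝ} {k q d : ℕ} {ε : ℝ} {s : State}

/-- Samples are not stored: each is added into all power sums at once. The bound 4 k - 1, written
without multiplication, covers the powers 0 to 4 k - 2. -/
theorem runs_samplesProg (h : Ready k q d ε s) (hpos : s.pos = 0) (harr : s.arr 3 = 0) :
    Runs x samplesProg s
      (sampleSize k q d * ((2 + ((k + k + (k + k)) * 7 + 3)) + 3) + 3) fun s' =>
      s'.pos = sampleSize k q d ∧ ∀ j < k + k + (k + k) - 1,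
        s'.arr 3 j = ∑ l ∈ Finset.range (sampleSize k q d), x l ^ j := by
  refine runs_forLoop (N := sampleSize k q d) (fun l s' => s'.pos = l ∧
    ∀ j < k + k + (k + k) - 1, s'.arr 3 j = ∑ l ∈ Finset.range l, x l ^ j)
    (by decide) (by decide) (by decide) (by decide) h.n1 h.n6 (by simp [hpos, harr]) ?_
  rintro l - s' ⟨hp, ha⟩ - - hF
  have h' := h.of_frame hF (by decide) (by decide)
  refine (Runs.seq (runs_block (Q := fun s₁ => s₁.pos = l + 1 ∧ s₁.real 20 = x l ∧
    s₁.real 21 = 1 ∧ s₁.arr 3 = s'.arr 3) (by simp [Instr.apply, hp])) fun s₁ h₁ hF₁ => ?_).mono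
    (T := 2 + ((k + k + (k + k) - 1) * (4 + 3) + 3)) (by omega)
    (P := fun s'' => s''.pos = l + 1 ∧
      ∀ j < k + k + (k + k) - 1, s''.arr 3 j = s'.arr 3 j + x l ^ j) ?_
  · obtain ⟨hp₁, hx₁, hy₁, ha₁⟩ := h₁
    have h₁ := h'.of_frame hF₁ (by decide) (by decide)
    refine (runs_forLoop (N := k + k + (k + k) - 1) (T := 4) (fun j s'' => s''.real 21 = x l ^ j ∧
      ∀ i, s''.arr 3 i = if i < j then s'.arr 3 i + x l ^ i else s'.arr 3 i)
      (by decide) (by decide) (by decide) (by decide) h₁.n1 h₁.n10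
      (by simp [hy₁, ha₁]) ?_).mono le_rfl ?_
    · rintro j - s₂ ⟨hy, hA⟩ hi - hF₂
      have hx := (hF₂.real 20 (by decide)).trans hx₁
      refine runs_block ⟨?_, fun i => ?_⟩
      · simp [Instr.apply, Op.eval, hx, hy, pow_succ]
      · simp only [List.foldl, Instr.apply, Op.eval, State.setCounter_arr, Function.update_apply,
          hi, hy, hA]
        by_cases hij : i = j
        · subst hij; simp
        · simp only [if_true]
          rw [Function.update_of_ne hij, hA]
          by_cases hlt : i < j
          · simp [hlt, show i < j + 1 by omega]
          · simp [hlt, show ¬ i < j + 1 by omega]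
    · rintro s₂ hF₂ ⟨-, hA⟩
      refine ⟨(hF₂.pos (by decide)).trans hp₁, fun j hj => ?_⟩
      rw [hA, if_pos hj]
  · rintro s'' - ⟨hp'', ha''⟩
    refine ⟨hp'', fun j hj => ?_⟩
    simp only [State.setCounter_arr]
    rw [ha'' j hj, ha j hj, Finset.sum_range_succ]

/-- Computing the sample moments from the power sums. -/
def normalizeProg : Prog :=
  forLoop 40 41 10 (block (.load 20 3 40) [.realOp .div 20 20 9, .store 3 40 20])

theorem runs_normalizeProg (h : Ready k q d ε s) :
    Runs x normalizeProg s ((k + k + (k + k)) * 6 + 3) fun s' =>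
      ∀ j < k + k + (k + k) - 1, s'.arr 3 j = s.arr 3 j / sampleSize k q d := by
  refine (runs_forLoop (N := k + k + (k + k) - 1) (T := 3) (fun j s'' =>
    ∀ i, s''.arr 3 i = if i < j then s.arr 3 i / sampleSize k q d else s.arr 3 i)
    (by decide) (by decide) (by decide) (by decide) h.n1 h.n10 (by simp) ?_).mono
    (by omega) ?_
  · rintro j - s₂ hA hi - hF₂
    have h' := h.of_frame hF₂ (by decide) (by decide)
    refine runs_block fun i => ?_
    simp only [List.foldl, Instr.apply, Op.eval, State.setCounter_arr, Function.update_apply,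
      hi, hA]
    by_cases hij : i = j
    · subst hij; simp [h'.r9]
    · simp only [if_true]
      rw [Function.update_of_ne hij, hA]
      by_cases hlt : i < j
      · simp [hlt, show i < j + 1 by omega]
      · simp [hlt, show ¬ i < j + 1 by omega]
  · rintro s₂ - hA j hj
    rw [hA, if_pos hj]

/-- The `i`-th coordinate of the grid point with number `t`. -/
noncomputable def gridCoord (k q t i : ℕ) : ℝ :=
  (((t / gridSize k q ^ i % gridSize k q : ℕ) : ℝ) - gridBound k q) * (1 / (invMesh k q : ℝ))

/-- Decoding the grid point with the number held by variable `60`. -/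
def decodeProg : Prog :=
  .seq (block (.natConst 51 0) [.natAdd 51 51 60])
    (forLoop 42 43 11 (.seq (natDivMod 52 51 8) (.seq (natToReal 20 51)
      (block (.realOp .sub 20 20 8) [.realOp .mul 20 20 4, .store 4 42 20, .natConst 51 0,
        .natAdd 51 51 52]))))

/-- The coordinates are the digits of t in base `gridSize k q`, shifted by `gridBound k q` to allow
negative values and scaled by the mesh. Division by repeated subtraction accounts for the term 3 t.
-/
theorem runs_decodeProg (h : Ready k q d ε s) {t : ℕ} (ht : s.nat 60 = t) :
    Runs x decodeProg s (2 + ((k + k + k) * (((3 * t + 2) + ((4 * gridSize k q + 4) + 5)) + 3) + 3))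
      fun s' => ∀ i < k + k + k, s'.arr 4 i = gridCoord k q t i := by
  have hD : 0 < gridSize k q := Nat.succ_pos _
  refine Runs.seq (runs_block (Q := fun s₁ => s₁.nat 51 = t) (by simp [Instr.apply, ht]))
    fun s₁ h₁ hF₁ => ?_
  have h' := h.of_frame hF₁ (by decide) (by decide)
  refine (runs_forLoop (N := k + k + k) (fun i s'' => s''.nat 51 = t / gridSize k q ^ i ∧
    ∀ j < i, s''.arr 4 j = gridCoord k q t j)
    (by decide) (by decide) (by decide) (by decide) h'.n1 h'.n11 (by simp [h₁]) ?_).mono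
    le_rfl fun _ _ h => h.2
  rintro i - s₂ ⟨hc, hA⟩ hi - hF₂
  have h₂ := h'.of_frame hF₂ (by decide) (by decide)
  refine (Runs.seq (runs_natDivMod h₂.n1 (by decide) (by decide) hc h₂.n8 hD)
    fun s₃ h₃ hF₃ => ?_).mono (T := (3 * (t / gridSize k q ^ i) + 2) + ((4 * gridSize k q + 4) + 5))
    ?_ fun _ _ h => h
  · have h₃' := h₂.of_frame hF₃ (by decide) (by decide)
    refine Runs.seq ((runs_natToReal h₃'.n1 h₃'.r2 (by decide) (by decide) h₃.2).mono ?_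
      fun s' _ h => h) fun s₄ h₄ hF₄ => ?_
    · have := Nat.mod_lt (t / gridSize k q ^ i) hD
      omega
    have h₄' := h₃'.of_frame hF₄ (by decide) (by decide)
    have h52 := (hF₄.nat 52 (by decide)).trans h₃.1
    have h42 := (hF₄.nat 42 (by decide)).trans ((hF₃.nat 42 (by decide)).trans hi)
    have hA4 : s₄.arr 4 = s₂.arr 4 := (hF₄.arr 4 (by decide)).trans (hF₃.arr 4 (by decide))
    refine runs_block ⟨?_, fun j hj => ?_⟩
    · simp [Instr.apply, h52, Nat.div_div_eq_div_mul, pow_succ]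
    · simp only [List.foldl, Instr.apply, Op.eval, State.setCounter_arr, Function.update_apply]
      simp only [if_true, h42, hA4]
      by_cases hij : j = i
      · subst hij
        simp [h₄, h₄'.r4, h₄'.r8, gridCoord]
      · simp [hij, hA j (by omega)]
  · have : t / gridSize k q ^ i ≤ t := Nat.div_le_self _ _
    omega

/-- Setting the flag `50` unless all listed inequalities between real variables hold. -/
def checkProg : List (ℕ × ℕ) → Prog
  | [] => .instr (.natConst 98 0)
  | p :: l => .seq (.cond (.realLe p.1 p.2) (.instr (.natConst 98 0)) (.instr (.natConst 50 1)))
    (checkProg l)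

/-- The flag is only ever raised, so checks accumulate. Writing to variable 98 plays the role of the
empty program. -/
theorem runs_checkProg (l : List (ℕ × ℕ)) (s : State) :
    Runs x (checkProg l) s (2 * l.length + 1) fun s' =>
      (s'.nat 50 = 0 ↔ s.nat 50 = 0 ∧ ∀ p ∈ l, s.real p.1 ≤ s.real p.2) := by
  induction l generalizing s with
  | nil => exact Runs.instr (by simp [Instr.apply])
  | cons p l ih =>
    refine (Runs.seq (T := 2) (T' := 2 * l.length + 1) (Runs.cond (T := 1)
      (Q := fun s' => s'.real = s.real ∧
        (s'.nat 50 = 0 ↔ s.nat 50 = 0 ∧ s.real p.1 ≤ s.real p.2))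
      (fun ht => Runs.instr ?_) fun ht => Runs.instr ?_) fun s' h' _ =>
        (ih s').mono le_rfl fun s'' _ h'' => ?_).mono (by simp; omega) fun s'' _ h'' => h''
    · simp only [Test.holds] at ht
      simp [Instr.apply, ht]
    · simp only [Test.holds] at ht
      simp [Instr.apply, ht]
    · rw [h'', h'.2, h'.1]
      simp [and_assoc]

/-- Replacing a real variable by its absolute value; variable `10` holds `0`. -/
def absProg (r : ℕ) : Prog :=
  .cond (.realLe r 10) (.instr (.realOp .sub r 10 r)) (.instr (.natConst 98 0))

theorem runs_absProg (r : ℕ) (h : s.real 10 = 0) :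
    Runs x (absProg r) s 2 fun s' => s'.real r = |s.real r| := by
  refine Runs.cond (fun ht => Runs.instr ?_) fun ht => Runs.instr ?_
  · simp only [Test.holds, h] at ht
    simp [Instr.apply, Op.eval, h, abs_of_nonpos ht]
  · simp only [Test.holds, h, not_le] at ht
    simp [Instr.apply, abs_of_pos ht]

end

/-! ### Testing whether a candidate is a match

The flag `50` is zero as long as all tests have been passed. -/

section

variable {x : ℕ → ℝ} {k q d : ℕ} {ε : ℝ} {s : State}

/-- A loop whose body may raise the flag tests a bounded universal statement. -/
theorem runs_flagLoop {i i' n : ℕ} {c : Prog} {T N : ℕ} {P : ℕ → Prop} (hii : i ≠ i')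
    (hw : ∀ r ∈ [i, i', n, 1], r ∉ c.natWrites) (hn : n ≠ i ∧ n ≠ i') (h1 : 1 ≠ i ∧ 1 ≠ i')
    (h50 : 50 ≠ i ∧ 50 ≠ i') (hs : s.nat 1 = 1) (hN : s.nat n = N)
    (hstep : ∀ l < N, ∀ s', s'.nat i = l → Frame (forLoop i i' n c) s s' →
      Runs x c s' T fun s'' => (s''.nat 50 = 0 ↔ s'.nat 50 = 0 ∧ P l)) :
    Runs x (forLoop i i' n c) s (N * (T + 3) + 3) fun s' =>
      (s'.nat 50 = 0 ↔ s.nat 50 = 0 ∧ ∀ l < N, P l) := by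
  refine runs_forLoop (fun l s' => (s'.nat 50 = 0 ↔ s.nat 50 = 0 ∧ ∀ j < l, P j)) hii hw hn h1 hs
    hN (by simp [State.setCounter_nat h50.1 h50.2]) fun l hl s' hI hi _ hF => ?_
  refine (hstep l hl s' hi hF).mono le_rfl fun s'' _ h => ?_
  rw [State.setCounter_nat h50.1 h50.2, h, hI]
  simp only [Nat.lt_succ_iff_lt_or_eq, or_imp, forall_and, forall_eq, and_assoc]

/-- Testing the bounds on the parameters. -/
def rangeProg : Prog :=
  forLoop 42 43 0 (.seq (block (.natAdd 53 42 0) [.natAdd 54 53 0, .load 20 4 42, .load 21 4 53,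
    .load 22 4 54]) (checkProg [(5, 20), (21, 6), (7, 21), (4, 22), (22, 6)]))

/-- Positivity of a variance is tested as being at least the mesh width, which is equivalent on the
grid and needs only ≤. -/
theorem runs_rangeProg (h : Ready k q d ε s) :
    Runs x rangeProg s (k * (16 + 3) + 3) fun s' => (s'.nat 50 = 0 ↔ s.nat 50 = 0 ∧
      ∀ i < k, ε / 2 ≤ s.arr 4 i ∧ s.arr 4 (i + k) ≤ 2 / ε ∧ -(2 / ε) ≤ s.arr 4 (i + k) ∧
        1 / (invMesh k q : ℝ) ≤ s.arr 4 (i + k + k) ∧ s.arr 4 (i + k + k) ≤ 2 / ε) := by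
  refine runs_flagLoop (by decide) (by decide) (by decide) (by decide) (by decide) h.n1 h.n0 ?_
  intro i _ s' hi hF
  have h' := h.of_frame hF (by decide) (by decide)
  refine (Runs.seq (T := 5) (T' := 11) (runs_block (Q := fun s₁ => s₁.nat 50 = s'.nat 50 ∧
    s₁.real 20 = s.arr 4 i ∧ s₁.real 21 = s.arr 4 (i + k) ∧ s₁.real 22 = s.arr 4 (i + k + k))
    (by simp [Instr.apply, hi, h'.n0, hF.arr 4 (by decide)])) fun s₁ h₁ hF₁ =>
    (runs_checkProg _ s₁).mono le_rfl fun s₂ _ h₂ => ?_)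
  have h₃ := h'.of_frame hF₁ (by decide) (by decide)
  rw [h₂, h₁.1]
  simp [h₁.2, h₃.r5, h₃.r6, h₃.r7, h₃.r4]

/-- Testing the distances between the components. -/
def separationProg : Prog :=
  forLoop 42 43 0 (.seq (block (.natAdd 53 42 0) [.natAdd 54 53 0, .load 23 4 53, .load 24 4 54])
    (forLoop 44 45 42 (.seq (block (.natAdd 55 44 0) [.natAdd 56 55 0, .load 21 4 55,
      .load 22 4 56, .realOp .sub 21 23 21, .realOp .sub 22 24 22])
      (.seq (absProg 21) (.seq (absProg 22) (.seq (.instr (.realOp .add 21 21 22))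
        (checkProg [(5, 21)])))))))

/-- By symmetry the pairs j < i suffice, so the counter of the outer loop bounds the inner one. -/
theorem runs_separationProg (h : Ready k q d ε s) :
    Runs x separationProg s (k * ((4 + (k * (14 + 3) + 3)) + 3) + 3) fun s' =>
      (s'.nat 50 = 0 ↔ s.nat 50 = 0 ∧ ∀ i < k, ∀ j < i,
        ε / 2 ≤ |s.arr 4 (i + k) - s.arr 4 (j + k)| +
          |s.arr 4 (i + k + k) - s.arr 4 (j + k + k)|) := by
  refine runs_flagLoop (by decide) (by decide) (by decide) (by decide) (by decide) h.n1 h.n0 ?_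
  intro i hik s' hi hF
  have h' := h.of_frame hF (by decide) (by decide)
  refine (Runs.seq (T := 4) (T' := k * (14 + 3) + 3) (runs_block (Q := fun s₁ =>
    s₁.nat 50 = s'.nat 50 ∧ s₁.nat 42 = i ∧ s₁.real 23 = s.arr 4 (i + k) ∧
      s₁.real 24 = s.arr 4 (i + k + k))
    (by simp [Instr.apply, hi, h'.n0, hF.arr 4 (by decide)])) fun s₁ h₁ hF₁ => ?_)
  have h₂ := h'.of_frame hF₁ (by decide) (by decide)
  obtain ⟨h50, h42, h23, h24⟩ := h₁
  rw [← h50]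
  refine (runs_flagLoop (T := 14) (by decide) (by decide) (by decide) (by decide) (by decide)
    h₂.n1 h42 ?_).mono (by gcongr) fun _ _ h => h
  intro j _ s₃ hj hF₃
  have h₃ := h₂.of_frame hF₃ (by decide) (by decide)
  have e4 : s₃.arr 4 = s.arr 4 := (hF₃.arr 4 (by decide)).trans
    ((hF₁.arr 4 (by decide)).trans (hF.arr 4 (by decide)))
  have e23 := (hF₃.real 23 (by decide)).trans h23
  have e24 := (hF₃.real 24 (by decide)).trans h24
  refine Runs.seq (T := 6) (T' := 8) (runs_block (Q := fun s₄ => s₄.nat 50 = s₃.nat 50 ∧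
    s₄.real 21 = s.arr 4 (i + k) - s.arr 4 (j + k) ∧
    s₄.real 22 = s.arr 4 (i + k + k) - s.arr 4 (j + k + k))
    (by simp [Instr.apply, Op.eval, hj, h₃.n0, e4, e23, e24])) fun s₄ h₄ hF₄ => ?_
  have g₄ := h₃.of_frame hF₄ (by decide) (by decide)
  refine Runs.seq (T := 2) (T' := 6) (runs_absProg 21 g₄.r10) fun s₅ h₅ hF₅ => ?_
  have g₅ := g₄.of_frame hF₅ (by decide) (by decide)
  refine Runs.seq (T := 2) (T' := 4) (runs_absProg 22 g₅.r10) fun s₆ h₆ hF₆ => ?_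
  have g₆ := g₅.of_frame hF₆ (by decide) (by decide)
  refine Runs.seq (T := 1) (T' := 3) (Runs.instr (Q := fun s₇ => s₇.nat 50 = s₆.nat 50 ∧
    s₇.real 5 = ε / 2 ∧ s₇.real 21 = s₆.real 21 + s₆.real 22)
    (by simp [Instr.apply, Op.eval, g₆.r5])) fun s₇ h₇ hF₇ => ?_
  refine (runs_checkProg _ s₇).mono le_rfl fun s₈ _ h₈ => ?_
  rw [h₈, h₇.1, hF₆.nat 50 (by decide), hF₅.nat 50 (by decide), h₄.1]
  simp only [List.mem_singleton, forall_eq, h₇.2, h₆, hF₆.real 21 (by decide),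
    hF₅.real 22 (by decide), h₅, h₄.2]

/-- Computing the moments of the candidate. -/
def momentsProg : Prog :=
  .seq (forLoop 42 43 10 (.instr (.store 5 42 10)))
    (forLoop 42 43 0 (.seq (block (.natAdd 53 42 0) [.natAdd 54 53 0, .load 20 4 42,
      .load 21 4 53, .load 22 4 54, .realConst 25 1, .realOp .add 26 21 10,
      .realConst 27 1])
      (forLoop 44 45 10 (block (.load 28 5 44) [.realOp .mul 29 20 25, .realOp .add 28 28 29,
        .store 5 44 28, .realOp .mul 29 27 22, .realOp .mul 29 29 25, .realOp .mul 30 21 26,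
        .realOp .add 25 26 10, .realOp .add 26 30 29, .realOp .add 27 27 2]))))

/-- Real variables 25 and 26 hold two consecutive moments of one component and 27 the factor l + 1,
so the inner loop runs the recursion defining `gaussMoment` while accumulating the weighted moments.
-/
theorem runs_momentsProg (h : Ready k q d ε s) :
    Runs x momentsProg s (((k + k + (k + k)) * 4 + 3) +
      (k * ((8 + ((k + k + (k + k)) * (10 + 3) + 3)) + 3) + 3)) fun s' =>
      ∀ j < k + k + (k + k) - 1, s'.arr 5 j = ∑ i ∈ Finset.range k,
        s.arr 4 i * gaussMoment j (s.arr 4 (i + k)) (s.arr 4 (i + k + k)) := by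
  refine Runs.seq ((runs_forLoop (N := k + k + (k + k) - 1) (T := 1)
    (fun l s' => ∀ j < l, s'.arr 5 j = 0) (by decide) (by decide) (by decide) (by decide) h.n1
    h.n10 (by simp) ?_).mono (by omega) fun s' _ h => h) fun s₁ h₁ hF₁ => ?_
  · intro l _ s' hI hi _ hF
    have h' := h.of_frame hF (by decide) (by decide)
    refine Runs.instr fun j hj => ?_
    simp only [Instr.apply, State.setCounter_arr, Function.update_self, hi, h'.r10]
    by_cases hjl : j = l
    · subst hjl; simp
    · rw [Function.update_of_ne hjl, hI j (by omega)]
  have g₁ := h.of_frame hF₁ (by decide) (by decide)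
  refine runs_forLoop (N := k) (fun l s' => ∀ j < k + k + (k + k) - 1, s'.arr 5 j =
    ∑ i ∈ Finset.range l, s.arr 4 i * gaussMoment j (s.arr 4 (i + k)) (s.arr 4 (i + k + k)))
    (by decide) (by decide) (by decide) (by decide) g₁.n1 g₁.n0
    (by simpa using h₁) ?_
  intro i hik s' hI hi _ hF
  have h' := g₁.of_frame hF (by decide) (by decide)
  have e4 : s'.arr 4 = s.arr 4 := (hF.arr 4 (by decide)).trans (hF₁.arr 4 (by decide))
  refine Runs.seq (T := 8) (T' := (k + k + (k + k)) * (10 + 3) + 3) (runs_block (Q := fun s₃ =>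
    s₃.real 20 = s.arr 4 i ∧ s₃.real 21 = s.arr 4 (i + k) ∧ s₃.real 22 = s.arr 4 (i + k + k) ∧
    s₃.real 25 = 1 ∧ s₃.real 26 = s.arr 4 (i + k) ∧ s₃.real 27 = 1)
    (by simp [Instr.apply, Op.eval, hi, h'.n0, h'.r10, e4])) fun s₃ h₃ hF₃ => ?_
  obtain ⟨w₃, m₃, v₃, a₃, b₃, c₃⟩ := h₃
  have g₃ := h'.of_frame hF₃ (by decide) (by decide)
  have e5 : s₃.arr 5 = s'.arr 5 := hF₃.arr 5 (by decide)
  refine (runs_forLoop (N := k + k + (k + k) - 1) (T := 10) (fun l s'' =>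
    s''.real 25 = gaussMoment l (s.arr 4 (i + k)) (s.arr 4 (i + k + k)) ∧
    s''.real 26 = gaussMoment (l + 1) (s.arr 4 (i + k)) (s.arr 4 (i + k + k)) ∧
    s''.real 27 = (l + 1 : ℕ) ∧ ∀ j, s''.arr 5 j = if j < l then s'.arr 5 j +
      s.arr 4 i * gaussMoment j (s.arr 4 (i + k)) (s.arr 4 (i + k + k)) else s'.arr 5 j)
    (by decide) (by decide) (by decide) (by decide) g₃.n1
    g₃.n10 (by simp [a₃, b₃, c₃, e5, gaussMoment]) ?_).mono (by omega) ?_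
  · rintro l - s₄ ⟨a₄, b₄, c₄, hA⟩ hl - hF₄
    have g₄ := g₃.of_frame hF₄ (by decide) (by decide)
    have w₄ := (hF₄.real 20 (by decide)).trans w₃
    have m₄ := (hF₄.real 21 (by decide)).trans m₃
    have v₄ := (hF₄.real 22 (by decide)).trans v₃
    refine runs_block ⟨?_, ?_, ?_, fun j => ?_⟩
    · simp [Instr.apply, Op.eval, b₄, g₄.r10]
    · simp [Instr.apply, Op.eval, a₄, b₄, c₄, w₄, m₄, v₄, gaussMoment]
    · simp [Instr.apply, Op.eval, c₄, g₄.r2]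
    · have : ∀ u : ℝ,
          s₄.arr 5 l + s.arr 4 i * gaussMoment l (s.arr 4 (i + k)) (s.arr 4 (i + k + k)) = u →
          Function.update (s₄.arr 5) l u j = if j < l + 1 then s'.arr 5 j +
          s.arr 4 i * gaussMoment j (s.arr 4 (i + k)) (s.arr 4 (i + k + k)) else s'.arr 5 j := by
        rintro u rfl
        by_cases hjl : j = l
        · subst hjl; simp [hA]
        · rw [Function.update_of_ne hjl, hA]
          by_cases hlt : j < l
          · simp [hlt, show j < l + 1 by omega]
          · simp [hlt, show ¬ j < l + 1 by omega]
      simpa [Instr.apply, Op.eval, hl, w₄, a₄] using this _ rfl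
  · rintro s₄ - ⟨-, -, -, hA⟩ j hj
    rw [State.setCounter_arr, hA, if_pos hj, hI j hj, Finset.sum_range_succ]

/-- Comparing the moments of the candidate with the sample moments, and testing whether the
weights sum up to one. -/
def compareProg : Prog :=
  .seq (block (.natConst 57 0) [.load 20 5 57]) (.seq (checkProg [(20, 2), (2, 20)])
    (forLoop 44 45 10 (.seq (block (.load 20 5 44) [.load 21 3 44, .realOp .sub 20 20 21])
      (.seq (absProg 20) (checkProg [(20, 3)])))))

/-- Moment 0 of the candidate is the sum of its weights; equality with one is tested by two
inequalities. -/
theorem runs_compareProg (h : Ready k q d ε s) :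
    Runs x compareProg s (2 + (5 + ((k + k + (k + k)) * (8 + 3) + 3))) fun s' =>
      (s'.nat 50 = 0 ↔ (s.nat 50 = 0 ∧ s.arr 5 0 = 1) ∧ ∀ j < k + k + (k + k) - 1,
        |s.arr 5 j - s.arr 3 j| ≤ 1 / (invTol k q : ℝ)) := by
  refine Runs.seq (T := 2) (runs_block (Q := fun s₁ => s₁.nat 50 = s.nat 50 ∧
    s₁.real 20 = s.arr 5 0) (by simp [Instr.apply])) fun s₁ h₁ hF₁ => ?_
  have g₁ := h.of_frame hF₁ (by decide) (by decide)
  refine Runs.seq (T := 5) ((runs_checkProg _ s₁).mono le_rfl fun s' _ h => h) fun s₂ h₂ hF₂ => ?_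
  have g₂ := g₁.of_frame hF₂ (by decide) (by decide)
  have e : s₂.nat 50 = 0 ↔ s.nat 50 = 0 ∧ s.arr 5 0 = 1 := by
    rw [h₂, h₁.1]
    simp only [List.forall_mem_cons, List.not_mem_nil, false_imp_iff, implies_true, and_true,
      h₁.2, g₁.r2, ← le_antisymm_iff]
  rw [← e]
  refine (runs_flagLoop (N := k + k + (k + k) - 1) (T := 8) (by decide) (by decide) (by decide)
    (by decide) (by decide) g₂.n1 g₂.n10 ?_).mono (by omega) fun _ _ h => h
  intro j _ s₃ hj hF₃
  have g₃ := g₂.of_frame hF₃ (by decide) (by decide)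
  have e5 : s₃.arr 5 = s.arr 5 := (hF₃.arr 5 (by decide)).trans
    ((hF₂.arr 5 (by decide)).trans (hF₁.arr 5 (by decide)))
  have e3 : s₃.arr 3 = s.arr 3 := (hF₃.arr 3 (by decide)).trans
    ((hF₂.arr 3 (by decide)).trans (hF₁.arr 3 (by decide)))
  refine Runs.seq (T := 3) (T' := 5) (runs_block (Q := fun s₄ => s₄.nat 50 = s₃.nat 50 ∧
    s₄.real 20 = s.arr 5 j - s.arr 3 j) (by simp [Instr.apply, Op.eval, hj, e5, e3]))
    fun s₄ h₄ hF₄ => ?_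
  have g₄ := g₃.of_frame hF₄ (by decide) (by decide)
  refine Runs.seq (T := 2) (T' := 3) (runs_absProg 20 g₄.r10) fun s₅ h₅ hF₅ => ?_
  have g₅ := g₄.of_frame hF₅ (by decide) (by decide)
  refine (runs_checkProg _ s₅).mono le_rfl fun s₆ _ h₆ => ?_
  rw [h₆, hF₅.nat 50 (by decide), h₄.1]
  simp [h₅, h₄.2, g₅.r3]

/-- Testing whether the candidate is a match. -/
def testProg : Prog :=
  .seq (.instr (.natConst 50 0)) (.seq rangeProg (.seq separationProg
    (.seq momentsProg compareProg)))

/-- A bound on the time for the test. -/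
def testCost (k : ℕ) : ℕ :=
  1 + ((k * (16 + 3) + 3) + ((k * ((4 + (k * (14 + 3) + 3)) + 3) + 3) +
    ((((k + k + (k + k)) * 4 + 3) +
      (k * ((8 + ((k + k + (k + k)) * (10 + 3) + 3)) + 3) + 3)) +
    (2 + (5 + ((k + k + (k + k)) * (8 + 3) + 3))))))

/-- The condition tested, in terms of the array `c` of parameters and the array `b` of sample
moments. -/
def Passes (k q : ℕ) (ε : ℝ) (c b : ℕ → ℝ) : Prop :=
  (∀ i < k, ε / 2 ≤ c i ∧ c (i + k) ≤ 2 / ε ∧ -(2 / ε) ≤ c (i + k) ∧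
    1 / (invMesh k q : ℝ) ≤ c (i + k + k) ∧ c (i + k + k) ≤ 2 / ε) ∧
  (∀ i < k, ∀ j < i, ε / 2 ≤ |c (i + k) - c (j + k)| + |c (i + k + k) - c (j + k + k)|) ∧
  ∑ i ∈ Finset.range k, c i = 1 ∧
  ∀ j < k + k + (k + k) - 1,
    |∑ i ∈ Finset.range k, c i * gaussMoment j (c (i + k)) (c (i + k + k)) - b j| ≤
      1 / (invTol k q : ℝ)

theorem runs_testProg (h : Ready k q d ε s) (hk : 1 ≤ k) :
    Runs x testProg s (testCost k) fun s' =>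
      (s'.nat 50 = 0 ↔ Passes k q ε (s.arr 4) (s.arr 3)) := by
  refine Runs.seq (Runs.instr (Q := fun s₁ => s₁.nat 50 = 0) (by simp [Instr.apply]))
    fun s₁ h₁ hF₁ => ?_
  have g₁ := h.of_frame hF₁ (by decide) (by decide)
  refine Runs.seq (runs_rangeProg g₁) fun s₂ h₂ hF₂ => ?_
  have g₂ := g₁.of_frame hF₂ (by decide) (by decide)
  refine Runs.seq (runs_separationProg g₂) fun s₃ h₃ hF₃ => ?_
  have g₃ := g₂.of_frame hF₃ (by decide) (by decide)
  refine Runs.seq (runs_momentsProg g₃) fun s₄ h₄ hF₄ => ?_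
  have g₄ := g₃.of_frame hF₄ (by decide) (by decide)
  refine (runs_compareProg g₄).mono le_rfl fun s₅ _ h₅ => ?_
  have e₁ : s₁.arr 4 = s.arr 4 := hF₁.arr 4 (by decide)
  have e₂ : s₂.arr 4 = s.arr 4 := (hF₂.arr 4 (by decide)).trans e₁
  have e₃ : s₃.arr 4 = s.arr 4 := (hF₃.arr 4 (by decide)).trans e₂
  have e : s₄.arr 3 = s.arr 3 := (hF₄.arr 3 (by decide)).trans ((hF₃.arr 3 (by decide)).trans
    ((hF₂.arr 3 (by decide)).trans (hF₁.arr 3 (by decide))))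
  rw [e₃] at h₄
  rw [e₁] at h₂
  rw [e₂] at h₃
  rw [h₅, hF₄.nat 50 (by decide), h₃, h₂, h₁, h₄ 0 (by omega), e, Passes]
  simp only [gaussMoment, mul_one, true_and, and_assoc]
  refine and_congr_right fun _ => and_congr_right fun _ => and_congr_right fun _ => ?_
  exact forall₂_congr fun j hj => by rw [h₄ j hj]

/-- Copying the candidate to the output if the flag is zero. -/
def copyProg : Prog :=
  .seq (.instr (.natConst 57 0)) (.cond (.natLe 50 57)
    (forLoop 42 43 0 (block (.natAdd 53 42 0) [.natAdd 54 53 0, .load 20 4 42, .load 21 4 53,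
      .load 22 4 54, .store 0 42 20, .store 1 42 21, .store 2 42 22]))
    (.instr (.natConst 98 0)))

/-- The parameters described by an array. -/
def ofArray (k : ℕ) (c : ℕ → ℝ) : Params k where
  w i := c i
  μ i := c (i + k)
  v i := c (i + k + k)

/-- Each passing candidate overwrites the previous one, so the search ends with the last match. -/
theorem runs_copyProg (h : Ready k q d ε s) :
    Runs x copyProg s (1 + ((k * (8 + 3) + 3) + 1)) fun s' =>
      (s.nat 50 = 0 → s'.output k = ofArray k (s.arr 4)) ∧
      (s.nat 50 ≠ 0 → s'.output k = s.output k) := by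
  refine Runs.seq (Runs.instr (Q := fun s₁ => s₁ = (Instr.natConst 57 0).apply x s) rfl)
    fun s₁ h₁ hF₁ => ?_
  have g₁ := h.of_frame hF₁ (by decide) (by decide)
  have e : Test.holds s₁ (.natLe 50 57) ↔ s.nat 50 = 0 := by
    simp [Test.holds, h₁, Instr.apply]
  refine Runs.cond (fun ht => ?_) fun ht => ?_
  · rw [e] at ht
    refine (runs_forLoop (N := k) (T := 8) (fun l s' => ∀ j < l, s'.arr 0 j = s.arr 4 j ∧
      s'.arr 1 j = s.arr 4 (j + k) ∧ s'.arr 2 j = s.arr 4 (j + k + k)) (by decide) (by decide)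
      (by decide) (by decide) g₁.n1 g₁.n0 (by simp) ?_).mono le_rfl ?_
    · intro l _ s' hI hi _ hF
      have g' := g₁.of_frame hF (by decide) (by decide)
      have e4 : s'.arr 4 = s.arr 4 := (hF.arr 4 (by decide)).trans (hF₁.arr 4 (by decide))
      refine runs_block fun j hj => ?_
      by_cases hjl : j = l
      · subst hjl; simp [Instr.apply, hi, e4, g'.n0]
      · simpa [Instr.apply, hi, hjl] using hI j (by omega)
    · intro s' _ hI
      refine ⟨fun _ => ?_, fun h => absurd ht h⟩
      simp only [State.output, ofArray, Params.mk.injEq]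
      exact ⟨funext fun i => (hI i i.2).1, funext fun i => (hI i i.2).2.1,
        funext fun i => (hI i i.2).2.2⟩
  · rw [e] at ht
    refine (Runs.instr (Q := fun s' => (s.nat 50 = 0 → s'.output k = ofArray k (s.arr 4)) ∧
      (s.nat 50 ≠ 0 → s'.output k = s.output k)) ⟨fun h => absurd h ht, fun _ => ?_⟩).mono
      (by omega) fun _ _ h => h
    simp [State.output, Instr.apply, h₁]

end

/-! ### The search program -/

section

variable {x : ℕ → ℝ} {k q d : ℕ} {ε : ℝ}

/-- Computing the parameters of the search. -/
def setupProg : Prog :=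
  .seq (block (.natConst 1 1) [.realConst 2 1]) (.seq (ceilInv 2 0 20) (.seq (ceilInv 3 1 20)
    (.seq (natProg paramOps) (.seq (natToReal 20 4) (.seq (.instr (.realOp .div 3 2 20))
    (.seq (natToReal 20 5) (.seq (.instr (.realOp .div 4 2 20)) (.seq (natToReal 8 7)
    (.seq (natToReal 9 6) (block (.realConst 20 2) [.realOp .div 5 0 20, .realOp .div 6 20 0,
      .realConst 10 0, .realOp .sub 7 10 6]))))))))))

/-- A bound on the time for computing the parameters of the search. -/
def setupCost (k q d : ℕ) : ℕ :=
  2 + ((3 * q + 3) + ((3 * d + 3) + (paramCost k q d + ((4 * invTol k q + 4) + (1 +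
    ((4 * invMesh k q + 4) + (1 + ((4 * gridBound k q + 4) +
      ((4 * sampleSize k q d + 4) + 5)))))))))

theorem runs_setupProg {δ : ℝ} (hε : 0 < ε) (hδ : 0 < δ) (hq : ⌊1 / ε⌋₊ + 1 = q)
    (hd : ⌊1 / δ⌋₊ + 1 = d) :
    Runs x setupProg (inputState k ε δ) (setupCost k q d) fun s' => Ready k q d ε s' := by
  have i2 : (inputState k ε δ).real 0 = ε := by simp [inputState]
  have i3 : (inputState k ε δ).real 1 = δ := by simp [inputState]
  refine Runs.seq (T := 2) (runs_block (Q := fun s₁ => s₁.nat 1 = 1 ∧ s₁.real 2 = 1 ∧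
    s₁.real 0 = ε ∧ s₁.real 1 = δ) (by simp [Instr.apply, i2, i3])) fun s₁ h₁ hF₁ => ?_
  obtain ⟨h1, h2, h3, h4⟩ := h₁
  refine Runs.seq ((runs_ceilInv h1 h2 (n := 2) (r := 0) (a := 20) (by decide) (by decide)
    (by decide) (by rwa [h3])).mono (T' := 3 * q + 3) (by rw [h3, hq])
    fun s' _ h => h) fun s₂ h₂ hF₂ => ?_
  rw [h3, hq] at h₂
  have e1 := (hF₂.nat 1 (by decide)).trans h1
  have e2 := (hF₂.real 2 (by decide)).trans h2
  have e3 := (hF₂.real 0 (by decide)).trans h3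
  have e4 := (hF₂.real 1 (by decide)).trans h4
  refine Runs.seq ((runs_ceilInv e1 e2 (n := 3) (r := 1) (a := 20) (by decide) (by decide)
    (by decide) (by rwa [e4])).mono (T' := 3 * d + 3) (by rw [e4, hd])
    fun s' _ h => h) fun s₃ h₃ hF₃ => ?_
  rw [e4, hd] at h₃
  have f1 := (hF₃.nat 1 (by decide)).trans e1
  have f2 := (hF₃.real 2 (by decide)).trans e2
  have f3 := (hF₃.real 0 (by decide)).trans e3
  have f4 := (hF₃.nat 2 (by decide)).trans h₂
  -- At this point the natural number memory off the scratch variables is k, 1, q, d in variables 0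
  -- to 3 and zero elsewhere.
  refine Runs.seq (runs_natProg (by decide) (f := fun r => if r = 0 then k else if r = 1 then 1
    else if r = 2 then q else if r = 3 then d else 0) f1 ?_) fun s₄ h₄ hF₄ => ?_
  · intro r _
    by_cases r1 : r = 1
    · simp [r1, f1]
    by_cases r2 : r = 2
    · simp [r2, f4]
    by_cases r3 : r = 3
    · simp [r3, h₃]
    rw [hF₃.nat r (by simpa [ceilInv, block, Prog.natWrites, Instr.natWrites] using r3),
      hF₂.nat r (by simpa [ceilInv, block, Prog.natWrites, Instr.natWrites] using r2),
      hF₁.nat r (by simpa [block, Prog.natWrites, Instr.natWrites] using r1)]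
    by_cases r0 : r = 0 <;> simp [inputState, r0, r1, r2, r3]
  obtain ⟨p0, p1, p4, p5, p6, p7, p8, p9, p10, p11⟩ := natEval_paramOps (k := k) (q := q) (d := d)
    (f := fun r => if r = 0 then k else if r = 1 then 1
      else if r = 2 then q else if r = 3 then d else 0) rfl rfl rfl rfl
  rw [← h₄ _ (by decide)] at p0 p1 p4 p5 p6 p7 p8 p9 p10 p11
  have g2 := (hF₄.real 2 (by decide)).trans f2
  have g0 := (hF₄.real 0 (by decide)).trans f3
  clear h₄ hF₄ hF₃ hF₂ hF₁
  refine Runs.seq (runs_natToReal p1 g2 (by decide) (by decide) p4) fun s₅ h₅ hF₅ => ?_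
  refine Runs.seq (Runs.instr (Q := fun s₆ => s₆.real 3 = 1 / invTol k q)
    (by simp [Instr.apply, Op.eval, h₅, hF₅.real 2 (by decide), g2])) fun s₆ h₆ hF₆ => ?_
  have hF := hF₅.seq_left.trans hF₆.seq_right
  refine Runs.seq (runs_natToReal (a := invMesh k q) (by rw [hF.nat 1 (by decide), p1])
    (by rw [hF.real 2 (by decide), g2]) (by decide) (by decide) (by rw [hF.nat 5 (by decide), p5]))
    fun s₇ h₇ hF₇ => ?_
  replace hF := hF.seq_left.trans hF₇.seq_right
  refine Runs.seq (Runs.instr (Q := fun s₈ => s₈.real 4 = 1 / invMesh k q)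
    (by simp [Instr.apply, Op.eval, h₇, hF.real 2 (by decide), g2])) fun s₈ h₈ hF₈ => ?_
  replace hF := hF.seq_left.trans hF₈.seq_right
  refine Runs.seq (runs_natToReal (a := gridBound k q) (by rw [hF.nat 1 (by decide), p1])
    (by rw [hF.real 2 (by decide), g2]) (by decide) (by decide) (by rw [hF.nat 7 (by decide), p7]))
    fun s₉ h₉ hF₉ => ?_
  replace hF := hF.seq_left.trans hF₉.seq_right
  refine Runs.seq (runs_natToReal (a := sampleSize k q d) (by rw [hF.nat 1 (by decide), p1])
    (by rw [hF.real 2 (by decide), g2]) (by decide) (by decide) (by rw [hF.nat 6 (by decide), p6]))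
    fun s₁₀ h₁₀ hF₁₀ => ?_
  replace hF := hF.seq_left.trans hF₁₀.seq_right
  have k0 := (hF.real 0 (by decide)).trans g0
  refine (runs_block (Q := fun s' => s'.real 5 = ε / 2 ∧ s'.real 6 = 2 / ε ∧
    s'.real 7 = -(2 / ε) ∧ s'.real 10 = 0) (by simp [Instr.apply, Op.eval, k0])).mono
    (by simp) fun s₁₁ hF₁₁ h₁₁ => ?_
  have hF' := hF.seq_left.trans hF₁₁.seq_right
  constructor
  · rw [hF'.nat _ (by decide), p0]
  · rw [hF'.nat _ (by decide), p1]
  · rw [hF'.nat _ (by decide), p6]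
  · rw [hF'.nat _ (by decide), p7]
  · rw [hF'.nat _ (by decide), p8]
  · rw [hF'.nat _ (by decide), p9]
  · rw [hF'.nat _ (by decide), p10]
  · rw [hF'.nat _ (by decide), p11]
  · rw [hF'.real _ (by decide), g2]
  · rw [hF₁₁.real _ (by decide), hF₁₀.real _ (by decide), hF₉.real _ (by decide),
      hF₈.real _ (by decide), hF₇.real _ (by decide), h₆]
  · rw [hF₁₁.real _ (by decide), hF₁₀.real _ (by decide), hF₉.real _ (by decide), h₈]
  · exact h₁₁.1
  · exact h₁₁.2.1
  · exact h₁₁.2.2.1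
  · rw [hF₁₁.real _ (by decide), hF₁₀.real _ (by decide), h₉]
  · rw [hF₁₁.real _ (by decide), h₁₀]
  · exact h₁₁.2.2.2

/-- The test differs from the definition of a match in three harmless ways: variances are compared
with the mesh width, only pairs j < i are examined, and moment 0 is compared as well, where both
sides equal one because m ≠ 0. -/
theorem passes_iff {m : ℕ} {c b : ℕ → ℝ} (hk : 1 ≤ k) (hq : 1 ≤ q) (hε : 0 < ε) (hm : m ≠ 0)
    (hb : ∀ j < k + k + (k + k) - 1, b j = sampleMoment x m j)
    (hc : ∀ i < k + k + k, ∃ z : ℤ, c i = z * (1 / (invMesh k q : ℝ))) :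
    Passes k q ε c b ↔
      IsMatch ε (1 / (invTol k q : ℝ)) (1 / (invMesh k q : ℝ)) x m (ofArray k c) := by
  have hN : (0 : ℝ) < 1 / invMesh k q := by
    have := invMesh_pos hk hq
    positivity
  have hA : (0 : ℝ) ≤ 1 / invTol k q := by positivity
  have hsum : ∑ i ∈ Finset.range k, c i = ∑ i, (ofArray k c).w i := Finset.sum_range _
  have hraw : (ofArray k c).IsGMM → ∀ j, ∑ i ∈ Finset.range k,
      c i * gaussMoment j (c (i + k)) (c (i + k + k)) = (ofArray k c).rawMoment j := by
    intro h j
    rw [Params.rawMoment_eq h, Finset.sum_range]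
    rfl
  constructor
  · rintro ⟨h1, h2, h3, h4⟩
    have hG : (ofArray k c).IsGMM :=
      ⟨fun i => by have := (h1 i i.2).1; simp only [ofArray]; linarith, hsum ▸ h3,
        fun i => hN.trans_le (h1 i i.2).2.2.2.1⟩
    refine ⟨⟨hG, ⟨fun i => (h1 i i.2).1, fun i j hij => ?_⟩, fun i => ⟨?_, ?_⟩, fun i =>
      ⟨hc _ (by omega), hc _ (by omega), hc _ (by omega)⟩⟩, fun j hj => ?_⟩
    · rcases lt_or_gt_of_ne (Fin.val_ne_of_ne hij) with h | h
      · have := h2 j j.2 i h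
        rwa [abs_sub_comm, abs_sub_comm (c (j + k + k))] at this
      · exact h2 i i.2 j h
    · exact abs_le.2 ⟨(h1 i i.2).2.2.1, (h1 i i.2).2.1⟩
    · exact abs_le.2 ⟨by have := (h1 i i.2).2.2.2.1; have : 0 < 2 / ε := (by positivity)
                         simp only [ofArray]; linarith, (h1 i i.2).2.2.2.2⟩
    · rw [Finset.mem_Icc] at hj
      have := h4 j (by omega)
      rwa [hraw hG, hb j (by omega)] at this
  · rintro ⟨⟨hG, ⟨h1, h2⟩, h3, -⟩, h4⟩
    refine ⟨fun i hi => ⟨h1 ⟨i, hi⟩, (abs_le.1 (h3 ⟨i, hi⟩).1).2, (abs_le.1 (h3 ⟨i, hi⟩).1).1,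
      ?_, (abs_le.1 (h3 ⟨i, hi⟩).2).2⟩, fun i hi j hj => h2 ⟨i, hi⟩ ⟨j, by omega⟩
        (by simp; omega), hsum ▸ hG.2.1, fun j hj => ?_⟩
    · obtain ⟨z, hz⟩ := hc (i + k + k) (by omega)
      have : 0 < c (i + k + k) := hG.2.2 ⟨i, hi⟩
      rw [hz] at this ⊢
      have hz0 : (0 : ℝ) < z := pos_of_mul_pos_left this hN.le
      have hz1 : (1 : ℝ) ≤ z := by exact_mod_cast (Int.cast_pos.1 hz0 : 0 < z)
      exact le_mul_of_one_le_left hN.le hz1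
    · rw [hb j hj]
      rcases Nat.eq_zero_or_pos j with rfl | hj0
      · have : (m : ℝ) ≠ 0 := by exact_mod_cast hm
        simp [gaussMoment, hsum, hG.2.1, sampleMoment, this]
      · rw [hraw hG]
        exact h4 j (Finset.mem_Icc.2 ⟨hj0, by omega⟩)

/-- Shifted by `gridBound k q`, the numerators become digits below `gridSize k q`, and t is the
number with these digits. -/
theorem exists_gridCoord_eq {g : ℕ → ℝ}
    (hg : ∀ i < k + k + k, ∃ z : ℤ, |z| ≤ gridBound k q ∧ g i = z * (1 / (invMesh k q : ℝ))) :
    ∃ t < numCandidates k q, ∀ i < k + k + k, gridCoord k q t i = g i := by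
  choose! z hz hgz using hg
  have hD : ∀ i : Fin (k + k + k), (z i + gridBound k q).toNat < gridSize k q := fun i => by
    have := abs_le.1 (hz i i.2)
    simp only [gridSize]
    omega
  refine ⟨finFunctionFinEquiv fun i => ⟨_, hD i⟩, Fin.is_lt _, fun i hi => ?_⟩
  have h := congrArg Fin.val (congrFun
    (finFunctionFinEquiv.symm_apply_apply fun i : Fin (k + k + k) => (⟨_, hD i⟩ : Fin _)) ⟨i, hi⟩)
  rw [finFunctionFinEquiv_symm_apply_val] at h
  rw [gridCoord, h, hgz i hi]
  have := abs_le.1 (hz i hi)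
  have h' : (((z i + gridBound k q).toNat : ℤ) : ℝ) = z i + gridBound k q := by
    rw [Int.toNat_of_nonneg (by omega)]
    push_cast
    rfl
  simp only [Int.cast_natCast] at h'
  rw [h']
  ring

/-- All parameters of a candidate are at most 2/ε ≤ 2 q in absolute value and its weights are at
most 1, so their numerators respect `gridBound k q`: the enumeration misses no candidate. -/
theorem Params.IsCandidate.exists_gridCoord {G : Params k} (hq : 1 ≤ q) (hk : 1 ≤ k) (hε : 0 < ε)
    (hqε : 1 ≤ q * ε) (hG : G.IsCandidate ε (1 / (invMesh k q : ℝ))) :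
    ∃ t < numCandidates k q, ofArray k (gridCoord k q t) = G := by
  have hN : (0 : ℝ) < invMesh k q := by exact_mod_cast invMesh_pos hk hq
  have hq2 : 2 / ε ≤ (q + q : ℝ) := by
    rw [div_le_iff₀ hε]
    linarith
  have hq1 : (1 : ℝ) ≤ q + q := by
    have : (1 : ℝ) ≤ q := by exact_mod_cast hq
    linarith
  have hint : ∀ u : ℝ, |u| ≤ q + q → (∃ z : ℤ, u = z * (1 / (invMesh k q : ℝ))) →
      ∃ z : ℤ, |z| ≤ gridBound k q ∧ u = z * (1 / (invMesh k q : ℝ)) := by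
    rintro u hu ⟨z, hz⟩
    refine ⟨z, ?_, hz⟩
    have : (|z| : ℝ) ≤ gridBound k q := by
      have e : (z : ℝ) = u * invMesh k q := by rw [hz]; field_simp
      rw [e, abs_mul, abs_of_pos hN, gridBound]
      push_cast
      gcongr
    exact_mod_cast this
  obtain ⟨⟨hw, hsum, hv⟩, -, hbd, hz⟩ := hG
  have hw1 : ∀ i, |G.w i| ≤ q + q := fun i => by
    rw [abs_of_nonneg (hw i)]
    exact (hsum ▸ Finset.single_le_sum (fun i _ => hw i) (Finset.mem_univ i)).trans hq1
  obtain ⟨t, ht, h⟩ := exists_gridCoord_eq (k := k) (q := q) (g := fun i =>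
    if h : i < k then G.w ⟨i, h⟩ else if h : i - k < k then G.μ ⟨i - k, h⟩ else
      if h : i - k - k < k then G.v ⟨i - k - k, h⟩ else 0) (by
    intro i hi
    by_cases h1 : i < k
    · simpa only [dif_pos h1] using hint _ (hw1 _) (hz _).1
    by_cases h2 : i - k < k
    · simpa only [dif_neg h1, dif_pos h2] using hint _ ((hbd _).1.trans hq2) (hz _).2.1
    · simpa only [dif_neg h1, dif_neg h2, dif_pos (show i - k - k < k by omega)] using
        hint _ ((hbd _).2.trans hq2) (hz _).2.2)
  refine ⟨t, ht, ?_⟩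
  obtain ⟨w, μ, v⟩ := G
  simp only [ofArray, Params.mk.injEq]
  refine ⟨funext fun i => ?_, funext fun i => ?_, funext fun i => ?_⟩
  · rw [h _ (by omega)]
    simp
  · rw [h _ (by omega)]
    simp
  · rw [h _ (by omega)]
    simp

/-- Trying all candidates. -/
def searchProg : Prog :=
  forLoop 60 61 9 (.seq decodeProg (.seq testProg copyProg))

/-- A bound on the time for the search. -/
def searchCost (k q : ℕ) : ℕ :=
  numCandidates k q * (((2 + ((k + k + k) * (((3 * numCandidates k q + 2) +
    ((4 * gridSize k q + 4) + 5)) + 3) + 3)) + (testCost k + (1 + ((k * (8 + 3) + 3) + 1)))) + 3)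
    + 3

/-- The invariant after l rounds: if one of the first l grid points is a match, the current output
is a match. Exhausting the grid then covers every match. -/
theorem runs_searchProg {s : State} {m : ℕ} (h : Ready k q d ε s) (hk : 1 ≤ k) (hq : 1 ≤ q)
    (hε : 0 < ε) (hqε : 1 ≤ q * ε) (hm : m ≠ 0)
    (hs : ∀ j < k + k + (k + k) - 1, s.arr 3 j = sampleMoment x m j) :
    Runs x searchProg s (searchCost k q) fun s' =>
      (∃ G : Params k, IsMatch ε (1 / (invTol k q : ℝ)) (1 / (invMesh k q : ℝ)) x m G) →
        IsMatch ε (1 / (invTol k q : ℝ)) (1 / (invMesh k q : ℝ)) x m (s'.output k) := by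
  refine (runs_forLoop (N := numCandidates k q) (fun l s' => (∃ t < l, IsMatch ε
    (1 / (invTol k q : ℝ)) (1 / (invMesh k q : ℝ)) x m (ofArray k (gridCoord k q t))) →
      IsMatch ε (1 / (invTol k q : ℝ)) (1 / (invMesh k q : ℝ)) x m (s'.output k))
    (by decide) (by decide) (by decide) (by decide) h.n1 h.n9 (by simp) ?_).mono le_rfl ?_
  · intro t ht s' hI h60 _ hF
    have h' := h.of_frame hF (by decide) (by decide)
    refine Runs.seq ((runs_decodeProg h' h60).mono (by gcongr) fun _ _ h => h)
      fun s₁ h₁ hF₁ => ?_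
    have g₁ := h'.of_frame hF₁ (by decide) (by decide)
    refine Runs.seq (runs_testProg g₁ hk) fun s₂ h₂ hF₂ => ?_
    have g₂ := g₁.of_frame hF₂ (by decide) (by decide)
    refine (runs_copyProg g₂).mono le_rfl fun s₃ _ h₃ => ?_
    have e4 : ofArray k (s₁.arr 4) = ofArray k (gridCoord k q t) := by
      simp only [ofArray, Params.mk.injEq]
      exact ⟨funext fun i => h₁ _ (by omega), funext fun i => h₁ _ (by omega),
        funext fun i => h₁ _ (by omega)⟩
    have e3 : s₁.arr 3 = s.arr 3 := (hF₁.arr 3 (by decide)).trans (hF.arr 3 (by decide))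
    have eo : s₂.output k = s'.output k := by
      simp only [State.output]
      rw [hF₂.arr 0 (by decide), hF₂.arr 1 (by decide), hF₂.arr 2 (by decide),
        hF₁.arr 0 (by decide), hF₁.arr 1 (by decide), hF₁.arr 2 (by decide)]
    rw [passes_iff (x := x) hk hq hε hm (fun j hj => by rw [e3, hs j hj]) (fun i hi => by
      rw [h₁ i hi]
      refine ⟨((t / gridSize k q ^ i % gridSize k q : ℕ) : ℤ) - gridBound k q, ?_⟩
      rw [gridCoord]
      push_cast
      rfl), e4] at h₂
    rw [hF₂.arr 4 (by decide), e4, eo] at h₃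
    rintro ⟨t', ht', hM⟩
    change IsMatch _ _ _ _ _ (s₃.output k)
    by_cases h50 : s₂.nat 50 = 0
    · rw [h₃.1 h50]
      exact h₂.1 h50
    · rw [h₃.2 h50]
      refine hI ⟨t', ?_, hM⟩
      rcases Nat.lt_succ_iff_lt_or_eq.1 ht' with h | rfl
      · exact h
      · exact absurd (h₂.2 hM) h50
  · rintro s' - h' ⟨G, hG⟩
    obtain ⟨t, ht, rfl⟩ := hG.1.exists_gridCoord hq hk hε hqε
    exact h' ⟨t, ht, hG⟩

/-- The complete program. -/
def mainProg : Prog :=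
  .seq setupProg (.seq samplesProg (.seq normalizeProg searchProg))

/-- A bound on the running time of the complete program. -/
def mainCost (k q d : ℕ) : ℕ :=
  setupCost k q d + ((sampleSize k q d * ((2 + ((k + k + (k + k)) * 7 + 3)) + 3) + 3) +
    (((k + k + (k + k)) * 6 + 3) + searchCost k q))

theorem runs_mainProg {δ : ℝ} (hk : 1 ≤ k) (hε : 0 < ε) (hδ : 0 < δ) (hq : ⌊1 / ε⌋₊ + 1 = q)
    (hd : ⌊1 / δ⌋₊ + 1 = d) :
    Runs x mainProg (inputState k ε δ) (mainCost k q d) fun s' => s'.pos = sampleSize k q d ∧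
      ((∃ G : Params k, IsMatch ε (1 / (invTol k q : ℝ)) (1 / (invMesh k q : ℝ)) x
          (sampleSize k q d) G) →
        IsMatch ε (1 / (invTol k q : ℝ)) (1 / (invMesh k q : ℝ)) x (sampleSize k q d)
          (s'.output k)) := by
  have hq1 : 1 ≤ q := by omega
  have hqε : 1 ≤ q * ε := by
    have := Nat.lt_floor_add_one (1 / ε)
    rw [div_lt_iff₀ hε] at this
    rw [← hq]
    push_cast
    exact this.le
  have hm : sampleSize k q d ≠ 0 := by
    have := invMesh_pos hk hq1
    have : 0 < d := by omega
    rw [sampleSize]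
    positivity
  refine Runs.seq (runs_setupProg hε hδ hq hd) fun s₁ g₁ hF₁ => ?_
  refine Runs.seq (runs_samplesProg g₁ ((hF₁.pos (by decide)).trans rfl)
    ((hF₁.arr 3 (by decide)).trans rfl)) fun s₂ h₂ hF₂ => ?_
  have g₂ := g₁.of_frame hF₂ (by decide) (by decide)
  refine Runs.seq (runs_normalizeProg g₂) fun s₃ h₃ hF₃ => ?_
  have g₃ := g₂.of_frame hF₃ (by decide) (by decide)
  refine (runs_searchProg g₃ hk hq1 hε hqε hm fun j hj => ?_).mono le_rfl fun s₄ hF₄ h₄ =>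
    ⟨?_, h₄⟩
  · rw [h₃ j hj, h₂.2 j hj, sampleMoment]
  · rw [hF₄.pos (by decide), hF₃.pos (by decide), h₂.1]

end

/-! ### Polynomial bounds -/

/-- Functions of two positive integers bounded by a power of their product, up to a constant. -/
def PolyBdd (f : ℕ → ℕ → ℕ) : Prop :=
  ∃ C a : ℕ, ∀ q d, 1 ≤ q → 1 ≤ d → f q d ≤ C * (q * d) ^ a

namespace PolyBdd

variable {f g : ℕ → ℕ → ℕ}

theorem const (c : ℕ) : PolyBdd fun _ _ => c :=
  ⟨c, 0, fun _ _ _ _ => by simp⟩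

theorem fst : PolyBdd fun q _ => q :=
  ⟨1, 1, fun q d _ hd => by simpa using Nat.le_mul_of_pos_right q hd⟩

theorem snd : PolyBdd fun _ d => d :=
  ⟨1, 1, fun q d hq _ => by simpa using Nat.le_mul_of_pos_left d hq⟩

theorem add (hf : PolyBdd f) (hg : PolyBdd g) : PolyBdd fun q d => f q d + g q d := by
  obtain ⟨C, a, h⟩ := hf
  obtain ⟨C', a', h'⟩ := hg
  refine ⟨C + C', a + a', fun q d hq hd => ?_⟩
  have hqd : 1 ≤ q * d := Nat.mul_pos hq hd
  have h1 := Nat.pow_le_pow_right hqd (Nat.le_add_right a a')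
  have h2 := Nat.pow_le_pow_right hqd (Nat.le_add_left a' a)
  calc f q d + g q d ≤ C * (q * d) ^ (a + a') + C' * (q * d) ^ (a + a') :=
        Nat.add_le_add ((h q d hq hd).trans (Nat.mul_le_mul_left C h1))
          ((h' q d hq hd).trans (Nat.mul_le_mul_left C' h2))
    _ = _ := by ring

theorem mul (hf : PolyBdd f) (hg : PolyBdd g) : PolyBdd fun q d => f q d * g q d := by
  obtain ⟨C, a, h⟩ := hf
  obtain ⟨C', a', h'⟩ := hg
  refine ⟨C * C', a + a', fun q d hq hd => ?_⟩
  calc f q d * g q d ≤ (C * (q * d) ^ a) * (C' * (q * d) ^ a') :=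
        Nat.mul_le_mul (h q d hq hd) (h' q d hq hd)
    _ = _ := by ring

theorem pow (hf : PolyBdd f) (n : ℕ) : PolyBdd fun q d => f q d ^ n := by
  induction n with
  | zero => simpa using const 1
  | succ n ih => simpa only [pow_succ] using ih.mul hf

end PolyBdd

section

variable (k : ℕ)

theorem polyBdd_invTol : PolyBdd fun q _ => invTol k q :=
  ((PolyBdd.const _).mul .fst).pow _

theorem polyBdd_invMesh : PolyBdd fun q _ => invMesh k q :=
  (polyBdd_invTol k).mul (polyBdd_invTol k)

theorem polyBdd_sampleSize : PolyBdd fun q d => sampleSize k q d :=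
  ((polyBdd_invMesh k).mul (polyBdd_invMesh k)).mul .snd

theorem polyBdd_gridBound : PolyBdd fun q _ => gridBound k q :=
  (PolyBdd.fst.add .fst).mul (polyBdd_invMesh k)

theorem polyBdd_gridSize : PolyBdd fun q _ => gridSize k q :=
  ((polyBdd_gridBound k).add (polyBdd_gridBound k)).add (.const 1)

theorem polyBdd_numCandidates : PolyBdd fun q _ => numCandidates k q :=
  (polyBdd_gridSize k).pow _

/-- After unfolding, the cost is built from q and d by sums, products and powers whose exponents
depend on k only. -/
theorem polyBdd_paramCost : PolyBdd fun q d => paramCost k q d := by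
  simp [paramCost, paramOps, natCost, NatOp.cost, NatOp.eval]
  repeat with_reducible first
    | exact .const _ | exact .fst | exact .snd | apply PolyBdd.add | apply PolyBdd.mul
    | apply PolyBdd.pow

theorem polyBdd_mainCost : PolyBdd fun q d => mainCost k q d := by
  unfold mainCost setupCost searchCost
  repeat with_reducible first
    | exact .const _ | exact .fst | exact .snd | exact polyBdd_invTol k | exact polyBdd_invMesh k
    | exact polyBdd_sampleSize k | exact polyBdd_gridBound k | exact polyBdd_gridSize k
    | exact polyBdd_numCandidates k | exact polyBdd_paramCost k
    | apply PolyBdd.add | apply PolyBdd.mul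

end

end UnivariateGMM

/-! ### The main theorem -/

open MeasureTheory ProbabilityTheory
open UnivariateGMM in
theorem mainTheorem6 :
    -- one program, its sample size, matching tolerance and mesh width, and for every number of
    -- components the constant and the exponent of the polynomial bounds
    ∃ (A : Prog) (m : ℕ → ℝ → ℝ → ℕ) (α γ : ℕ → ℝ → ℝ) (C : ℕ → ℝ) (a : ℕ → ℕ),
      ∀ k : ℕ, 1 ≤ k → ∀ ε δ : ℝ, 0 < ε → ε ≤ 1 → 0 < δ → δ ≤ 1 →
        -- polynomial sample size, tolerance and mesh
        (m k ε δ : ℝ) ≤ C k * (1 / (ε * δ)) ^ a k ∧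
        0 < α k ε ∧ α k ε ≤ ε ∧ 1 / α k ε ≤ C k * (1 / ε) ^ a k ∧
        0 < γ k ε ∧ 1 / γ k ε ≤ C k * (1 / ε) ^ a k ∧
        ∃ out : (ℕ → ℝ) → Params k,
          -- on every sequence of samples the program halts in polynomial time, having drawn
          -- `m k ε δ` samples, with output `out x`
          (∀ x : ℕ → ℝ, ∃ (n : ℕ) (s : State), Exec x A (inputState k ε δ) n s ∧
            (n : ℝ) ≤ C k * (1 / (ε * δ)) ^ a k ∧ s.pos = m k ε δ ∧ s.output k = out x) ∧
          -- the output is the result of a brute-force search for a matching candidate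
          (∀ x : ℕ → ℝ,
            (∃ G : Params k, IsMatch ε (α k ε) (γ k ε) x (m k ε δ) G) →
              IsMatch ε (α k ε) (γ k ε) x (m k ε δ) (out x)) ∧
          -- on independent samples from an admissible mixture, the probability that the search
          -- fails or that its result is not `ε`-accurate is at most `δ`
          (∀ F : Params k, F.IsGMM → F.IsSeparated ε →
            ∫ y, y ∂F.law = 0 → Var[id; F.law] ∈ Set.Icc (1 / 2) 2 →
            ∀ {Ω : Type*} [MeasurableSpace Ω] (P : Measure Ω) [IsProbabilityMeasure P]
              (X : ℕ → Ω → ℝ), (∀ l, Measurable (X l)) → iIndepFun X P →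
              (∀ l, P.map (X l) = F.law) →
              P {ω | ¬ (IsMatch ε (α k ε) (γ k ε) (fun l => X l ω) (m k ε δ)
                    (out fun l => X l ω) ∧
                  F.Close ε (out fun l => X l ω))} ≤ ENNReal.ofReal δ) := by

  -- One constant and exponent bound the sum, hence each, of running time, sample size, inverse
  -- tolerance and inverse mesh.
  choose C a hCa using fun k => (((polyBdd_mainCost k).add (polyBdd_sampleSize k)).add
    (polyBdd_invTol k)).add (polyBdd_invMesh k)
  refine ⟨mainProg, fun k ε δ => sampleSize k (⌊1 / ε⌋₊ + 1) (⌊1 / δ⌋₊ + 1),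
    fun k ε => 1 / (invTol k (⌊1 / ε⌋₊ + 1) : ℝ), fun k ε => 1 / (invMesh k (⌊1 / ε⌋₊ + 1) : ℝ),
    fun k => C k * 4 ^ a k, a, fun k hk ε δ hε hε1 hδ hδ1 => ?_⟩
  obtain ⟨q, hq⟩ : ∃ q, ⌊1 / ε⌋₊ + 1 = q := ⟨_, rfl⟩
  obtain ⟨d, hd⟩ : ∃ d, ⌊1 / δ⌋₊ + 1 = d := ⟨_, rfl⟩
  -- The roundings satisfy q ≤ 2/ε and d ≤ 2/δ; hence the factor 4 ^ a k in the constant.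
  have key : ∀ {e : ℝ} {n : ℕ}, 0 < e → e ≤ 1 → ⌊1 / e⌋₊ + 1 = n →
      1 ≤ n ∧ 1 ≤ n * e ∧ (n : ℝ) ≤ 2 * (1 / e) := by
    intro e n he he1 hn
    have hn' : (n : ℝ) = ⌊1 / e⌋₊ + 1 := by exact_mod_cast hn.symm
    have h1 := Nat.lt_floor_add_one (1 / e)
    have h2 := Nat.floor_le (show 0 ≤ 1 / e by positivity)
    have h3 : 1 ≤ 1 / e := by rwa [le_div_iff₀ he, one_mul]
    rw [div_lt_iff₀ he] at h1
    rw [hn']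
    exact ⟨by omega, h1.le, by linarith⟩
  obtain ⟨hq1, hqε, hq2⟩ := key hε hε1 hq
  obtain ⟨hd1, hdδ, hd2⟩ := key hδ hδ1 hd
  have hT := invTol_pos hk hq1
  have hM := invMesh_pos hk hq1
  -- the polynomial bounds
  have hbd : ∀ {n : ℕ}, n ≤ C k * (q * d) ^ a k →
      (n : ℝ) ≤ C k * 4 ^ a k * (1 / (ε * δ)) ^ a k := by
    intro n hn
    calc (n : ℝ) ≤ C k * (q * d : ℝ) ^ a k := by exact_mod_cast hn
      _ ≤ C k * ((2 * (1 / ε)) * (2 * (1 / δ))) ^ a k := by gcongr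
      _ = _ := by rw [mul_assoc (C k : ℝ), ← mul_pow]; congr 2; field_simp; norm_num
  have hbd' : ∀ {n : ℕ}, n ≤ C k * (q * 1) ^ a k →
      (n : ℝ) ≤ C k * 4 ^ a k * (1 / ε) ^ a k := by
    intro n hn
    calc (n : ℝ) ≤ C k * (q : ℝ) ^ a k := by exact_mod_cast (by simpa using hn)
      _ ≤ C k * (4 * (1 / ε)) ^ a k := by
        gcongr
        exact hq2.trans (by gcongr; norm_num)
      _ = _ := by rw [mul_assoc (C k : ℝ), ← mul_pow]
  have hall := hCa k q d hq1 hd1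
  -- Tolerance and mesh do not depend on δ, so setting d = 1 yields bounds in 1/ε alone.
  have hall' := hCa k q 1 hq1 le_rfl
  dsimp only at hall hall' ⊢
  rw [hq, hd]
  have hrun := fun x => runs_mainProg (x := x) hk hε hδ hq hd
  choose n s hexec hn hpos hout using hrun
  refine ⟨hbd (by omega), by positivity, ?_, ?_, by positivity, ?_, fun x => (s x).output k,
    fun x => ⟨n x, s x, hexec x, hbd ((hn x).trans (by omega)), hpos x, rfl⟩, hout, ?_⟩
  · rw [div_le_iff₀ (by positivity)]
    -- Since q ε ≥ 1, this gives that the tolerance is at most ε.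
    have h1 : (q : ℝ) ≤ invTol k q := by
      have := baseScale_le_invTol hk hq1
      have h2 : q ≤ baseScale k q := Nat.le_mul_of_pos_left q (by omega)
      exact_mod_cast h2.trans this
    nlinarith
  · rw [one_div_one_div]
    exact hbd' (by omega)
  · rw [one_div_one_div]
    exact hbd' (by omega)
  · intro F hF hsep hmean hvar Ω _ P _ X hX hind hlaw
    have hF2 := Params.sq_add_le_of_variance hF hε hsep hmean hvar.2
    -- Failure is contained in the event that some sample moment is off by at least half the
    -- tolerance: otherwise a match exists, the search finds one, and every match is accurate.
    refine (measure_mono fun ω hω => ?_).trans (Params.measure_not_typical_le hk hq1 hd1 hε hqε hε1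
      hdδ hF hF2 P hX hind hlaw)
    by_contra hnot
    simp only [Set.mem_ofPred_eq, not_exists, not_and, not_le] at hnot
    have hmatch := hout (fun l => X l ω) (Params.exists_isMatch hk hq1 hε hqε hε1 hF hsep hF2 hnot)
    exact hω ⟨hmatch, Params.close_of_isMatch hk hq1 hε hqε hε1 hF hsep hF2 hmatch hnot⟩
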